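/- Let $d\in\mathbb N$, $k,r\in\mathbb N^*$, let $\Omega$ be an open neighbourhood of $0$ in $\mathbb R^d$ and let $f_0,\dots,f_r:\Omega\to\mathbb R^d$ be real-analytic vector fields with $f_0(0)=0$. Consider the control-affine system $$x'(t)=f_0(x(t))+\sum_{\ell=1}^r u^\ell(t)f_\ell(x(t)),\qquad x(0)=0,\tag{S}$$ and, for $T>0$ and $u\in L^1((0,T),\mathbb R)^r$, denote by $x(\cdot;u)$ its maximal mild solution, i.e. the maximal continuous $\Omega$-valued solution of $x(t)=\int_0^t\big(f_0(x(s))+\sum_\ell u^\ell(s)f_\ell(x(s))\big)\,ds$. For $m\in\mathbb N$, the system (S) is called $H^m$-STLC around $0$ if for all $T,\varepsilon>0$ there exists $\delta>0$ such that for every $x_f\in B(0,\delta)$ there exists $u\in H^m((0,T),\mathbb R)^r\cap L^1((0,T),\mathbb R)^r$ with $\|u\|_{H^m}\le\varepsilon$ such that $x(\cdot;u)$ is defined on $[0,T]$ and $x(T;u)=x_f$. Let $\mathcal L(X)$ be the free Lie algebra over $\mathbb R$ on the indeterminates $X_0,\dots,X_r$. For $b\in\mathcal L(X)$ let $f_b:=\Lambda(b)$,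 where $\Lambda:\mathcal L(X)\to C^\infty(\Omega,\mathbb R^d)$ is the unique homomorphism of Lie algebras with $\Lambda(X_i)=f_i$ for $0\le i\le r$, the bracket of vector fields being $[f,g](x)=Dg(x)f(x)-Df(x)g(x)$. For $\nu\in\mathbb N$ let $b0^\nu:=[\cdots[b,X_0],\dots,X_0]$ with $X_0$ appearing $\nu$ times. Define, for $l\in\mathbb N$, $$M^\ell_l:=X_\ell 0^l\quad(1\le\ell\le r),\qquad W^\ell_{p,l}:=[M^\ell_{p-1},M^\ell_p]0^l\quad(1\le\ell\le r,\ p\ge1),$$ $$C^{\ell,L}_{p,l}:=(-1)^p\big[M^\ell_{\lfloor (p+1)/2\rfloor},M^L_{\lfloor p/2\rfloor}\big]0^l\quad(1\le\ell<L\le r,\ p\ge0),$$ and let $\mathcal N_k\subseteq\mathbb R^d$ be the sum of the three subspaces $$\mathrm{Span}\{f_{M^\ell_l}(0):1\le\ell\le r,\ l\ge0\},\qquad \mathrm{Span}\{f_{W^\ell_{p,l}}(0):1\le\ell\le r,\ 1\le p\le k-1,\ l\ge0\},$$ $$\mathrm{Span}\{f_{C^{\ell,L}_{p,l}}(0):1\le\ell<L\le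 r,\ 0\le p\le 2k-2,\ l\ge0\}.$$ Theorem. Assume that there exists a linear form $\mathbb P$ on $\mathbb R^d$ that vanishes on $\mathcal N_k$ and such that $$(a_1,\dots,a_r)\in\mathbb R^r\mapsto\sum_{\ell=1}^r\mathbb P\big(f_{W^\ell_{k,0}}(0)\big)\frac{a_\ell^2}{2}+\sum_{1\le\ell<L\le r}\mathbb P\big(f_{C^{\ell,L}_{2k-1,0}}(0)\big)a_\ell a_L$$ is a definite (positive definite or negative definite) quadratic form on $\mathbb R^r$. Then the system (S) is not $H^{2k}$-STLC around $0$. -/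

import Mathlib

open scoped ContDiff
open MeasureTheory

noncomputable section

namespace QuadObstruction

/-! ### The Lie algebra of smooth vector fields on an open subset of `ℝ^d` -/

/-- Smooth vector fields on the open set `Ω ⊆ ℝ^d`. A function on `Ω` is represented by its
extension by `0` to the whole space, so that each vector field on `Ω` has exactly one
representative. -/
def smoothVectorFields {d : ℕ} (Ω : TopologicalSpace.Opens (EuclideanSpace ℝ (Fin d))) :
    Submodule ℝ (EuclideanSpace ℝ (Fin d) → EuclideanSpace ℝ (Fin d)) where
  carrier := {f | ContDiffOn ℝ ∞ f (Ω : Set (EuclideanSpace ℝ (Fin d))) ∧ ∀ x, x ∉ Ω → f x = 0}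
  zero_mem' := ⟨contDiffOn_const, fun _ _ => rfl⟩
  add_mem' := by
    rintro f g ⟨hf, hf0⟩ ⟨hg, hg0⟩
    exact ⟨hf.add hg, fun x hx => by simp [hf0 x hx, hg0 x hx]⟩
  smul_mem' := by
    rintro c f ⟨hf, hf0⟩
    exact ⟨contDiffOn_const.smul hf, fun x hx => by simp [hf0 x hx]⟩

/-- The type of smooth vector fields on `Ω`. -/
abbrev SmoothVectorField {d : ℕ} (Ω : TopologicalSpace.Opens (EuclideanSpace ℝ (Fin d))) : Type :=
  ↥(smoothVectorFields Ω)

section LieAlgebra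

variable {d : ℕ} {Ω : TopologicalSpace.Opens (EuclideanSpace ℝ (Fin d))}

theorem SmoothVectorField.contDiffAt (f : SmoothVectorField Ω) {x : EuclideanSpace ℝ (Fin d)}
    (hx : x ∈ Ω) : ContDiffAt ℝ ∞ f.1 x :=
  f.2.1.contDiffAt (Ω.isOpen.mem_nhds hx)

theorem SmoothVectorField.differentiableAt (f : SmoothVectorField Ω)
    {x : EuclideanSpace ℝ (Fin d)} (hx : x ∈ Ω) : DifferentiableAt ℝ f.1 x :=
  (f.contDiffAt hx).differentiableAt (by simp)

/-- The Lie bracket `[f, g] (x) = Dg(x) f(x) - Df(x) g(x)`, for `x ∈ Ω`. -/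
instance : Bracket (SmoothVectorField Ω) (SmoothVectorField Ω) where
  bracket f g :=
    ⟨(Ω : Set (EuclideanSpace ℝ (Fin d))).indicator
        (fun x => fderiv ℝ g.1 x (f.1 x) - fderiv ℝ f.1 x (g.1 x)), by
      constructor
      · intro x hx
        have h : ContDiffAt ℝ ∞ (VectorField.lieBracket ℝ f.1 g.1) x :=
          (f.contDiffAt hx).lieBracket_vectorField (n := ∞) (g.contDiffAt hx) (by simp)
        exact h.contDiffWithinAt.congr (fun y hy => Set.indicator_of_mem hy _)
          (Set.indicator_of_mem hx _)
      · intro x hx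
        exact Set.indicator_of_notMem hx _⟩

theorem SmoothVectorField.bracket_apply (f g : SmoothVectorField Ω)
    {x : EuclideanSpace ℝ (Fin d)} (hx : x ∈ Ω) :
    (⁅f, g⁆ : SmoothVectorField Ω).1 x = VectorField.lieBracket ℝ f.1 g.1 x := by
  change (Ω : Set (EuclideanSpace ℝ (Fin d))).indicator
    (fun x => fderiv ℝ g.1 x (f.1 x) - fderiv ℝ f.1 x (g.1 x)) x = _
  rw [Set.indicator_of_mem (show x ∈ (Ω : Set (EuclideanSpace ℝ (Fin d))) from hx)]
  rfl

theorem SmoothVectorField.bracket_eventuallyEq (f g : SmoothVectorField Ω)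
    {x : EuclideanSpace ℝ (Fin d)} (hx : x ∈ Ω) :
    (⁅f, g⁆ : SmoothVectorField Ω).1 =ᶠ[nhds x] VectorField.lieBracket ℝ f.1 g.1 :=
  Filter.eventually_of_mem (Ω.isOpen.mem_nhds hx) fun _ hy => f.bracket_apply g hy

theorem SmoothVectorField.ext_on {f g : SmoothVectorField Ω} (h : ∀ x ∈ Ω, f.1 x = g.1 x) :
    f = g := by
  apply Subtype.ext
  funext x
  by_cases hx : x ∈ Ω
  · exact h x hx
  · rw [f.2.2 x hx, g.2.2 x hx]

instance : LieRing (SmoothVectorField Ω) where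
  add_lie f g h := SmoothVectorField.ext_on fun x hx => by
    have := VectorField.lieBracket_add_left (W := h.1) (f.differentiableAt hx)
      (g.differentiableAt hx)
    simpa [SmoothVectorField.bracket_apply _ _ hx] using this
  lie_add f g h := SmoothVectorField.ext_on fun x hx => by
    have := VectorField.lieBracket_add_right (V := f.1) (g.differentiableAt hx)
      (h.differentiableAt hx)
    simpa [SmoothVectorField.bracket_apply _ _ hx] using this
  lie_self f := SmoothVectorField.ext_on fun x hx => by
    simp [SmoothVectorField.bracket_apply _ _ hx]
  leibniz_lie f g h := SmoothVectorField.ext_on fun x hx => by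
    have key := VectorField.leibniz_identity_lieBracket (𝕜 := ℝ) (n := ∞)
      (by simpa using WithTop.coe_le_coe.2 (le_top : (2 : ℕ∞) ≤ ⊤))
      (f.contDiffAt hx) (g.contDiffAt hx) (h.contDiffAt hx)
    have e1 := (Filter.EventuallyEq.refl (nhds x) f.1).lieBracket_vectorField_eq (𝕜 := ℝ)
      (g.bracket_eventuallyEq h hx)
    have e2 := (f.bracket_eventuallyEq g hx).lieBracket_vectorField_eq (𝕜 := ℝ)
      (Filter.EventuallyEq.refl (nhds x) h.1)
    have e3 := (Filter.EventuallyEq.refl (nhds x) g.1).lieBracket_vectorField_eq (𝕜 := ℝ)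
      (f.bracket_eventuallyEq h hx)
    simp only [Submodule.coe_add, Pi.add_apply, SmoothVectorField.bracket_apply _ _ hx]
    rw [e1, e2, e3]
    exact key

instance : LieAlgebra ℝ (SmoothVectorField Ω) where
  lie_smul c f g := SmoothVectorField.ext_on fun x hx => by
    have := VectorField.lieBracket_const_smul_right (V := f.1) (c := c) (g.differentiableAt hx)
    simpa [SmoothVectorField.bracket_apply _ _ hx] using this

end LieAlgebra

/-! ### Formal brackets and their evaluation -/

/-- The free Lie algebra over `ℝ` on the `r + 1` indeterminates `X_0, …, X_r`. -/
abbrev FreeLie (r : ℕ) : Type := FreeLieAlgebra ℝ (Fin (r + 1))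

/-- The indeterminate `X_i`, `0 ≤ i ≤ r`. -/
def X {r : ℕ} (i : Fin (r + 1)) : FreeLie r := FreeLieAlgebra.of ℝ i

/-- `b 0^ν`, the right-iterated bracket `[…[b, X_0], …, X_0]` with `ν` occurrences of `X_0`. -/
def rightIter {r : ℕ} (b : FreeLie r) : ℕ → FreeLie r
  | 0 => b
  | ν + 1 => ⁅rightIter b ν, X 0⁆

/-- `M^ℓ_l = X_ℓ 0^l`. The control index `ℓ : Fin r` stands for the indeterminate
`X_{ℓ+1} = X ℓ.succ`, because `Fin r` counts from zero. -/
def brM {r : ℕ} (ℓ : Fin r) (l : ℕ) : FreeLie r := rightIter (X ℓ.succ) l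

/-- `W^ℓ_{p,l} = [M^ℓ_{p-1}, M^ℓ_p] 0^l`, meant for `p ≥ 1`. -/
def brW {r : ℕ} (ℓ : Fin r) (p l : ℕ) : FreeLie r := rightIter ⁅brM ℓ (p - 1), brM ℓ p⁆ l

/-- `C^{ℓ,L}_{p,l} = (-1)^p [M^ℓ_{⌊(p+1)/2⌋}, M^L_{⌊p/2⌋}] 0^l`, meant for `ℓ < L`. -/
def brC {r : ℕ} (ℓ L : Fin r) (p l : ℕ) : FreeLie r :=
  rightIter ((-1 : ℝ) ^ p • ⁅brM ℓ ((p + 1) / 2), brM L (p / 2)⁆) l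

/-- The evaluated bracket `f_b = Λ(b)`, where `Λ` is the unique homomorphism of Lie algebras from
the free Lie algebra to the smooth vector fields on `Ω` such that `Λ(X_i) = f_i`. -/
def evalBracket {d r : ℕ} {Ω : TopologicalSpace.Opens (EuclideanSpace ℝ (Fin d))}
    (f : Fin (r + 1) → SmoothVectorField Ω) (b : FreeLie r) : SmoothVectorField Ω :=
  FreeLieAlgebra.lift ℝ f b

/-- The vector `f_b(0)`. -/
def evalAtZero {d r : ℕ} {Ω : TopologicalSpace.Opens (EuclideanSpace ℝ (Fin d))}
    (f : Fin (r + 1) → SmoothVectorField Ω) (b : FreeLie r) : EuclideanSpace ℝ (Fin d) :=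
  (evalBracket f b).1 0

/-- The subspace `𝒩_k` of `ℝ^d`. -/
def spaceN {d r : ℕ} {Ω : TopologicalSpace.Opens (EuclideanSpace ℝ (Fin d))}
    (f : Fin (r + 1) → SmoothVectorField Ω) (k : ℕ) : Submodule ℝ (EuclideanSpace ℝ (Fin d)) :=
  Submodule.span ℝ {v | ∃ (ℓ : Fin r) (l : ℕ), v = evalAtZero f (brM ℓ l)} ⊔
  Submodule.span ℝ {v | ∃ (ℓ : Fin r) (p l : ℕ), 1 ≤ p ∧ p ≤ k - 1 ∧
    v = evalAtZero f (brW ℓ p l)} ⊔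
  Submodule.span ℝ {v | ∃ (ℓ L : Fin r) (p l : ℕ), ℓ < L ∧ p ≤ 2 * k - 2 ∧
    v = evalAtZero f (brC ℓ L p l)}

/-- The quadratic form
`a ↦ ∑_ℓ P(f_{W^ℓ_{k,0}}(0)) a_ℓ² / 2 + ∑_{ℓ < L} P(f_{C^{ℓ,L}_{2k-1,0}}(0)) a_ℓ a_L`. -/
def quadForm {d r : ℕ} {Ω : TopologicalSpace.Opens (EuclideanSpace ℝ (Fin d))}
    (f : Fin (r + 1) → SmoothVectorField Ω) (k : ℕ) (P : EuclideanSpace ℝ (Fin d) →ₗ[ℝ] ℝ)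
    (a : Fin r → ℝ) : ℝ :=
  ∑ ℓ, P (evalAtZero f (brW ℓ k 0)) * (a ℓ ^ 2 / 2) +
    ∑ ℓ, ∑ L ∈ Finset.Ioi ℓ, P (evalAtZero f (brC ℓ L (2 * k - 1) 0)) * (a ℓ * a L)

/-- A quadratic form on `ℝ^r` is definite if it is positive definite or negative definite. -/
def IsDefinite {r : ℕ} (q : (Fin r → ℝ) → ℝ) : Prop :=
  (∀ a, a ≠ 0 → 0 < q a) ∨ (∀ a, a ≠ 0 → q a < 0)

/-! ### Sobolev spaces on an interval -/

/-- `v` is a weak (distributional) derivative of order `j` of `u` on `(0, T)`. -/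
def IsWeakDeriv (T : ℝ) (j : ℕ) (u v : ℝ → ℝ) : Prop :=
  LocallyIntegrableOn u (Set.Ioo 0 T) ∧ LocallyIntegrableOn v (Set.Ioo 0 T) ∧
  ∀ φ : ℝ → ℝ, ContDiff ℝ ∞ φ → HasCompactSupport φ → tsupport φ ⊆ Set.Ioo 0 T →
    ∫ t in Set.Ioo 0 T, u t * iteratedDeriv j φ t
      = (-1) ^ j * ∫ t in Set.Ioo 0 T, v t * φ t

open Classical in
/-- The weak derivative of order `j` of `u` on `(0, T)` (unique up to a null set; `0` if there is
none). -/
def weakDeriv (T : ℝ) (j : ℕ) (u : ℝ → ℝ) : ℝ → ℝ :=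
  if h : ∃ v, IsWeakDeriv T j u v then h.choose else 0

/-- `u ∈ H^m((0, T), ℝ)`: the weak derivatives of order `≤ m` exist and are in `L²(0, T)`. -/
def MemH (m : ℕ) (T : ℝ) (u : ℝ → ℝ) : Prop :=
  ∀ j ≤ m, ∃ v, IsWeakDeriv T j u v ∧ MemLp v 2 (volume.restrict (Set.Ioo 0 T))

/-- The usual norm of `H^m((0, T), ℝ)^r`. -/
def normH {r : ℕ} (m : ℕ) (T : ℝ) (u : Fin r → ℝ → ℝ) : ℝ :=
  Real.sqrt (∑ ℓ, ∑ j ∈ Finset.range (m + 1), ∫ t in Set.Ioo 0 T, weakDeriv T j (u ℓ) t ^ 2)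

/-! ### The control system -/

/-- `x` is on `[0, T]` the mild solution, with values in `Ω`, of
`x' = f_0(x) + ∑_ℓ u^ℓ f_ℓ(x)`, `x(0) = 0`. -/
def IsMildSolution {d r : ℕ} {Ω : TopologicalSpace.Opens (EuclideanSpace ℝ (Fin d))}
    (f : Fin (r + 1) → SmoothVectorField Ω) (T : ℝ) (u : Fin r → ℝ → ℝ)
    (x : ℝ → EuclideanSpace ℝ (Fin d)) : Prop :=
  ContinuousOn x (Set.Icc 0 T) ∧ (∀ t ∈ Set.Icc 0 T, x t ∈ Ω) ∧
  ∀ t ∈ Set.Icc 0 T,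
    x t = ∫ s in (0 : ℝ)..t, ((f 0).1 (x s) + ∑ ℓ : Fin r, u ℓ s • (f ℓ.succ).1 (x s))

/-- The system is `H^m`-STLC around `0`: for all `T, ε > 0` there is `δ > 0` such that every
`x_f ∈ B(0, δ)` is reached from `0` at time `T` with a control `u ∈ H^m((0,T))^r ∩ L^1((0,T))^r`
of norm at most `ε`. -/
def IsSTLC {d r : ℕ} {Ω : TopologicalSpace.Opens (EuclideanSpace ℝ (Fin d))}
    (m : ℕ) (f : Fin (r + 1) → SmoothVectorField Ω) : Prop :=
  ∀ T > 0, ∀ ε > 0, ∃ δ > 0, ∀ xf ∈ Metric.ball (0 : EuclideanSpace ℝ (Fin d)) δ,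
    ∃ u : Fin r → ℝ → ℝ,
      (∀ ℓ, MemH m T (u ℓ) ∧ IntegrableOn (u ℓ) (Set.Ioo 0 T)) ∧ normH m T u ≤ ε ∧
      ∃ x, IsMildSolution f T u x ∧ x T = xf

end QuadObstruction

end

/-! Write u_i for the i-fold primitive of the control u, N for the L¹ norm of u, and Q for the
integral of |u_k|² over (0, T). To first order the state lies in the span of the vectors `J.b i ℓ`,
which `P` annihilates together with their orbits under the linearised drift. Hence P(x(T)) is
governed by the quadratic terms. Repeated integration by parts replaces u by its primitives and
creates brackets of the fields `M^ℓ_i`, `M^L_j`. Modulo brackets of lower order, all brackets of the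
same total order i + j agree up to sign (Jacobi identity), so the hypothesis on `𝒩_k` makes `P` kill
every bracket of order at most 2k - 2. The first surviving term is the given definite form evaluated
at u_k. On a short interval this yields, for positive definite forms, P(x(T)) ≥ (c/4) Q - C N³ - C
‖x(T)‖ (N + ‖x(T)‖), which is `QuadJet.IsBounded.exists_drift_estimate`.

The integrations by parts are carried by one functional, `QuadJet.corrected`: the backward adjoint
system (p, S) removes the linear and quadratic effects of the drift, and two corrections, one linear
in the state and one purely in the primitives, remove the terms in u_0, …, u_{k-1}. Its derivative
(`QuadJet.IsAdjoint.hasDerivAt_corrected`) is half the bracket form at u_k, plus a term in u_k times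
the distance of x to its first-order part, plus cubic terms. At the final time the corrections
involve u_1(T), …, u_k(T). Definiteness forces the vectors `J.b i ℓ`, i < k, to be linearly
independent (`QuadJet.coeff_eq_zero`), so these numbers are controlled by x(T) and by small
quantities.

The cubic error is absorbed by interpolation (`exists_cubic_le`). With φ = u_k one has φ⁽ᵏ⁾ = u and
φ⁽³ᵏ⁾ = u⁽²ᵏ⁾, and the L² inequality ‖φ⁽ᵏ⁾‖³ ≤ C ‖φ⁽³ᵏ⁾‖ ‖φ‖², with the lower-order correction
required on an interval, gives N³ ≤ C ε Q when the H^{2k} norm is at most ε. This is where the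
regularity 2k enters. Then P(x(T)) ≥ -C ‖x(T)‖ (N + ‖x(T)‖), which rules out the targets -s e with
P(e) = 1 and s small. -/

noncomputable section
namespace QuadObstruction

/-! ### Algebra of the second-order jet and its brackets -/

/-- The algebraic data of a control-affine system at an equilibrium that enter its expansion to
second order: the `1`-jets `(b i ℓ, D i ℓ)` of the iterated brackets of the `ℓ`-th control field
with the drift, and the `2`-jet `(0, A, B)` of the drift. -/
structure QuadJet (E : Type*) [NormedAddCommGroup E] [NormedSpace ℝ E] (r : ℕ) where
  A : E →L[ℝ] E
  B : E →L[ℝ] E →L[ℝ] E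
  b : ℕ → Fin r → E
  D : ℕ → Fin r → E →L[ℝ] E
  symm : ∀ v w, B v w = B w v
  b_succ : ∀ i ℓ, b (i + 1) ℓ = A (b i ℓ)
  D_succ : ∀ i ℓ v, D (i + 1) ℓ v = B (b i ℓ) v + A (D i ℓ v) - D i ℓ (A v)

namespace QuadJet

variable {E : Type*} [NormedAddCommGroup E] [NormedSpace ℝ E] {r : ℕ} (J : QuadJet E r)

/-- The value at the equilibrium of the bracket of two iterated brackets. -/
def br (i : ℕ) (ℓ : Fin r) (j : ℕ) (L : Fin r) : E := J.D j L (J.b i ℓ) - J.D i ℓ (J.b j L)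

theorem br_antisymm (i : ℕ) (ℓ : Fin r) (j : ℕ) (L : Fin r) : J.br j L i ℓ = -J.br i ℓ j L := by
  simp [br]

/-- The Jacobi identity for the bracket with the drift, read at the equilibrium; the two terms in
`B` cancel by symmetry. -/
theorem A_br (i : ℕ) (ℓ : Fin r) (j : ℕ) (L : Fin r) :
    J.A (J.br i ℓ j L) = J.br (i + 1) ℓ j L + J.br i ℓ (j + 1) L := by
  simp only [br, map_sub, J.D_succ, J.b_succ, J.symm (J.b j L)]
  abel

theorem b_add (i n : ℕ) (ℓ : Fin r) : J.b (i + n) ℓ = (J.A ^ n) (J.b i ℓ) := by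
  induction n with
  | zero => simp
  | succ n ih => rw [← add_assoc, J.b_succ, ih, pow_succ']; rfl

/-- If `P` kills, at every level, one representative of the brackets of total order `m`, for all
`m ≤ N`, then it kills all brackets of total order at most `N`. -/
theorem apply_br_eq_zero (P : E →ₗ[ℝ] ℝ) (ℓ L : Fin r) (N : ℕ)
    (h : ∀ m ≤ N, ∃ i j, i + j = m ∧ ∀ n, P ((J.A ^ n) (J.br i ℓ j L)) = 0) :
    ∀ m ≤ N, ∀ i j, i + j = m → ∀ n, P ((J.A ^ n) (J.br i ℓ j L)) = 0 := by
  intro m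
  induction m with
  | zero =>
    intro hm i j hij
    obtain ⟨i', j', hij', h'⟩ := h 0 hm
    obtain ⟨rfl, rfl⟩ : i = 0 ∧ j = 0 := by omega
    obtain ⟨rfl, rfl⟩ : i' = 0 ∧ j' = 0 := by omega
    exact h'
  | succ m ih =>
    intro hm
    have ih := ih (by omega)
    -- Since order m is already killed along the whole `A`-orbit, `A_br` lets one unit of order pass
    -- from the first slot to the second at the cost of a sign.
    have step : ∀ i j, i + j = m → ∀ n, P ((J.A ^ n) (J.br (i + 1) ℓ j L)) =
        -P ((J.A ^ n) (J.br i ℓ (j + 1) L)) := by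
      intro i j hij n
      have h1 := ih i j hij (n + 1)
      rw [pow_succ, mul_apply_eq_comp, J.A_br, map_add, map_add] at h1
      linarith
    obtain ⟨i₀, j₀, hij₀, h₀⟩ := h (m + 1) hm
    have to_zero : ∀ i j, i + j = m + 1 → ∀ n,
        |P ((J.A ^ n) (J.br i ℓ j L))| = |P ((J.A ^ n) (J.br 0 ℓ (m + 1) L))| := by
      intro i
      induction i with
      | zero => intro j hj n; rw [show j = m + 1 by omega]
      | succ i ihi =>
        intro j hj n
        rw [step i j (by omega), abs_neg]
        exact ihi (j + 1) (by omega) n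
    intro i j hij n
    rw [← abs_eq_zero, to_zero i j hij, ← to_zero i₀ j₀ hij₀, h₀, abs_zero]

/-- The linear combinations of the iterated brackets of order less than `k` are independent at the
equilibrium, provided that `P` kills the brackets of total order at most `2k - 2` and that the
bracket form of total order `2k - 1` is anisotropic. -/
theorem coeff_eq_zero (P : E →ₗ[ℝ] ℝ) {k : ℕ}
    (h0 : ∀ i j, i + j ≤ 2 * k - 2 → ∀ ℓ L, P (J.br i ℓ j L) = 0)
    (hdef : ∀ a : Fin r → ℝ,
      ∑ ℓ, ∑ L, a ℓ * a L * P (J.br (k - 1) ℓ k L) = 0 → a = 0) :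
    ∀ m ≤ k, ∀ c : ℕ → Fin r → ℝ, ∑ i ∈ Finset.range m, ∑ ℓ, c i ℓ • J.b i ℓ = 0 →
      ∀ i < m, c i = 0 := by
  intro m
  induction m with
  | zero => intro _ c _ i hi; omega
  | succ m ih =>
    intro hm c hc
    have hshift : ∀ s, ∑ i ∈ Finset.range (m + 1), ∑ ℓ, c i ℓ • J.b (i + s) ℓ = 0 := by
      intro s
      have := congrArg (J.A ^ s) hc
      simpa [map_sum, ← J.b_add] using this
    -- Shifting the relation by s and by s + 1 places the leading pair i = j = m at the levels k - 1
    -- and k; every other pair has total order at most 2k - 2.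
    set s := k - 1 - m with hs
    -- Each half of the bracket is linear in one of the two shifted combinations, and both
    -- combinations vanish.
    have key : ∑ i ∈ Finset.range (m + 1), ∑ ℓ, ∑ j ∈ Finset.range (m + 1), ∑ L,
        c i ℓ * c j L * P (J.br (i + s) ℓ (j + (s + 1)) L) = 0 := by
      have e1 : ∑ j ∈ Finset.range (m + 1), ∑ L,
          c j L • J.D (j + (s + 1)) L
            (∑ i ∈ Finset.range (m + 1), ∑ ℓ, c i ℓ • J.b (i + s) ℓ) = 0 := by
        simp [hshift s]
      have e2 : ∑ i ∈ Finset.range (m + 1), ∑ ℓ,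
          c i ℓ • J.D (i + s) ℓ
            (∑ j ∈ Finset.range (m + 1), ∑ L, c j L • J.b (j + (s + 1)) L) = 0 := by
        simp [hshift (s + 1)]
      have e1' := congrArg P e1
      have e2' := congrArg P e2
      simp only [map_sum, map_smul, smul_eq_mul, map_zero, Finset.mul_sum] at e1' e2'
      simp only [br, map_sub, mul_sub, Finset.sum_sub_distrib]
      rw [sub_eq_zero]
      trans (0 : ℝ)
      · rw [← e1']
        rw [Finset.sum_congr rfl fun i _ => Finset.sum_comm, Finset.sum_comm]
        refine Finset.sum_congr rfl fun j _ => ?_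
        rw [Finset.sum_congr rfl fun i _ => Finset.sum_comm, Finset.sum_comm]
        refine Finset.sum_congr rfl fun i _ => ?_
        refine Finset.sum_congr rfl fun ℓ _ => Finset.sum_congr rfl fun L _ => by ring
      · rw [← e2']
        refine Finset.sum_congr rfl fun j _ => ?_
        refine Finset.sum_congr rfl fun i _ => ?_
        refine Finset.sum_congr rfl fun ℓ _ => Finset.sum_congr rfl fun L _ => by ring
    have hcm : c m = 0 := by
      apply hdef
      rw [← key, Finset.sum_range_succ, Finset.sum_eq_zero (s := Finset.range m), zero_add]
      · refine Finset.sum_congr rfl fun ℓ _ => ?_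
        rw [Finset.sum_range_succ, Finset.sum_eq_zero (s := Finset.range m), zero_add]
        · rw [show m + s = k - 1 by omega, show m + (s + 1) = k by omega]
        · intro j hj
          rw [Finset.mem_range] at hj
          exact Finset.sum_eq_zero fun L _ => by rw [h0 _ _ (by omega), mul_zero]
      · intro i hi
        rw [Finset.mem_range] at hi
        refine Finset.sum_eq_zero fun ℓ _ => Finset.sum_eq_zero fun j hj =>
          Finset.sum_eq_zero fun L _ => ?_
        rw [Finset.mem_range] at hj
        rw [h0 _ _ (by omega), mul_zero]
    intro i hi
    rcases Nat.lt_succ_iff_lt_or_eq.1 hi with hi | rfl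
    · refine ih (by omega) c ?_ i hi
      rwa [Finset.sum_range_succ, hcm, Finset.sum_eq_zero (s := Finset.univ) (by simp),
        add_zero] at hc
    · exact hcm

/-- An injective linear map on a finite-dimensional space is antilipschitz. This later recovers the
final values of the primitives of the control from the state. -/
theorem exists_coeff_bound (P : E →ₗ[ℝ] ℝ) {k : ℕ}
    (h0 : ∀ i j, i + j ≤ 2 * k - 2 → ∀ ℓ L, P (J.br i ℓ j L) = 0)
    (hdef : ∀ a : Fin r → ℝ,
      ∑ ℓ, ∑ L, a ℓ * a L * P (J.br (k - 1) ℓ k L) = 0 → a = 0) :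
    ∃ K, 0 ≤ K ∧ ∀ c : ℕ → Fin r → ℝ, ∀ i < k, ∀ ℓ,
      |c i ℓ| ≤ K * ‖∑ i ∈ Finset.range k, ∑ ℓ, c i ℓ • J.b i ℓ‖ := by
  let F : (Fin k × Fin r → ℝ) →ₗ[ℝ] E := Fintype.linearCombination ℝ fun q => J.b q.1 q.2
  have hF : ∀ c : ℕ → Fin r → ℝ, F (fun q => c q.1 q.2) =
      ∑ i ∈ Finset.range k, ∑ ℓ, c i ℓ • J.b i ℓ := by
    intro c
    simp only [F, Fintype.linearCombination_apply, Fintype.sum_prod_type]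
    exact Fin.sum_univ_eq_sum_range (fun i => ∑ ℓ, c i ℓ • J.b i ℓ) k
  have hker : F.ker = ⊥ := by
    rw [LinearMap.ker_eq_bot']
    intro a ha
    let c : ℕ → Fin r → ℝ := fun i ℓ => if h : i < k then a (⟨i, h⟩, ℓ) else 0
    have hca : (fun q : Fin k × Fin r => c q.1 q.2) = a := by
      funext q; simp [c]
    have hc := J.coeff_eq_zero P h0 hdef k le_rfl c (by rw [← hF, hca, ha])
    rw [← hca]
    funext q
    simp [hc q.1 q.1.2]
  obtain ⟨K, -, hK⟩ := F.exists_antilipschitzWith hker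
  refine ⟨K, K.2, fun c i hi ℓ => ?_⟩
  have h1 := hK.le_mul_dist (fun q => c q.1 q.2) 0
  rw [map_zero, dist_zero_right, dist_zero_right, hF] at h1
  exact (norm_le_pi_norm (fun q : Fin k × Fin r => c q.1 q.2) (⟨i, hi⟩, ℓ)).trans h1

end QuadJet

/-! ### The jet of a system of smooth vector fields -/

section JetOf

variable {d r : ℕ} {Ω : TopologicalSpace.Opens (EuclideanSpace ℝ (Fin d))}

theorem evalBracket_lie (f : Fin (r + 1) → SmoothVectorField Ω) (a b : FreeLie r) :
    evalBracket f ⁅a, b⁆ = ⁅evalBracket f a, evalBracket f b⁆ :=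
  LieHom.map_lie _ _ _

theorem evalBracket_X (f : Fin (r + 1) → SmoothVectorField Ω) (i : Fin (r + 1)) :
    evalBracket f (X i) = f i :=
  FreeLieAlgebra.lift_of_apply ..

theorem SmoothVectorField.bracket_zero (hΩ : 0 ∈ Ω) (f g : SmoothVectorField Ω) :
    (⁅f, g⁆ : SmoothVectorField Ω).1 0 = fderiv ℝ g.1 0 (f.1 0) - fderiv ℝ f.1 0 (g.1 0) :=
  SmoothVectorField.bracket_apply f g hΩ

theorem SmoothVectorField.differentiableAt_fderiv (f : SmoothVectorField Ω)
    {x : EuclideanSpace ℝ (Fin d)} (hx : x ∈ Ω) : DifferentiableAt ℝ (fderiv ℝ f.1) x :=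
  ((f.contDiffAt hx).fderiv_right (m := 1) (WithTop.coe_le_coe.2 (le_top : (2 : ℕ∞) ≤ ⊤))).differentiableAt (by simp)

/-- The product rule would also give D²g(0)(v, f(0)), which vanishes because f(0) = 0. So only first
derivatives of the iterated brackets have to be tracked. -/
theorem SmoothVectorField.fderiv_bracket (hΩ : 0 ∈ Ω) (g f : SmoothVectorField Ω)
    (hf0 : f.1 0 = 0) (v : EuclideanSpace ℝ (Fin d)) :
    fderiv ℝ (⁅g, f⁆ : SmoothVectorField Ω).1 0 v =
      fderiv ℝ (fderiv ℝ f.1) 0 v (g.1 0) + fderiv ℝ f.1 0 (fderiv ℝ g.1 0 v)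
        - fderiv ℝ g.1 0 (fderiv ℝ f.1 0 v) := by
  rw [(g.bracket_eventuallyEq f hΩ).fderiv_eq]
  have h : VectorField.lieBracket ℝ g.1 f.1 =
      fun x => fderiv ℝ f.1 x (g.1 x) - fderiv ℝ g.1 x (f.1 x) := rfl
  have h1 := (f.differentiableAt_fderiv hΩ).hasFDerivAt.clm_apply
    (g.differentiableAt hΩ).hasFDerivAt
  have h2 := (g.differentiableAt_fderiv hΩ).hasFDerivAt.clm_apply
    (f.differentiableAt hΩ).hasFDerivAt
  rw [h, (h1.fun_sub h2).fderiv]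
  simp [hf0]
  abel

/-- The second-order data at `0` of the system given by `f`. -/
def jetOf (f : Fin (r + 1) → SmoothVectorField Ω) (hΩ : 0 ∈ Ω) (hf0 : (f 0).1 0 = 0) :
    QuadJet (EuclideanSpace ℝ (Fin d)) r where
  A := fderiv ℝ (f 0).1 0
  B := fderiv ℝ (fderiv ℝ (f 0).1) 0
  b i ℓ := evalAtZero f (brM ℓ i)
  D i ℓ := fderiv ℝ (evalBracket f (brM ℓ i)).1 0
  symm v w := (((f 0).contDiffAt hΩ).isSymmSndFDerivAt (n := ∞) (by
    simpa using WithTop.coe_le_coe.2 (le_top : (2 : ℕ∞) ≤ ⊤))).eq v w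
  b_succ i ℓ := by
    have : brM ℓ (i + 1) = ⁅brM ℓ i, X 0⁆ := rfl
    simp [evalAtZero, this, evalBracket_lie, evalBracket_X,
      SmoothVectorField.bracket_zero hΩ, hf0]
  D_succ i ℓ v := by
    have : brM ℓ (i + 1) = ⁅brM ℓ i, X 0⁆ := rfl
    rw [this, evalBracket_lie, evalBracket_X, SmoothVectorField.fderiv_bracket hΩ _ _ hf0,
      (((f 0).contDiffAt hΩ).isSymmSndFDerivAt (n := ∞) (by
        simpa using WithTop.coe_le_coe.2 (le_top : (2 : ℕ∞) ≤ ⊤))).eq v _]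
    rfl

variable (f : Fin (r + 1) → SmoothVectorField Ω) (hΩ : 0 ∈ Ω) (hf0 : (f 0).1 0 = 0)

/-- As the drift vanishes at 0, bracketing with `X 0` acts on values at 0 as its linearisation `A`.
-/
theorem evalAtZero_rightIter (b : FreeLie r) (n : ℕ) :
    evalAtZero f (rightIter b n) = ((jetOf f hΩ hf0).A ^ n) (evalAtZero f b) := by
  induction n with
  | zero => rfl
  | succ n ih =>
    have : rightIter b (n + 1) = ⁅rightIter b n, X 0⁆ := rfl
    rw [pow_succ', mul_apply_eq_comp, ← ih]
    simp [evalAtZero, this, evalBracket_lie, evalBracket_X,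
      SmoothVectorField.bracket_zero hΩ, hf0, jetOf]

theorem evalAtZero_lie_brM (i j : ℕ) (ℓ L : Fin r) :
    evalAtZero f ⁅brM ℓ i, brM L j⁆ = (jetOf f hΩ hf0).br i ℓ j L := by
  simp [evalAtZero, evalBracket_lie, SmoothVectorField.bracket_zero hΩ, jetOf, QuadJet.br]

theorem evalAtZero_brW (p n : ℕ) (ℓ : Fin r) :
    evalAtZero f (brW ℓ p n) =
      ((jetOf f hΩ hf0).A ^ n) ((jetOf f hΩ hf0).br (p - 1) ℓ p ℓ) := by
  rw [brW, evalAtZero_rightIter f hΩ hf0, evalAtZero_lie_brM f hΩ hf0]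

theorem evalAtZero_brC (p n : ℕ) (ℓ L : Fin r) :
    evalAtZero f (brC ℓ L p n) =
      (-1 : ℝ) ^ p • ((jetOf f hΩ hf0).A ^ n)
        ((jetOf f hΩ hf0).br ((p + 1) / 2) ℓ (p / 2) L) := by
  rw [brC, evalAtZero_rightIter f hΩ hf0, ← evalAtZero_lie_brM f hΩ hf0, ← map_smul]
  congr 1
  simp [evalAtZero, evalBracket]

variable {k : ℕ} {P : EuclideanSpace ℝ (Fin d) →ₗ[ℝ] ℝ}

theorem apply_b_eq_zero (hP : ∀ v ∈ spaceN f k, P v = 0) (n : ℕ) (ℓ : Fin r) :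
    P ((jetOf f hΩ hf0).b n ℓ) = 0 :=
  hP _ (Submodule.mem_sup_left (Submodule.mem_sup_left (Submodule.subset_span ⟨ℓ, n, rfl⟩)))

/-- `apply_br_eq_zero` needs one representative for each order. For ℓ < L it is `C_m`; for ℓ = L it
is `W` in odd order, while in even order [M_p, M_p] = 0; the case ℓ > L follows by antisymmetry. -/
theorem apply_pow_br_eq_zero (hP : ∀ v ∈ spaceN f k, P v = 0) (n i j : ℕ)
    (hij : i + j ≤ 2 * k - 2) (ℓ L : Fin r) :
    P (((jetOf f hΩ hf0).A ^ n) ((jetOf f hΩ hf0).br i ℓ j L)) = 0 := by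
  have hlt : ∀ ℓ L : Fin r, ℓ < L → ∀ n i j, i + j ≤ 2 * k - 2 →
      P (((jetOf f hΩ hf0).A ^ n) ((jetOf f hΩ hf0).br i ℓ j L)) = 0 := by
    intro ℓ L hL n i j hij
    refine (jetOf f hΩ hf0).apply_br_eq_zero P ℓ L (2 * k - 2) (fun m hm => ?_) (i + j) hij i j
      rfl n
    refine ⟨(m + 1) / 2, m / 2, by omega, fun n => ?_⟩
    have := hP _ (Submodule.mem_sup_right (Submodule.subset_span ⟨ℓ, L, m, n, hL, hm, rfl⟩))
    rw [evalAtZero_brC f hΩ hf0, map_smul, smul_eq_mul] at this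
    exact (mul_eq_zero.1 this).resolve_left (by simp)
  rcases lt_trichotomy ℓ L with h | rfl | h
  · exact hlt ℓ L h n i j hij
  · refine (jetOf f hΩ hf0).apply_br_eq_zero P ℓ ℓ (2 * k - 2) (fun m hm => ?_) (i + j) hij i j
      rfl n
    rcases Nat.even_or_odd' m with ⟨p, rfl | rfl⟩
    · exact ⟨p, p, by omega, fun n => by simp [QuadJet.br]⟩
    · refine ⟨p, p + 1, by omega, fun n => ?_⟩
      have := hP _ (Submodule.mem_sup_left (Submodule.mem_sup_right
        (Submodule.subset_span ⟨ℓ, p + 1, n, by omega, by omega, rfl⟩)))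
      rwa [evalAtZero_brW f hΩ hf0] at this
  · rw [QuadJet.br_antisymm, map_neg, map_neg, hlt L ℓ h n j i (by omega), neg_zero]

/-- The matrix of P-values of the brackets at the levels (k - 1, k) is symmetric, because `P` kills
`A` applied to the brackets at the levels (k - 1, k - 1). Its diagonal comes from `W_k` and its
off-diagonal entries from `C_{2k-1}`. -/
theorem sum_br_eq_quadForm (hk : 1 ≤ k) (hP : ∀ v ∈ spaceN f k, P v = 0) (a : Fin r → ℝ) :
    ∑ ℓ, ∑ L, a ℓ * a L * P ((jetOf f hΩ hf0).br (k - 1) ℓ k L) = 2 * quadForm f k P a := by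
  set J := jetOf f hΩ hf0 with hJ
  obtain ⟨m, rfl⟩ : ∃ m, k = m + 1 := ⟨k - 1, by omega⟩
  have hC : ∀ ℓ L : Fin r, P (evalAtZero f (brC ℓ L (2 * (m + 1) - 1) 0)) =
      P (J.br m L (m + 1) ℓ) := by
    intro ℓ L
    rw [evalAtZero_brC f hΩ hf0, ← hJ, J.br_antisymm, pow_zero,
      show (2 * (m + 1) - 1 + 1) / 2 = m + 1 by omega, show (2 * (m + 1) - 1) / 2 = m by omega,
      Odd.neg_one_pow ⟨m, by omega⟩]
    simp
  have hsym : ∀ ℓ L : Fin r, P (J.br m ℓ (m + 1) L) = P (J.br m L (m + 1) ℓ) := by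
    intro ℓ L
    have h1 := apply_pow_br_eq_zero f hΩ hf0 hP 1 m m (by omega) ℓ L
    rw [← hJ, pow_one, J.A_br, map_add, J.br_antisymm m L (m + 1) ℓ, map_neg] at h1
    linarith
  have hW : ∀ ℓ : Fin r, P (evalAtZero f (brW ℓ (m + 1) 0)) = P (J.br m ℓ (m + 1) ℓ) := by
    intro ℓ
    rw [evalAtZero_brW f hΩ hf0, ← hJ]
    simp
  simp only [quadForm, hC, hW, Nat.add_sub_cancel]
  have hsplit : ∀ F : Fin r → Fin r → ℝ, (∀ i j, F i j = F j i) →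
      ∑ i, ∑ j, F i j = ∑ i, F i i + 2 * ∑ i, ∑ j ∈ Finset.Ioi i, F i j := by
    intro F hF
    have h1 : ∀ i, ∑ j, F i j =
        F i i + (∑ j ∈ Finset.Ioi i, F i j + ∑ j ∈ Finset.Iio i, F i j) := by
      intro i
      have : (Finset.univ : Finset (Fin r)) =
          insert i (Finset.Ioi i ∪ Finset.Iio i) := by
        ext j
        simp only [Finset.mem_univ, Finset.mem_insert, Finset.mem_union, Finset.mem_Ioi,
          Finset.mem_Iio, true_iff]
        rcases lt_trichotomy i j with h | h | h
        · exact Or.inr (Or.inl h)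
        · exact Or.inl h.symm
        · exact Or.inr (Or.inr h)
      rw [this, Finset.sum_insert (by simp), Finset.sum_union]
      exact Finset.disjoint_left.2 fun j h1 h2 =>
        lt_asymm (Finset.mem_Ioi.1 h1) (Finset.mem_Iio.1 h2)
    have h2 : ∑ i, ∑ j ∈ Finset.Iio i, F i j = ∑ i, ∑ j ∈ Finset.Ioi i, F i j := by
      rw [Finset.sum_comm' (t' := Finset.univ) (s' := fun j => Finset.Ioi j) (by simp)]
      exact Finset.sum_congr rfl fun i _ => Finset.sum_congr rfl fun j _ => hF _ _
    simp only [h1, Finset.sum_add_distrib, h2]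
    ring
  rw [hsplit _ fun ℓ L => by rw [hsym ℓ L]; ring, mul_add]
  congr 1
  · rw [Finset.mul_sum]
    exact Finset.sum_congr rfl fun ℓ _ => by ring
  · congr 1
    refine Finset.sum_congr rfl fun ℓ _ => Finset.sum_congr rfl fun L _ => ?_
    rw [hsym ℓ L]; ring

end JetOf


/-! ### Taylor expansions at the equilibrium -/

section Taylor

open Asymptotics Filter Topology

variable {E F : Type*} [NormedAddCommGroup E] [NormedSpace ℝ E] [NormedAddCommGroup F]
  [NormedSpace ℝ F]

/-- Mean value inequality on the closed ball of radius ‖x‖; it raises the order by one, and both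
Taylor expansions below are obtained from it. -/
theorem isBigO_sub_of_fderiv_isBigO {H : E → F} {n : ℕ}
    (hd : ∀ᶠ x in 𝓝 (0 : E), DifferentiableAt ℝ H x)
    (hO : fderiv ℝ H =O[𝓝 0] fun x => ‖x‖ ^ n) :
    (fun x => H x - H 0) =O[𝓝 0] fun x => ‖x‖ ^ (n + 1) := by
  obtain ⟨C, hC0, hC⟩ := hO.exists_nonneg
  obtain ⟨ε, hε, hball⟩ := Metric.eventually_nhds_iff_ball.1 (hd.and hC.bound)
  refine IsBigO.of_bound C ?_
  filter_upwards [Metric.ball_mem_nhds (0 : E) hε] with x hx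
  have hsub : ∀ y ∈ Metric.closedBall (0 : E) ‖x‖, y ∈ Metric.ball (0 : E) ε := by
    intro y hy
    rw [mem_closedBall_zero_iff] at hy
    rw [mem_ball_zero_iff] at hx ⊢
    exact hy.trans_lt hx
  have h := (convex_closedBall (0 : E) ‖x‖).norm_image_sub_le_of_norm_fderiv_le (𝕜 := ℝ)
    (f := H) (C := C * ‖x‖ ^ n) (fun y hy => (hball y (hsub y hy)).1)
    (fun y hy => by
      refine (hball y (hsub y hy)).2.trans ?_
      rw [mem_closedBall_zero_iff] at hy
      simp only [norm_pow, norm_norm]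
      gcongr)
    (Metric.mem_closedBall_self (norm_nonneg x)) (by simp : x ∈ Metric.closedBall (0 : E) ‖x‖)
  rw [sub_zero] at h
  simpa [pow_succ, mul_assoc] using h

theorem taylor_one_isBigO {f : E → F} (hd : ∀ᶠ x in 𝓝 (0 : E), DifferentiableAt ℝ f x)
    (h2 : DifferentiableAt ℝ (fderiv ℝ f) 0) :
    (fun x => f x - f 0 - fderiv ℝ f 0 x) =O[𝓝 0] fun x => ‖x‖ ^ 2 := by
  have h := isBigO_sub_of_fderiv_isBigO (H := fun x => f x - fderiv ℝ f 0 x) (n := 1)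
    (hd.mono fun x hx => hx.sub (fderiv ℝ f 0).differentiableAt) ?_
  · refine h.congr_left fun x => ?_
    simp; abel
  · have h3 : (fun x => fderiv ℝ f x - fderiv ℝ f 0) =O[𝓝 0] fun x => ‖x‖ ^ 1 := by
      simpa using h2.isBigO_sub.norm_right
    refine h3.congr' ?_ EventuallyEq.rfl
    filter_upwards [hd] with x hx
    exact ((hx.hasFDerivAt.fun_sub (fderiv ℝ f 0).hasFDerivAt).fderiv).symm

theorem taylor_two_isBigO {f : E → F} (hd : ∀ᶠ x in 𝓝 (0 : E), DifferentiableAt ℝ f x)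
    (hd2 : ∀ᶠ x in 𝓝 (0 : E), DifferentiableAt ℝ (fderiv ℝ f) x)
    (h3 : DifferentiableAt ℝ (fderiv ℝ (fderiv ℝ f)) 0)
    (hs : ∀ v w, fderiv ℝ (fderiv ℝ f) 0 v w = fderiv ℝ (fderiv ℝ f) 0 w v) :
    (fun x => f x - f 0 - fderiv ℝ f 0 x - (1 / 2 : ℝ) • fderiv ℝ (fderiv ℝ f) 0 x x)
      =O[𝓝 0] fun x => ‖x‖ ^ 3 := by
  set B := fderiv ℝ (fderiv ℝ f) 0
  have hH : ∀ x, DifferentiableAt ℝ f x → HasFDerivAt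
      (fun x => f x - fderiv ℝ f 0 x - (1 / 2 : ℝ) • B x x)
      (fderiv ℝ f x - fderiv ℝ f 0 - B x) x := by
    intro x hx
    have hB : HasFDerivAt (fun x => B x x) ((B x).comp (ContinuousLinearMap.id ℝ E) + B.flip x)
      x := B.hasFDerivAt.clm_apply (hasFDerivAt_id x)
    refine ((hx.hasFDerivAt.fun_sub (fderiv ℝ f 0).hasFDerivAt).fun_sub
      (hB.const_smul (1 / 2 : ℝ))).congr_fderiv ?_
    ext v
    simp [hs v x, ← two_smul ℝ, smul_smul]
  have h := isBigO_sub_of_fderiv_isBigO (n := 2)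
    (H := fun x => f x - fderiv ℝ f 0 x - (1 / 2 : ℝ) • B x x)
    (hd.mono fun x hx => (hH x hx).differentiableAt) ?_
  · refine h.congr_left fun x => ?_
    simp; abel
  · refine (taylor_one_isBigO hd2 h3).congr' ?_ EventuallyEq.rfl
    filter_upwards [hd] with x hx
    rw [(hH x hx).fderiv]

variable {d r : ℕ} {Ω : TopologicalSpace.Opens (EuclideanSpace ℝ (Fin d))}

theorem SmoothVectorField.taylor_one (hΩ : 0 ∈ Ω) (f : SmoothVectorField Ω) :
    (fun x => f.1 x - f.1 0 - fderiv ℝ f.1 0 x) =O[𝓝 0] fun x => ‖x‖ ^ 2 :=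
  taylor_one_isBigO (eventually_of_mem (Ω.isOpen.mem_nhds hΩ) fun _ hx => f.differentiableAt hx)
    (f.differentiableAt_fderiv hΩ)

theorem SmoothVectorField.taylor_two (hΩ : 0 ∈ Ω) (f : SmoothVectorField Ω) :
    (fun x => f.1 x - f.1 0 - fderiv ℝ f.1 0 x
      - (1 / 2 : ℝ) • fderiv ℝ (fderiv ℝ f.1) 0 x x) =O[𝓝 0] fun x => ‖x‖ ^ 3 := by
  have h1 : ContDiffAt ℝ 2 (fderiv ℝ f.1) 0 :=
    (f.contDiffAt hΩ).fderiv_right (WithTop.coe_le_coe.2 (le_top : (3 : ℕ∞) ≤ ⊤))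
  have h2 : ContDiffAt ℝ 1 (fderiv ℝ (fderiv ℝ f.1)) 0 :=
    h1.fderiv_right (by norm_num)
  refine taylor_two_isBigO
    (eventually_of_mem (Ω.isOpen.mem_nhds hΩ) fun _ hx => f.differentiableAt hx)
    (eventually_of_mem (Ω.isOpen.mem_nhds hΩ) fun _ hx => f.differentiableAt_fderiv hx)
    (h2.differentiableAt (by simp)) fun v w => ?_
  exact ((f.contDiffAt hΩ).isSymmSndFDerivAt (n := ∞) (by
    simpa using WithTop.coe_le_coe.2 (le_top : (2 : ℕ∞) ≤ ⊤))).eq v w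

end Taylor

/-! ### The adjoint system -/

/-- The flow is the exponential series applied to z₀, so a functional that kills each term kills the
sum. -/
theorem exists_linear_flow {Z : Type*} [NormedAddCommGroup Z] [NormedSpace ℝ Z] [CompleteSpace Z]
    (G : Z →L[ℝ] Z) (z₀ : Z) :
    ∃ z : ℝ → Z, z 0 = z₀ ∧ (∀ s, HasDerivAt z (G (z s)) s) ∧
      ∀ φ : Z →L[ℝ] ℝ, (∀ n, φ (G^[n] z₀) = 0) → ∀ s, φ (z s) = 0 := by
  refine ⟨fun s => NormedSpace.exp (s • G) z₀, by simp, fun s => ?_, fun φ hφ s => ?_⟩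
  · have h := hasDerivAt_exp_smul_const' (𝕂 := ℝ) G s
    simpa using h.clm_apply (hasDerivAt_const s z₀)
  · have h := NormedSpace.exp_series_hasSum_exp' (𝕂 := ℝ) (s • G)
    have h1 := (φ.comp (ContinuousLinearMap.apply ℝ Z z₀)).hasSum h
    refine h1.unique ?_
    convert hasSum_zero with n
    simp [smul_pow, hφ]

theorem hasDerivAt_clm_comp {Z₁ Z₂ : Type*} [NormedAddCommGroup Z₁] [NormedSpace ℝ Z₁]
    [NormedAddCommGroup Z₂] [NormedSpace ℝ Z₂] (G : Z₁ →L[ℝ] Z₂) {p : ℝ → Z₁} {p' : Z₁} {s : ℝ}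
    (hp : HasDerivAt p p' s) : HasDerivAt (fun s => G (p s)) (G p') s :=
  G.hasFDerivAt.comp_hasDerivAt s hp

/-- The coupled system is a single autonomous linear flow on the product. The first component
evolves on its own, so the annihilation criterion needs only iterates of G. -/
theorem exists_triangular_flow {Z₁ Z₂ : Type*} [NormedAddCommGroup Z₁] [NormedSpace ℝ Z₁]
    [CompleteSpace Z₁] [NormedAddCommGroup Z₂] [NormedSpace ℝ Z₂] [CompleteSpace Z₂]
    (G : Z₁ →L[ℝ] Z₁) (H : Z₂ →L[ℝ] Z₂) (N : Z₁ →L[ℝ] Z₂) (a : Z₁) :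
    ∃ (p : ℝ → Z₁) (S : ℝ → Z₂), p 0 = a ∧ S 0 = 0 ∧ (∀ s, HasDerivAt p (G (p s)) s) ∧
      (∀ s, HasDerivAt S (H (S s) + N (p s)) s) ∧
      ∀ φ : Z₁ →L[ℝ] ℝ, (∀ n, φ (G^[n] a) = 0) → ∀ s, φ (p s) = 0 := by
  obtain ⟨z, hz0, hz, hzero⟩ := exists_linear_flow
    ((G.comp (.fst ℝ Z₁ Z₂)).prod (H.comp (.snd ℝ Z₁ Z₂) + N.comp (.fst ℝ Z₁ Z₂))) (a, 0)
  refine ⟨fun s => (z s).1, fun s => (z s).2, by simp [hz0], by simp [hz0],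
    fun s => (ContinuousLinearMap.fst ℝ Z₁ Z₂).hasFDerivAt.comp_hasDerivAt s (hz s),
    fun s => (ContinuousLinearMap.snd ℝ Z₁ Z₂).hasFDerivAt.comp_hasDerivAt s (hz s),
    fun φ hφ s => hzero (φ.comp (.fst ℝ Z₁ Z₂)) (fun n => ?_) s⟩
  refine Eq.trans (congrArg φ ?_) (hφ n)
  induction n with
  | zero => rfl
  | succ n ih =>
    rw [Function.iterate_succ_apply', Function.iterate_succ_apply', ← ih]
    rfl

namespace QuadJet

variable {E : Type*} [NormedAddCommGroup E] [NormedSpace ℝ E] {r : ℕ} (J : QuadJet E r)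

/-- The adjoint system `p' = p A`, `S' = S(A ·, ·) + S(·, A ·) + p B` has a solution with
`p(0) = P` and `S(0) = 0`; `S` is symmetric, and `p` kills the vectors whose whole orbit under `A`
is killed by `P`. -/
theorem exists_adjoint (P : E →L[ℝ] ℝ) :
    ∃ (p : ℝ → E →L[ℝ] ℝ) (S S' : ℝ → E →L[ℝ] E →L[ℝ] ℝ), p 0 = P ∧ S 0 = 0 ∧
      (∀ s, HasDerivAt p ((p s).comp J.A) s) ∧ (∀ s, HasDerivAt S (S' s) s) ∧
      (∀ s v w, S' s v w = S s (J.A v) w + S s v (J.A w) + p s (J.B v w)) ∧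
      (∀ s v w, S s v w = S s w v) ∧
      ∀ v, (∀ n, P ((J.A ^ n) v) = 0) → ∀ s, p s v = 0 := by
  let cA : (E →L[ℝ] ℝ) →L[ℝ] (E →L[ℝ] ℝ) := (ContinuousLinearMap.compL ℝ E E ℝ).flip J.A
  let H : (E →L[ℝ] E →L[ℝ] ℝ) →L[ℝ] (E →L[ℝ] E →L[ℝ] ℝ) :=
    (ContinuousLinearMap.compL ℝ E E (E →L[ℝ] ℝ)).flip J.A
      + ContinuousLinearMap.compL ℝ E (E →L[ℝ] ℝ) (E →L[ℝ] ℝ) cA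
  let N : (E →L[ℝ] ℝ) →L[ℝ] (E →L[ℝ] E →L[ℝ] ℝ) :=
    ((ContinuousLinearMap.compL ℝ E (E →L[ℝ] E) (E →L[ℝ] ℝ)).flip J.B).comp
      (ContinuousLinearMap.compL ℝ E E ℝ)
  obtain ⟨p, S, hp0, hS0, hp, hS, hzero⟩ := exists_triangular_flow
    (Z₂ := E →L[ℝ] E →L[ℝ] ℝ) cA H N P
  have hHN : ∀ S p v w, (H S + N p) v w = S (J.A v) w + S v (J.A w) + p (J.B v w) :=
    fun S p v w => rfl
  -- Rather than deriving symmetry from uniqueness, S is replaced by its symmetric part, which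
  -- solves the same equation because B is symmetric.
  let fl : (E →L[ℝ] E →L[ℝ] ℝ) →L[ℝ] (E →L[ℝ] E →L[ℝ] ℝ) :=
    ((ContinuousLinearMap.flipₗᵢ ℝ E E ℝ).toContinuousLinearEquiv :
      (E →L[ℝ] E →L[ℝ] ℝ) →L[ℝ] (E →L[ℝ] E →L[ℝ] ℝ))
  have hfl : ∀ S v w, fl S v w = S w v := fun S v w => rfl
  have hsy : ∀ S v w, ((1 / 2 : ℝ) • (S + fl S)) v w = 1 / 2 * (S v w + S w v) :=
    fun S v w => rfl
  have hflS : ∀ s, HasDerivAt (fun s => fl (S s)) (fl (H (S s) + N (p s))) s := fun s =>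
    hasDerivAt_clm_comp (Z₂ := E →L[ℝ] E →L[ℝ] ℝ) fl (hS s)
  refine ⟨p, fun s => (1 / 2 : ℝ) • (S s + fl (S s)),
    fun s => (1 / 2 : ℝ) • (H (S s) + N (p s) + fl (H (S s) + N (p s))), hp0, ?_, hp,
    fun s => ((hS s).add (hflS s)).const_smul (1 / 2 : ℝ), fun s v w => ?_, fun s v w => ?_,
    fun v hv s => ?_⟩
  · ext v w
    simp [hS0]
  · simp only [hsy, hHN, J.symm w v]
    ring
  · simp only [hsy]; ring
  · refine hzero (ContinuousLinearMap.apply ℝ ℝ v) (fun n => ?_) s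
    change (cA^[n] P) v = 0
    have hpow : (cA^[n] P) v = P ((J.A ^ n) v) := by
      clear hv
      induction n generalizing v with
      | zero => rfl
      | succ n ih =>
        rw [Function.iterate_succ_apply']
        change (cA^[n] P) (J.A v) = _
        rw [ih, pow_succ, mul_apply_eq_comp]
    rw [hpow, hv]

end QuadJet


/-! ### Integral bounds for differentiable curves -/

section Curves

open Set

variable {E : Type*} [NormedAddCommGroup E] [NormedSpace ℝ E]

/-- Testing against a norming functional of y(τ) reduces to a scalar one-sided inequality, which
needs no integrability of y'. -/
theorem norm_le_integral_of_norm_deriv_le {y y' : ℝ → E} {g : ℝ → ℝ} {τ : ℝ} (hτ : 0 ≤ τ)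
    (hc : ContinuousOn y (Icc 0 τ)) (h0 : y 0 = 0) (hd : ∀ t ∈ Ioo 0 τ, HasDerivAt y (y' t) t)
    (hg : Continuous g) (hb : ∀ t ∈ Ioo 0 τ, ‖y' t‖ ≤ g t) : ‖y τ‖ ≤ ∫ t in (0 : ℝ)..τ, g t := by
  obtain ⟨φ, hφ, hφy⟩ := exists_dual_vector'' ℝ (y τ)
  have h := intervalIntegral.sub_le_integral_of_hasDeriv_right_of_le (g := fun t => φ (y t))
    (g' := fun t => φ (y' t)) (φ := g) hτ (φ.continuous.comp_continuousOn hc)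
    (fun t ht => (hasDerivAt_clm_comp φ (hd t ht)).hasDerivWithinAt)
    (hg.continuousOn.integrableOn_Icc) (fun t ht => ?_)
  · simpa [h0, hφy] using h
  · refine ((le_abs_self _).trans (φ.le_opNorm (y' t))).trans ?_
    calc ‖φ‖ * ‖y' t‖ ≤ 1 * ‖y' t‖ := by gcongr
      _ ≤ g t := by rw [one_mul]; exact hb t ht

/-- A Gronwall estimate on short time intervals. -/
theorem norm_le_two_mul_integral {y y' : ℝ → E} {g : ℝ → ℝ} {τ K : ℝ} (hτ : 0 ≤ τ)
    (hK : 0 ≤ K) (hKτ : K * τ ≤ 1 / 2)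
    (hc : ContinuousOn y (Icc 0 τ)) (h0 : y 0 = 0) (hd : ∀ t ∈ Ioo 0 τ, HasDerivAt y (y' t) t)
    (hg : Continuous g) (hg0 : ∀ t, 0 ≤ g t) (hb : ∀ t ∈ Ioo 0 τ, ‖y' t‖ ≤ K * ‖y t‖ + g t) :
    ∀ t ∈ Icc 0 τ, ‖y t‖ ≤ 2 * ∫ t in (0 : ℝ)..τ, g t := by
  -- At a point of maximal norm the linear term contributes at most half of that maximum and is
  -- absorbed.
  obtain ⟨m, hm, hmax⟩ := isCompact_Icc.exists_isMaxOn (nonempty_Icc.2 hτ) hc.norm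
  have hsub : Ioo 0 m ⊆ Ioo 0 τ := Ioo_subset_Ioo_right hm.2
  have h1 := norm_le_integral_of_norm_deriv_le (g := fun t => K * ‖y m‖ + g t) hm.1
    (hc.mono (Icc_subset_Icc_right hm.2)) h0 (fun t ht => hd t (hsub ht)) (by fun_prop)
    (fun t ht => (hb t (hsub ht)).trans (by
      gcongr
      exact hmax (Ioo_subset_Icc_self (hsub ht))))
  rw [intervalIntegral.integral_add (by simp) (hg.intervalIntegrable _ _),
    intervalIntegral.integral_const, smul_eq_mul, sub_zero] at h1
  have h2 : ∫ t in (0 : ℝ)..m, g t ≤ ∫ t in (0 : ℝ)..τ, g t :=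
    intervalIntegral.integral_mono_interval le_rfl hm.1 hm.2
      (Filter.Eventually.of_forall hg0) (hg.intervalIntegrable _ _)
  have h3 : m * (K * ‖y m‖) ≤ 1 / 2 * ‖y m‖ := by
    rw [← mul_assoc]
    gcongr
    nlinarith [hm.2]
  intro t ht
  have := hmax ht
  simp only [mem_ofPred_eq] at this
  linarith

end Curves

/-! ### Iterated primitives of the control -/

section IterPrim

/-- The `i`-fold primitive of `u` that vanishes at `0` to order `i`. -/
def iterPrim (u : ℝ → ℝ) : ℕ → ℝ → ℝ
  | 0 => u
  | i + 1 => fun t => ∫ s in (0 : ℝ)..t, iterPrim u i s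

variable {u : ℝ → ℝ}

theorem continuous_iterPrim (hu : Continuous u) : ∀ i, Continuous (iterPrim u i)
  | 0 => hu
  | i + 1 => intervalIntegral.continuous_primitive
      (fun _ _ => (continuous_iterPrim hu i).intervalIntegrable _ _) 0

theorem hasDerivAt_iterPrim (hu : Continuous u) (i : ℕ) (t : ℝ) :
    HasDerivAt (iterPrim u (i + 1)) (iterPrim u i t) t :=
  (continuous_iterPrim hu i).integral_hasStrictDerivAt 0 t |>.hasDerivAt

theorem iterPrim_succ_zero (i : ℕ) : iterPrim u (i + 1) 0 = 0 := by simp [iterPrim]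

theorem abs_iterPrim_le (hu : Continuous u) {T : ℝ} (hT : T ≤ 1) (i : ℕ) :
    ∀ t ∈ Set.Icc 0 T, |iterPrim u (i + 1) t| ≤ ∫ s in (0 : ℝ)..T, |u s| := by
  induction i with
  | zero =>
    intro t ht
    refine (intervalIntegral.abs_integral_le_integral_abs ht.1).trans ?_
    exact intervalIntegral.integral_mono_interval le_rfl ht.1 ht.2
      (Filter.Eventually.of_forall fun _ => abs_nonneg _) (hu.abs.intervalIntegrable _ _)
  | succ i ih =>
    intro t ht
    have h := intervalIntegral.norm_integral_le_of_norm_le_const (a := 0) (b := t)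
      (f := iterPrim u (i + 1)) (C := ∫ s in (0 : ℝ)..T, |u s|) (fun s hs => by
        rw [Set.uIoc_of_le ht.1] at hs
        exact ih s ⟨hs.1.le, hs.2.trans ht.2⟩)
    refine h.trans ?_
    rw [sub_zero, abs_of_nonneg ht.1]
    have h0 : 0 ≤ ∫ s in (0 : ℝ)..T, |u s| :=
      intervalIntegral.integral_nonneg (ht.1.trans ht.2) fun _ _ => abs_nonneg _
    nlinarith [ht.2]

/-- All k integrations by parts at once: the sum telescopes, leaving only the levels 0 and k. It
applies to the vectors `J.b i ℓ` (with M = -A) and to the time-reversed covectors (with M the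
composition with A). -/
theorem hasDerivAt_sum_iterPrim {V : Type*} [NormedAddCommGroup V] [NormedSpace ℝ V] {r : ℕ}
    {u : Fin r → ℝ → ℝ} (hu : ∀ ℓ, Continuous (u ℓ)) (k : ℕ) (h : ℕ → Fin r → ℝ → V)
    (M : V →ₗ[ℝ] V) {t : ℝ}
    (hd : ∀ i ℓ, HasDerivAt (h i ℓ) (-h (i + 1) ℓ t - M (h i ℓ t)) t) :
    HasDerivAt (fun t => ∑ i ∈ Finset.range k, ∑ ℓ, iterPrim (u ℓ) (i + 1) t • h i ℓ t)
      (∑ ℓ, iterPrim (u ℓ) 0 t • h 0 ℓ t - ∑ ℓ, iterPrim (u ℓ) k t • h k ℓ t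
        - M (∑ i ∈ Finset.range k, ∑ ℓ, iterPrim (u ℓ) (i + 1) t • h i ℓ t)) t := by
  have h1 : HasDerivAt (fun t => ∑ i ∈ Finset.range k, ∑ ℓ, iterPrim (u ℓ) (i + 1) t • h i ℓ t)
      (∑ i ∈ Finset.range k, ∑ ℓ, (iterPrim (u ℓ) (i + 1) t • (-h (i + 1) ℓ t - M (h i ℓ t))
        + iterPrim (u ℓ) i t • h i ℓ t)) t :=
    HasDerivAt.fun_sum fun i _ => HasDerivAt.fun_sum fun ℓ _ =>
      (hasDerivAt_iterPrim (hu ℓ) i t).smul (hd i ℓ)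
  refine h1.congr_deriv ?_
  rw [← Finset.sum_range_sub' (fun i => ∑ ℓ, iterPrim (u ℓ) i t • h i ℓ t), map_sum,
    ← Finset.sum_sub_distrib]
  refine Finset.sum_congr rfl fun i _ => ?_
  rw [map_sum, ← Finset.sum_sub_distrib, ← Finset.sum_sub_distrib]
  refine Finset.sum_congr rfl fun ℓ _ => ?_
  rw [map_smul, smul_sub, smul_neg]
  abel

end IterPrim

/-! ### The corrected functional and its derivative -/

namespace QuadJet

variable {E : Type*} [NormedAddCommGroup E] [NormedSpace ℝ E] {r : ℕ} (J : QuadJet E r)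

/-- `(p, S)` solves the adjoint system with initial value `(P, 0)`. -/
structure IsAdjoint (P : E →L[ℝ] ℝ) (p : ℝ → E →L[ℝ] ℝ) (S : ℝ → E →L[ℝ] E →L[ℝ] ℝ) :
    Prop where
  p_zero : p 0 = P
  S_zero : S 0 = 0
  deriv_p : ∀ s, HasDerivAt p ((p s).comp J.A) s
  deriv_S : ∀ s, ∃ S', HasDerivAt S S' s ∧
    ∀ v w, S' v w = S s (J.A v) w + S s v (J.A w) + p s (J.B v w)
  symm : ∀ s v w, S s v w = S s w v

/-- The covector that multiplies the `i`-fold primitive of the `ℓ`-th control. -/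
def cov (p : ℝ → E →L[ℝ] ℝ) (S : ℝ → E →L[ℝ] E →L[ℝ] ℝ) (i : ℕ) (ℓ : Fin r) (s : ℝ) :
    E →L[ℝ] ℝ :=
  (p s).comp (J.D i ℓ) + S s (J.b i ℓ)

variable {J} {P : E →L[ℝ] ℝ} {p : ℝ → E →L[ℝ] ℝ} {S : ℝ → E →L[ℝ] E →L[ℝ] ℝ}

theorem cov_apply (i : ℕ) (ℓ : Fin r) (s : ℝ) (v : E) :
    J.cov p S i ℓ s v = p s (J.D i ℓ v) + S s (J.b i ℓ) v := rfl

/-- The recursions for D and b match the adjoint equations, so that differentiating one covector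
produces the next. -/
theorem IsAdjoint.hasDerivAt_cov (h : J.IsAdjoint P p S) (i : ℕ) (ℓ : Fin r) (s : ℝ) :
    HasDerivAt (J.cov p S i ℓ) (J.cov p S (i + 1) ℓ s + (J.cov p S i ℓ s).comp J.A) s := by
  obtain ⟨S', hS, hS'⟩ := h.deriv_S s
  have h1 : HasDerivAt (fun s => (p s).comp (J.D i ℓ)) (((p s).comp J.A).comp (J.D i ℓ)) s :=
    hasDerivAt_clm_comp ((ContinuousLinearMap.compL ℝ E E ℝ).flip (J.D i ℓ)) (h.deriv_p s)
  have h2 : HasDerivAt (fun s => S s (J.b i ℓ)) (S' (J.b i ℓ)) s :=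
    by simpa using hS.clm_apply (hasDerivAt_const s (J.b i ℓ))
  refine (h1.add h2).congr_deriv ?_
  ext v
  simp only [_root_.add_apply, ContinuousLinearMap.comp_apply, cov_apply, hS',
    J.D_succ, J.b_succ, map_add, map_sub]
  ring

/-- The symmetric part S cancels, so the antisymmetric part of the pairing consists of brackets
only. -/
theorem IsAdjoint.cov_sub (h : J.IsAdjoint P p S) (i : ℕ) (ℓ : Fin r) (j : ℕ) (L : Fin r)
    (s : ℝ) : J.cov p S i ℓ s (J.b j L) - J.cov p S j L s (J.b i ℓ) = -p s (J.br i ℓ j L) := by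
  simp only [cov_apply, br, map_sub, h.symm s (J.b j L)]
  ring

theorem IsAdjoint.cov_sum_sub (h : J.IsAdjoint P p S) (k j : ℕ) (a : Fin r → ℝ)
    (c : ℕ → Fin r → ℝ) (s : ℝ) :
    (∑ ℓ, a ℓ • J.cov p S j ℓ s) (∑ i ∈ Finset.range k, ∑ L, c i L • J.b i L)
      - (∑ i ∈ Finset.range k, ∑ L, c i L • J.cov p S i L s) (∑ ℓ, a ℓ • J.b j ℓ) =
    -∑ i ∈ Finset.range k, ∑ L, ∑ ℓ, c i L * a ℓ * p s (J.br j ℓ i L) := by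
  have e1 : (∑ ℓ, a ℓ • J.cov p S j ℓ s) (∑ i ∈ Finset.range k, ∑ L, c i L • J.b i L) =
      ∑ i ∈ Finset.range k, ∑ L, ∑ ℓ, c i L * a ℓ * J.cov p S j ℓ s (J.b i L) := by
    simp only [map_sum, _root_.sum_apply, _root_.smul_apply, map_smul, smul_eq_mul,
      Finset.mul_sum, mul_assoc]
  have e2 : (∑ i ∈ Finset.range k, ∑ L, c i L • J.cov p S i L s) (∑ ℓ, a ℓ • J.b j ℓ) =
      ∑ i ∈ Finset.range k, ∑ L, ∑ ℓ, c i L * a ℓ * J.cov p S i L s (J.b j ℓ) := by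
    simp only [_root_.sum_apply, _root_.smul_apply, map_sum, map_smul, smul_eq_mul,
      Finset.mul_sum, mul_assoc]
    rw [Finset.sum_comm]
    refine Finset.sum_congr rfl fun i _ => ?_
    rw [Finset.sum_comm]
    refine Finset.sum_congr rfl fun L _ => Finset.sum_congr rfl fun ℓ _ => by ring
  rw [e1, e2]
  simp only [← Finset.sum_sub_distrib, ← Finset.sum_neg_distrib]
  refine Finset.sum_congr rfl fun i _ => Finset.sum_congr rfl fun L _ =>
    Finset.sum_congr rfl fun ℓ _ => ?_
  rw [← mul_sub, h.cov_sub]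
  ring

/-- The corrected linear functional along a trajectory. -/
def corrected (J : QuadJet E r) (k : ℕ) (p : ℝ → E →L[ℝ] ℝ) (S : ℝ → E →L[ℝ] E →L[ℝ] ℝ) (T : ℝ)
    (u : Fin r → ℝ → ℝ) (x : ℝ → E) (t : ℝ) : ℝ :=
  p (T - t) (x t) + 1 / 2 * S (T - t) (x t) (x t)
    - (∑ i ∈ Finset.range k, ∑ ℓ, iterPrim (u ℓ) (i + 1) t • J.cov p S i ℓ (T - t)) (x t)
    + 1 / 2 * (∑ i ∈ Finset.range k, ∑ ℓ, iterPrim (u ℓ) (i + 1) t • J.cov p S i ℓ (T - t))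
      (∑ i ∈ Finset.range k, ∑ ℓ, iterPrim (u ℓ) (i + 1) t • J.b i ℓ)

theorem hasDerivAt_primSum_b (J : QuadJet E r) {u : Fin r → ℝ → ℝ} (hu : ∀ ℓ, Continuous (u ℓ))
    (k : ℕ) (t : ℝ) :
    HasDerivAt (fun t => ∑ i ∈ Finset.range k, ∑ ℓ, iterPrim (u ℓ) (i + 1) t • J.b i ℓ)
      (∑ ℓ, u ℓ t • J.b 0 ℓ - ∑ ℓ, iterPrim (u ℓ) k t • J.b k ℓ
        + J.A (∑ i ∈ Finset.range k, ∑ ℓ, iterPrim (u ℓ) (i + 1) t • J.b i ℓ)) t := by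
  have h := hasDerivAt_sum_iterPrim hu k (fun i ℓ _ => J.b i ℓ) (-J.A : E →L[ℝ] E).toLinearMap
    (t := t) (fun i ℓ => by simpa [J.b_succ] using hasDerivAt_const t (J.b i ℓ))
  refine h.congr_deriv ?_
  simp [iterPrim]

theorem IsAdjoint.hasDerivAt_primSum_cov (h : J.IsAdjoint P p S) {u : Fin r → ℝ → ℝ}
    (hu : ∀ ℓ, Continuous (u ℓ)) (k : ℕ) (T t : ℝ) :
    HasDerivAt
      (fun t => ∑ i ∈ Finset.range k, ∑ ℓ, iterPrim (u ℓ) (i + 1) t • J.cov p S i ℓ (T - t))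
      (∑ ℓ, u ℓ t • J.cov p S 0 ℓ (T - t) - ∑ ℓ, iterPrim (u ℓ) k t • J.cov p S k ℓ (T - t)
        - (∑ i ∈ Finset.range k, ∑ ℓ,
            iterPrim (u ℓ) (i + 1) t • J.cov p S i ℓ (T - t)).comp J.A) t := by
  have h1 := hasDerivAt_sum_iterPrim hu k (fun i ℓ t => J.cov p S i ℓ (T - t))
    ((ContinuousLinearMap.compL ℝ E E ℝ).flip J.A).toLinearMap
    (t := t) (fun i ℓ => by
      have h2 := (h.hasDerivAt_cov i ℓ (T - t)).comp_const_sub T t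
      refine h2.congr_deriv ?_
      rw [neg_add']
      rfl)
  exact h1

/-- Let ρ and w be the sums of u_{i+1} times the covectors and times the vectors `J.b i ℓ`, and let
η_j, β_j be the corresponding sums at level j with weight u_j. The adjoint equations leave η_0(x)
plus cubic terms. Subtracting ρ(x) turns η_0(x) into η_k(x) - ρ(β_0). Adding ρ(w)/2 cancels ρ(β_0),
because η_0(w) = ρ(β_0), and leaves η_k(x - w) + (η_k(w) - ρ(β_k))/2, up to cubic terms. -/
theorem IsAdjoint.hasDerivAt_corrected (h : J.IsAdjoint P p S) {k : ℕ} (hk : 1 ≤ k)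
    {u : Fin r → ℝ → ℝ} (hu : ∀ ℓ, Continuous (u ℓ)) {T t : ℝ} {x : ℝ → E} {e : E}
    (hx : HasDerivAt x (J.A (x t) + ∑ ℓ, u ℓ t • J.b 0 ℓ + e) t)
    (hb : ∀ ℓ, p (T - t) (J.b 0 ℓ) = 0)
    (hbr : ∀ i j, i + j ≤ 2 * k - 2 → ∀ ℓ L, p (T - t) (J.br i ℓ j L) = 0) :
    HasDerivAt (J.corrected k p S T u x)
      ((∑ ℓ, iterPrim (u ℓ) k t • J.cov p S k ℓ (T - t))
          (x t - ∑ i ∈ Finset.range k, ∑ ℓ, iterPrim (u ℓ) (i + 1) t • J.b i ℓ)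
        + 1 / 2 * ∑ ℓ, ∑ L, iterPrim (u ℓ) k t * iterPrim (u L) k t *
            p (T - t) (J.br (k - 1) ℓ k L)
        + (p (T - t) (e - (1 / 2 : ℝ) • J.B (x t) (x t) - ∑ ℓ, u ℓ t • J.D 0 ℓ (x t))
          + S (T - t) e (x t)
          - (∑ i ∈ Finset.range k, ∑ ℓ, iterPrim (u ℓ) (i + 1) t • J.cov p S i ℓ (T - t)) e)) t := by
  have hρ := h.hasDerivAt_primSum_cov hu k T t
  have hw := J.hasDerivAt_primSum_b hu k t
  obtain ⟨S', hS, hS'⟩ := h.deriv_S (T - t)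
  have hp := (h.deriv_p (T - t)).comp_const_sub T t
  have hS : HasDerivAt (fun t => S (T - t)) (-S') t :=
    HasDerivAt.comp_const_sub (F := E →L[ℝ] E →L[ℝ] ℝ) T t hS
  have hpx := hp.clm_apply hx
  have hSx := (hS.clm_apply hx).clm_apply hx
  have hρx := hρ.clm_apply hx
  have hρw := hρ.clm_apply hw
  have hall := ((hpx.add (hSx.const_mul (1 / 2 : ℝ))).sub hρx).add (hρw.const_mul (1 / 2 : ℝ))
  refine HasDerivAt.congr_deriv (f := J.corrected k p S T u x) hall ?_
  set pt := p (T - t)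
  set St := S (T - t)
  set β0 := ∑ ℓ, u ℓ t • J.b 0 ℓ with hβ0
  set βk := ∑ ℓ, iterPrim (u ℓ) k t • J.b k ℓ with hβk
  set η0 := ∑ ℓ, u ℓ t • J.cov p S 0 ℓ (T - t) with hη0
  set ηk := ∑ ℓ, iterPrim (u ℓ) k t • J.cov p S k ℓ (T - t) with hηk
  set ρ := ∑ i ∈ Finset.range k, ∑ ℓ, iterPrim (u ℓ) (i + 1) t • J.cov p S i ℓ (T - t) with hρdef
  set w := ∑ i ∈ Finset.range k, ∑ ℓ, iterPrim (u ℓ) (i + 1) t • J.b i ℓ with hwdef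
  have hpβ : pt β0 = 0 := by simp [hβ0, map_sum, pt, hb]
  have hη0x : η0 (x t) = pt (∑ ℓ, u ℓ t • J.D 0 ℓ (x t)) + St β0 (x t) := by
    simp only [hη0, hβ0, _root_.sum_apply, _root_.smul_apply, cov_apply,
      map_sum, map_smul, smul_eq_mul, mul_add, Finset.sum_add_distrib]
    rfl
  -- Only brackets of levels (0, i) with i ≤ k - 1 occur, of order at most 2k - 2.
  have hlow : η0 w = ρ β0 := by
    rw [← sub_eq_zero, h.cov_sum_sub k 0 (fun ℓ => u ℓ t) (fun i L => iterPrim (u L) (i + 1) t),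
      neg_eq_zero]
    refine Finset.sum_eq_zero fun i hi => Finset.sum_eq_zero fun L _ =>
      Finset.sum_eq_zero fun ℓ _ => ?_
    rw [Finset.mem_range] at hi
    rw [hbr 0 i (by omega), mul_zero]
  -- The brackets have levels (k, i) with i ≤ k - 1; only i = k - 1 exceeds order 2k - 2.
  have hhigh : ηk w - ρ βk = ∑ ℓ, ∑ L, iterPrim (u ℓ) k t * iterPrim (u L) k t *
      pt (J.br (k - 1) ℓ k L) := by
    rw [h.cov_sum_sub k k (fun ℓ => iterPrim (u ℓ) k t) (fun i L => iterPrim (u L) (i + 1) t)]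
    obtain ⟨m, rfl⟩ : ∃ m, k = m + 1 := ⟨k - 1, by omega⟩
    rw [Finset.sum_range_succ, Finset.sum_eq_zero, zero_add]
    · simp only [← Finset.sum_neg_distrib, Nat.add_sub_cancel]
      refine Finset.sum_congr rfl fun L _ => Finset.sum_congr rfl fun ℓ _ => ?_
      rw [J.br_antisymm m L (m + 1) ℓ, map_neg]
      ring
    · intro i hi
      rw [Finset.mem_range] at hi
      refine Finset.sum_eq_zero fun L _ => Finset.sum_eq_zero fun ℓ _ => ?_
      rw [hbr (m + 1) i (by omega), mul_zero]
  have e1 := hS' (x t) (x t)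
  have e3 := h.symm (T - t) (x t) β0
  have e4 := h.symm (T - t) (x t) e
  rw [← hhigh]
  simp only [map_add, map_sub, map_smul, _root_.add_apply,
    _root_.sub_apply, _root_.neg_apply, ContinuousLinearMap.comp_apply,
    smul_eq_mul] at e1 hη0x ⊢
  linear_combination hpβ - hη0x + 1 / 2 * hlow - 1 / 2 * e1 + 1 / 2 * e3 + 1 / 2 * e4

end QuadJet


/-! ### Uniform bounds on the fields and a priori bound on trajectories -/

theorem norm_sum_smul_le {V : Type*} [NormedAddCommGroup V] [NormedSpace ℝ V] {r : ℕ}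
    (v : Fin r → ℝ) (y : Fin r → V) {M : ℝ} (hM : ∀ ℓ, ‖y ℓ‖ ≤ M) :
    ‖∑ ℓ, v ℓ • y ℓ‖ ≤ (∑ ℓ, |v ℓ|) * M := by
  refine (norm_sum_le _ _).trans ?_
  rw [Finset.sum_mul]
  refine Finset.sum_le_sum fun ℓ _ => ?_
  rw [norm_smul, Real.norm_eq_abs]
  exact mul_le_mul_of_nonneg_left (hM ℓ) (abs_nonneg _)

theorem norm_sum_sum_smul_le {V : Type*} [NormedAddCommGroup V] [NormedSpace ℝ V] {r k : ℕ}
    (v : ℕ → Fin r → ℝ) (y : ℕ → Fin r → V) {M N : ℝ} (hN : 0 ≤ N)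
    (hv : ∀ i < k, ∀ ℓ, |v i ℓ| ≤ N) (hM : ∀ i < k, ∀ ℓ, ‖y i ℓ‖ ≤ M) :
    ‖∑ i ∈ Finset.range k, ∑ ℓ, v i ℓ • y i ℓ‖ ≤ k * r * N * M := by
  calc ‖∑ i ∈ Finset.range k, ∑ ℓ, v i ℓ • y i ℓ‖
      ≤ ∑ i ∈ Finset.range k, ∑ _ℓ : Fin r, N * M := by
        refine (norm_sum_le _ _).trans (Finset.sum_le_sum fun i hi => ?_)
        rw [Finset.mem_range] at hi
        refine (norm_sum_le _ _).trans (Finset.sum_le_sum fun ℓ _ => ?_)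
        rw [norm_smul, Real.norm_eq_abs]
        exact mul_le_mul (hv i hi ℓ) (hM i hi ℓ) (norm_nonneg _) hN
    _ = k * r * N * M := by simp; ring

/-- `x` solves `x' = F₀(x) + ∑ u_ℓ F_ℓ(x)` on `(0, T)` and starts at `0`. -/
structure IsTrajectory {E : Type*} [NormedAddCommGroup E] [NormedSpace ℝ E] {r : ℕ} (F₀ : E → E)
    (F : Fin r → E → E) (T : ℝ) (u : Fin r → ℝ → ℝ) (x : ℝ → E) : Prop where
  cont : ContinuousOn x (Set.Icc 0 T)
  zero : x 0 = 0
  deriv : ∀ t ∈ Set.Ioo 0 T, HasDerivAt x (F₀ (x t) + ∑ ℓ, u ℓ t • F ℓ (x t)) t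

namespace QuadJet

variable {E : Type*} [NormedAddCommGroup E] [NormedSpace ℝ E] {r : ℕ}

/-- The constant `K` bounds the `2`-jet `J` of the fields, the Taylor remainders of the fields on
the ball of radius `ρ`, and the inverse of the family of the `J.b i ℓ`, `i < k`. -/
structure IsBounded (J : QuadJet E r) (F₀ : E → E) (F : Fin r → E → E) (k : ℕ) (ρ K : ℝ) :
    Prop where
  one_le : 1 ≤ K
  pos : 0 < ρ
  le_one : ρ ≤ 1
  A_le : ‖J.A‖ ≤ K
  B_le : ‖J.B‖ ≤ K
  b_le : ∀ i ≤ k, ∀ ℓ, ‖J.b i ℓ‖ ≤ K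
  D_le : ∀ i ≤ k, ∀ ℓ, ‖J.D i ℓ‖ ≤ K
  drift : ∀ x, ‖x‖ ≤ ρ → ‖F₀ x - J.A x - (1 / 2 : ℝ) • J.B x x‖ ≤ K * ‖x‖ ^ 3
  field : ∀ ℓ x, ‖x‖ ≤ ρ → ‖F ℓ x - J.b 0 ℓ - J.D 0 ℓ x‖ ≤ K * ‖x‖ ^ 2
  coeff : ∀ c : ℕ → Fin r → ℝ, ∀ i < k, ∀ ℓ,
    |c i ℓ| ≤ K * ‖∑ i ∈ Finset.range k, ∑ ℓ, c i ℓ • J.b i ℓ‖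

/-- The nonlinear part of the velocity. -/
def velRem (J : QuadJet E r) (F₀ : E → E) (F : Fin r → E → E) (v : Fin r → ℝ) (x : E) : E :=
  F₀ x + ∑ ℓ, v ℓ • F ℓ x - J.A x - ∑ ℓ, v ℓ • J.b 0 ℓ

variable {J : QuadJet E r} {F₀ : E → E} {F : Fin r → E → E} {k : ℕ} {ρ K : ℝ}

namespace IsBounded

theorem norm_cubic_le (h : J.IsBounded F₀ F k ρ K) (v : Fin r → ℝ) {x : E} (hx : ‖x‖ ≤ ρ) :
    ‖J.velRem F₀ F v x - (1 / 2 : ℝ) • J.B x x - ∑ ℓ, v ℓ • J.D 0 ℓ x‖ ≤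
      K * (‖x‖ ^ 3 + (∑ ℓ, |v ℓ|) * ‖x‖ ^ 2) := by
  have e : J.velRem F₀ F v x - (1 / 2 : ℝ) • J.B x x - ∑ ℓ, v ℓ • J.D 0 ℓ x =
      (F₀ x - J.A x - (1 / 2 : ℝ) • J.B x x)
        + ∑ ℓ, v ℓ • (F ℓ x - J.b 0 ℓ - J.D 0 ℓ x) := by
    simp only [smul_sub, Finset.sum_sub_distrib, velRem]
    abel
  rw [e]
  refine (norm_add_le _ _).trans ?_
  have h1 := h.drift x hx
  have h2 := norm_sum_smul_le v _ fun ℓ => h.field ℓ x hx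
  linarith

theorem norm_velRem_le (h : J.IsBounded F₀ F k ρ K) (v : Fin r → ℝ) {x : E} (hx : ‖x‖ ≤ ρ) :
    ‖J.velRem F₀ F v x‖ ≤ 2 * K * (‖x‖ ^ 2 + (∑ ℓ, |v ℓ|) * ‖x‖) := by
  have h1 := h.norm_cubic_le v hx
  have h2 : ‖(1 / 2 : ℝ) • J.B x x‖ ≤ 1 / 2 * (K * ‖x‖ ^ 2) := by
    rw [norm_smul]
    have := J.B.le_of_opNorm₂_le_of_le h.B_le le_rfl le_rfl (x := x) (y := x)
    norm_num
    nlinarith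
  have h3 := norm_sum_smul_le v (fun ℓ => J.D 0 ℓ x)
    fun ℓ => (J.D 0 ℓ).le_of_opNorm_le (h.D_le 0 (Nat.zero_le k) ℓ) x
  have h4 : ‖J.velRem F₀ F v x‖ ≤ ‖J.velRem F₀ F v x - (1 / 2 : ℝ) • J.B x x
      - ∑ ℓ, v ℓ • J.D 0 ℓ x‖ + ‖∑ ℓ, v ℓ • J.D 0 ℓ x‖ + ‖(1 / 2 : ℝ) • J.B x x‖ := by
    refine le_trans (le_of_eq ?_) ((norm_add_le _ _).trans (add_le_add (norm_add_le _ _) le_rfl))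
    congr 1; abel
  have hx1 := hx.trans h.le_one
  have hU : 0 ≤ ∑ ℓ, |v ℓ| := Finset.sum_nonneg fun _ _ => abs_nonneg _
  have hK := h.one_le
  have h5 : ‖x‖ ^ 3 ≤ ‖x‖ ^ 2 := by
    have := norm_nonneg x
    nlinarith [sq_nonneg ‖x‖]
  have h6 : (∑ ℓ, |v ℓ|) * ‖x‖ ^ 2 ≤ (∑ ℓ, |v ℓ|) * ‖x‖ := by
    have := norm_nonneg x
    gcongr
    nlinarith
  have h7 : K * (‖x‖ ^ 3 + (∑ ℓ, |v ℓ|) * ‖x‖ ^ 2) ≤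
      K * (‖x‖ ^ 2 + (∑ ℓ, |v ℓ|) * ‖x‖) := by gcongr
  have h8 : 0 ≤ K * ‖x‖ ^ 2 := by positivity
  linarith

theorem norm_vel_le (h : J.IsBounded F₀ F k ρ K) (v : Fin r → ℝ) {x : E} (hx : ‖x‖ ≤ ρ) :
    ‖F₀ x + ∑ ℓ, v ℓ • F ℓ x‖ ≤ 3 * K * ‖x‖ + 3 * K * ∑ ℓ, |v ℓ| := by
  have e : F₀ x + ∑ ℓ, v ℓ • F ℓ x = J.velRem F₀ F v x + J.A x + ∑ ℓ, v ℓ • J.b 0 ℓ := by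
    simp only [velRem]; abel
  rw [e]
  have h1 := h.norm_velRem_le v hx
  have h2 := J.A.le_of_opNorm_le h.A_le x
  have h3 := norm_sum_smul_le v (fun ℓ => J.b 0 ℓ) fun ℓ => h.b_le 0 (Nat.zero_le k) ℓ
  have hx1 := hx.trans h.le_one
  have hx0 := norm_nonneg x
  have hU : 0 ≤ ∑ ℓ, |v ℓ| := Finset.sum_nonneg fun _ _ => abs_nonneg _
  have hK := h.one_le
  have h4 : 2 * K * (‖x‖ ^ 2 + (∑ ℓ, |v ℓ|) * ‖x‖) ≤ 2 * K * (‖x‖ + (∑ ℓ, |v ℓ|)) := by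
    gcongr
    · nlinarith
    · nlinarith
  refine (norm_add₃_le).trans ?_
  linarith

/-- A trajectory driven by a control with small `L¹` norm stays small on short time intervals. -/
theorem norm_trajectory_le (h : J.IsBounded F₀ F k ρ K) {T : ℝ} (hKT : 6 * K * T ≤ 1)
    {u : Fin r → ℝ → ℝ} (hu : ∀ ℓ, Continuous (u ℓ)) {x : ℝ → E} (hx : IsTrajectory F₀ F T u x)
    (hN : 6 * K * ∫ t in (0 : ℝ)..T, ∑ ℓ, |u ℓ t| < ρ) :
    ∀ t ∈ Set.Icc 0 T, ‖x t‖ ≤ 6 * K * ∫ t in (0 : ℝ)..T, ∑ ℓ, |u ℓ t| := by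
  have hK := h.one_le
  have hUc : Continuous fun t => ∑ ℓ, |u ℓ t| := by fun_prop
  have hU0 : ∀ t, 0 ≤ ∑ ℓ, |u ℓ t| := fun t => Finset.sum_nonneg fun _ _ => abs_nonneg _
  -- Bootstrap: inside the ball of radius ρ the short-time Gronwall bound holds with constant 3K,
  -- whence the condition 6KT ≤ 1 and the factor 6K.
  have claim : ∀ τ ∈ Set.Icc 0 T, (∀ t ∈ Set.Ioo 0 τ, ‖x t‖ ≤ ρ) → ∀ t ∈ Set.Icc 0 τ,
      ‖x t‖ ≤ 6 * K * ∫ t in (0 : ℝ)..T, ∑ ℓ, |u ℓ t| := by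
    intro τ hτ hρ t ht
    have h1 := norm_le_two_mul_integral (K := 3 * K) (g := fun t => 3 * K * ∑ ℓ, |u ℓ t|) hτ.1
      (by linarith) (by nlinarith [hτ.2]) (hx.cont.mono (Set.Icc_subset_Icc_right hτ.2)) hx.zero
      (fun t ht => hx.deriv t (Set.Ioo_subset_Ioo_right hτ.2 ht)) (by fun_prop)
      (fun t => mul_nonneg (by linarith) (hU0 t))
      (fun t ht => h.norm_vel_le (fun ℓ => u ℓ t) (hρ t ht)) t ht
    rw [intervalIntegral.integral_const_mul] at h1
    have h2 : ∫ t in (0 : ℝ)..τ, ∑ ℓ, |u ℓ t| ≤ ∫ t in (0 : ℝ)..T, ∑ ℓ, |u ℓ t| :=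
      intervalIntegral.integral_mono_interval le_rfl hτ.1 hτ.2
        (Filter.Eventually.of_forall hU0) (hUc.intervalIntegrable _ _)
    nlinarith
  by_contra! hcon
  obtain ⟨t₁, ht₁, hlt⟩ := hcon
  have hex : ∃ t ∈ Set.Icc 0 T, ρ ≤ ‖x t‖ := by
    by_contra! hcon
    exact absurd (claim T ⟨ht₁.1.trans ht₁.2, le_rfl⟩
      (fun t ht => (hcon t (Set.Ioo_subset_Icc_self ht)).le) t₁ ht₁) (not_le.2 hlt)
  -- At the first time the norm reaches ρ, the claim bounds it by a quantity smaller than ρ.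
  have hclosed : IsCompact (Set.Icc 0 T ∩ x ⁻¹' {y | ρ ≤ ‖y‖}) :=
    isCompact_Icc.of_isClosed_subset
      (hx.cont.preimage_isClosed_of_isClosed isClosed_Icc
        (isClosed_le continuous_const continuous_norm)) Set.inter_subset_left
  obtain ⟨m, hm, hmin⟩ := hclosed.exists_isLeast (by
    obtain ⟨t, ht, hρt⟩ := hex
    exact ⟨t, ht, hρt⟩)
  have h1 := claim m hm.1 (fun t ht => by
    by_contra! hcon
    exact absurd (hmin ⟨⟨ht.1.le, ht.2.le.trans hm.1.2⟩, hcon.le⟩) (not_le.2 ht.2)) m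
    ⟨hm.1.1, le_rfl⟩
  exact absurd (hm.2.trans h1) (not_le.2 hN)

end IsBounded

end QuadJet


/-! ### Lower bound for the growth of the corrected functional -/

theorem sq_integral_le {f : ℝ → ℝ} {a b : ℝ} (hab : a < b)
    (hf : IntervalIntegrable f volume a b)
    (hf2 : IntervalIntegrable (fun t => f t ^ 2) volume a b) :
    (∫ t in a..b, f t) ^ 2 ≤ (b - a) * ∫ t in a..b, f t ^ 2 := by
  set I := ∫ t in a..b, f t with hI
  set Q := ∫ t in a..b, f t ^ 2
  -- Cauchy–Schwarz as nonnegativity of the variance.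
  have h : 0 ≤ ∫ t in a..b, (f t - I / (b - a)) ^ 2 :=
    intervalIntegral.integral_nonneg hab.le fun _ _ => sq_nonneg _
  have e : ∫ t in a..b, (f t - I / (b - a)) ^ 2 =
      Q - 2 * (I / (b - a)) * I + (b - a) * (I / (b - a)) ^ 2 := by
    have : ∀ t, (f t - I / (b - a)) ^ 2 =
        f t ^ 2 - 2 * (I / (b - a)) * f t + (I / (b - a)) ^ 2 := fun t => by ring
    simp only [this]
    rw [intervalIntegral.integral_add (hf2.sub (hf.const_mul _)) (by simp),
      intervalIntegral.integral_sub hf2 (hf.const_mul _), intervalIntegral.integral_const_mul,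
      intervalIntegral.integral_const, smul_eq_mul]
  have hpos : 0 < b - a := sub_pos.2 hab
  rw [e] at h
  have h2 : 0 ≤ (b - a) * (Q - 2 * (I / (b - a)) * I + (b - a) * (I / (b - a)) ^ 2) :=
    mul_nonneg hpos.le h
  have h3 : (b - a) * (Q - 2 * (I / (b - a)) * I + (b - a) * (I / (b - a)) ^ 2) =
      (b - a) * Q - I ^ 2 := by
    field_simp
    ring
  linarith

theorem sq_sum_abs_le {r : ℕ} (a : Fin r → ℝ) : (∑ ℓ, |a ℓ|) ^ 2 ≤ r * ∑ ℓ, a ℓ ^ 2 := by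
  have := sq_sum_le_card_mul_sum_sq (s := Finset.univ) (f := fun ℓ => |a ℓ|)
  simpa using this

theorem abs_iterPrim_le_sum {r : ℕ} {u : Fin r → ℝ → ℝ} (hu : ∀ ℓ, Continuous (u ℓ)) {T : ℝ}
    (hT : T ≤ 1) (i : ℕ) (ℓ : Fin r) {t : ℝ} (ht : t ∈ Set.Icc 0 T) :
    |iterPrim (u ℓ) (i + 1) t| ≤ ∫ s in (0 : ℝ)..T, ∑ ℓ, |u ℓ s| := by
  refine (abs_iterPrim_le (hu ℓ) hT i t ht).trans ?_
  refine intervalIntegral.integral_mono_on (ht.1.trans ht.2) ((hu ℓ).abs.intervalIntegrable _ _)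
    (Continuous.intervalIntegrable (by fun_prop) _ _) fun s _ => ?_
  exact Finset.single_le_sum (f := fun ℓ => |u ℓ s|) (fun _ _ => abs_nonneg _) (Finset.mem_univ ℓ)

namespace QuadJet

variable {E : Type*} [NormedAddCommGroup E] [NormedSpace ℝ E] {r : ℕ}
variable {J : QuadJet E r} {F₀ : E → E} {F : Fin r → E → E} {k : ℕ} {ρ K : ℝ}
  {P : E →L[ℝ] ℝ} {p : ℝ → E →L[ℝ] ℝ} {S : ℝ → E →L[ℝ] E →L[ℝ] ℝ}

theorem IsBounded.norm_velRem_trajectory_le (h : J.IsBounded F₀ F k ρ K) {T : ℝ}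
    (hKT : 6 * K * T ≤ 1) {u : Fin r → ℝ → ℝ} (hu : ∀ ℓ, Continuous (u ℓ)) {x : ℝ → E}
    (hx : IsTrajectory F₀ F T u x) {N : ℝ} (hNdef : N = ∫ t in (0 : ℝ)..T, ∑ ℓ, |u ℓ t|)
    (hN0 : 0 ≤ N) (hN : 6 * K * N < ρ) {t : ℝ} (ht : t ∈ Set.Icc 0 T) :
    ‖J.velRem F₀ F (fun ℓ => u ℓ t) (x t)‖ ≤ 72 * K ^ 3 * (N ^ 2 + N * ∑ ℓ, |u ℓ t|) := by
  have hK := h.one_le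
  have hX := h.norm_trajectory_le hKT hu hx (hNdef ▸ hN) t ht
  rw [← hNdef] at hX
  have hU : 0 ≤ ∑ ℓ, |u ℓ t| := Finset.sum_nonneg fun _ _ => abs_nonneg _
  have h1 := h.norm_velRem_le (fun ℓ => u ℓ t) (hX.trans hN.le)
  have hx0 := norm_nonneg (x t)
  have h2 : 2 * K * (‖x t‖ ^ 2 + (∑ ℓ, |u ℓ t|) * ‖x t‖) ≤
      2 * K * ((6 * K * N) ^ 2 + (∑ ℓ, |u ℓ t|) * (6 * K * N)) := by gcongr
  have h3 : K ^ 2 * ((∑ ℓ, |u ℓ t|) * N) ≤ K ^ 3 * ((∑ ℓ, |u ℓ t|) * N) := by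
    gcongr
    norm_num
  have h4 : 0 ≤ K ^ 3 * ((∑ ℓ, |u ℓ t|) * N) := by positivity
  nlinarith

/-- The distance of the trajectory to the span of the first brackets is controlled by the `k`-th
primitive of the control. -/
theorem IsBounded.norm_sub_primSum_le (h : J.IsBounded F₀ F k ρ K) {T : ℝ} (hT0 : 0 ≤ T)
    (hKT : 6 * K * T ≤ 1) {u : Fin r → ℝ → ℝ} (hu : ∀ ℓ, Continuous (u ℓ)) {x : ℝ → E}
    (hx : IsTrajectory F₀ F T u x) {N I : ℝ} (hNdef : N = ∫ t in (0 : ℝ)..T, ∑ ℓ, |u ℓ t|)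
    (hN0 : 0 ≤ N) (hN : 6 * K * N < ρ)
    (hIdef : I = ∫ t in (0 : ℝ)..T, ∑ ℓ, |iterPrim (u ℓ) k t|) (hI0 : 0 ≤ I) :
    ∀ t ∈ Set.Icc 0 T,
      ‖x t - ∑ i ∈ Finset.range k, ∑ ℓ, iterPrim (u ℓ) (i + 1) t • J.b i ℓ‖ ≤
        288 * K ^ 3 * (I + N ^ 2) := by
  have hK := h.one_le
  have hT1 : T ≤ 1 := by nlinarith
  have hUk : Continuous fun t => ∑ ℓ, |iterPrim (u ℓ) k t| :=
    continuous_finsetSum _ fun ℓ _ => (continuous_iterPrim (hu ℓ) k).abs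
  have hU : Continuous fun t => ∑ ℓ, |u ℓ t| := by fun_prop
  have hU0 : ∀ t, 0 ≤ ∑ ℓ, |u ℓ t| := fun t => Finset.sum_nonneg fun _ _ => abs_nonneg _
  have hUk0 : ∀ t, 0 ≤ ∑ ℓ, |iterPrim (u ℓ) k t| :=
    fun t => Finset.sum_nonneg fun _ _ => abs_nonneg _
  have hwc : Continuous fun t => ∑ i ∈ Finset.range k, ∑ ℓ, iterPrim (u ℓ) (i + 1) t • J.b i ℓ :=
    continuous_finsetSum _ fun i _ => continuous_finsetSum _ fun ℓ _ =>
      (continuous_iterPrim (hu ℓ) (i + 1)).smul continuous_const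
  -- The difference y = x - w satisfies y' = A y + β_k + (nonlinear part): subtracting w leaves only
  -- the k-th primitive as linear forcing.
  have key := norm_le_two_mul_integral (K := K) (τ := T)
    (y := fun t => x t - ∑ i ∈ Finset.range k, ∑ ℓ, iterPrim (u ℓ) (i + 1) t • J.b i ℓ)
    (y' := fun t => J.A (x t - ∑ i ∈ Finset.range k, ∑ ℓ, iterPrim (u ℓ) (i + 1) t • J.b i ℓ)
      + ∑ ℓ, iterPrim (u ℓ) k t • J.b k ℓ + J.velRem F₀ F (fun ℓ => u ℓ t) (x t))
    (g := fun t => K * ∑ ℓ, |iterPrim (u ℓ) k t|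
      + (72 * K ^ 3 * N ^ 2 + 72 * K ^ 3 * N * ∑ ℓ, |u ℓ t|))
    hT0 (by linarith) (by nlinarith) (hx.cont.sub hwc.continuousOn)
    (by simp [hx.zero, iterPrim_succ_zero]) ?_ (by fun_prop) ?_ ?_
  · intro t ht
    refine (key t ht).trans ?_
    rw [intervalIntegral.integral_add ((hUk.const_mul _).intervalIntegrable _ _)
        (Continuous.intervalIntegrable (by fun_prop) _ _),
      intervalIntegral.integral_add (by simp) ((hU.const_mul _).intervalIntegrable _ _),
      intervalIntegral.integral_const, intervalIntegral.integral_const_mul,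
      intervalIntegral.integral_const_mul, ← hNdef, ← hIdef, smul_eq_mul, sub_zero]
    have h1 : T * (72 * K ^ 3 * N ^ 2) ≤ 72 * K ^ 3 * N ^ 2 :=
      mul_le_of_le_one_left (by positivity) hT1
    have h2 : K * I ≤ K ^ 3 * I := by
      gcongr
      exact le_self_pow₀ hK (by norm_num)
    have h3 : 0 ≤ K ^ 3 * I := by positivity
    nlinarith
  · intro t ht
    refine ((hx.deriv t ht).sub (J.hasDerivAt_primSum_b hu k t)).congr_deriv ?_
    simp only [velRem, map_sub]
    abel
  · intro t
    have := hU0 t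
    have := hUk0 t
    positivity
  · intro t ht
    have ht' := Set.Ioo_subset_Icc_self ht
    have h1 := J.A.le_of_opNorm_le h.A_le
      (x t - ∑ i ∈ Finset.range k, ∑ ℓ, iterPrim (u ℓ) (i + 1) t • J.b i ℓ)
    have h2 := norm_sum_smul_le (fun ℓ => iterPrim (u ℓ) k t) (fun ℓ => J.b k ℓ)
      fun ℓ => h.b_le k le_rfl ℓ
    have h3 := h.norm_velRem_trajectory_le hKT hu hx hNdef hN0 hN ht'
    refine norm_add₃_le.trans ?_
    linarith

theorem IsBounded.norm_cov_le (h : J.IsBounded F₀ F k ρ K) {s : ℝ} (hp : ‖p s‖ ≤ K)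
    (hS : ‖S s‖ ≤ K) {i : ℕ} (hi : i ≤ k) (ℓ : Fin r) : ‖J.cov p S i ℓ s‖ ≤ 2 * K ^ 2 := by
  have hK := h.one_le
  refine (norm_add_le _ _).trans ?_
  have h1 := (p s).opNorm_comp_le (J.D i ℓ)
  have h2 := (S s).le_opNorm (J.b i ℓ)
  have h3 : ‖p s‖ * ‖J.D i ℓ‖ ≤ K * K := by
    gcongr
    exact h.D_le i hi ℓ
  have h4 : ‖S s‖ * ‖J.b i ℓ‖ ≤ K * K := by
    gcongr
    exact h.b_le i hi ℓ
  nlinarith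

theorem IsBounded.norm_br_le (h : J.IsBounded F₀ F k ρ K) {i j : ℕ} (hi : i ≤ k) (hj : j ≤ k)
    (ℓ L : Fin r) : ‖J.br i ℓ j L‖ ≤ 2 * K ^ 2 := by
  have hK := h.one_le
  refine (norm_sub_le _ _).trans ?_
  have h1 := (J.D j L).le_of_opNorm_le_of_le (h.D_le j hj L) (h.b_le i hi ℓ)
  have h2 := (J.D i ℓ).le_of_opNorm_le_of_le (h.D_le i hi ℓ) (h.b_le j hj L)
  nlinarith

/-- Coercivity is assumed for P = p(0); since p(s) differs from P by O(s), it survives for p(s) with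
a loss linear in s. -/
theorem IsBounded.le_bracket_form (h : J.IsBounded F₀ F k ρ K) {c : ℝ}
    (hpos : ∀ a : Fin r → ℝ,
      c * ∑ ℓ, a ℓ ^ 2 ≤ ∑ ℓ, ∑ L, a ℓ * a L * P (J.br (k - 1) ℓ k L))
    {s : ℝ} (hps : ‖p s - P‖ ≤ K * s) (hs : 0 ≤ s) (a : Fin r → ℝ) :
    (c - 2 * K ^ 3 * r * s) * ∑ ℓ, a ℓ ^ 2 ≤
      ∑ ℓ, ∑ L, a ℓ * a L * p s (J.br (k - 1) ℓ k L) := by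
  have hK := h.one_le
  have e : ∑ ℓ, ∑ L, a ℓ * a L * p s (J.br (k - 1) ℓ k L) =
      ∑ ℓ, ∑ L, a ℓ * a L * P (J.br (k - 1) ℓ k L)
        + ∑ ℓ, a ℓ • ∑ L, a L • (p s - P) (J.br (k - 1) ℓ k L) := by
    simp only [smul_eq_mul, Finset.mul_sum, ← Finset.sum_add_distrib, _root_.sub_apply]
    exact Finset.sum_congr rfl fun ℓ _ => Finset.sum_congr rfl fun L _ => by ring
  have h1 : ∀ ℓ, ‖∑ L, a L • (p s - P) (J.br (k - 1) ℓ k L)‖ ≤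
      (∑ L, |a L|) * (K * s * (2 * K ^ 2)) := fun ℓ =>
    norm_sum_smul_le _ _ fun L => (p s - P).le_of_opNorm_le_of_le hps
      (h.norm_br_le (Nat.sub_le k 1) le_rfl ℓ L)
  have h2 := norm_sum_smul_le a _ h1
  have h3 := sq_sum_abs_le a
  have h4 : (∑ L, |a L|) * ((∑ L, |a L|) * (K * s * (2 * K ^ 2))) ≤
      2 * K ^ 3 * s * (r * ∑ ℓ, a ℓ ^ 2) := by
    calc (∑ L, |a L|) * ((∑ L, |a L|) * (K * s * (2 * K ^ 2)))
        = 2 * K ^ 3 * s * (∑ L, |a L|) ^ 2 := by ring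
      _ ≤ _ := by gcongr
  have h5 := neg_le_of_abs_le (Real.norm_eq_abs _ ▸ h2)
  have h6 := hpos a
  rw [e]
  linarith

theorem IsAdjoint.continuousOn_corrected (h : J.IsAdjoint P p S) {u : Fin r → ℝ → ℝ}
    (hu : ∀ ℓ, Continuous (u ℓ)) (k : ℕ) {T : ℝ} {x : ℝ → E}
    (hx : ContinuousOn x (Set.Icc 0 T)) :
    ContinuousOn (J.corrected k p S T u x) (Set.Icc 0 T) := by
  have hp : Continuous fun t => p (T - t) :=
    (continuous_iff_continuousAt.2 fun s => (h.deriv_p s).continuousAt).comp (by fun_prop)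
  have hSc : Continuous S := continuous_iff_continuousAt.2 fun s => by
    obtain ⟨S', hS', -⟩ := h.deriv_S s
    exact HasDerivAt.continuousAt (F := E →L[ℝ] E →L[ℝ] ℝ) hS'
  have hS : Continuous fun t => S (T - t) := hSc.comp (continuous_const.sub continuous_id)
  have hρ : Continuous fun t =>
      ∑ i ∈ Finset.range k, ∑ ℓ, iterPrim (u ℓ) (i + 1) t • J.cov p S i ℓ (T - t) :=
    continuous_iff_continuousAt.2 fun t => (h.hasDerivAt_primSum_cov hu k T t).continuousAt
  have hw : Continuous fun t =>
      ∑ i ∈ Finset.range k, ∑ ℓ, iterPrim (u ℓ) (i + 1) t • J.b i ℓ :=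
    continuous_iff_continuousAt.2 fun t => (J.hasDerivAt_primSum_b hu k t).continuousAt
  exact (((hp.continuousOn.clm_apply hx).add
    (continuousOn_const.mul ((hS.continuousOn.clm_apply hx).clm_apply hx))).sub
    (hρ.continuousOn.clm_apply hx)).add (continuous_const.mul (hρ.clm_apply hw)).continuousOn

/-- The drift of the corrected functional along trajectories. -/
theorem IsBounded.le_corrected (h : J.IsBounded F₀ F k ρ K) (hA : J.IsAdjoint P p S)
    (hk : 1 ≤ k) (hp : ∀ s ∈ Set.Icc (0 : ℝ) 1, ‖p s‖ ≤ K)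
    (hS : ∀ s ∈ Set.Icc (0 : ℝ) 1, ‖S s‖ ≤ K)
    (hpP : ∀ s ∈ Set.Icc (0 : ℝ) 1, ‖p s - P‖ ≤ K * s)
    (hb : ∀ s ℓ, p s (J.b 0 ℓ) = 0)
    (hbr : ∀ s i j, i + j ≤ 2 * k - 2 → ∀ ℓ L, p s (J.br i ℓ j L) = 0) {c : ℝ}
    (hpos : ∀ a : Fin r → ℝ,
      c * ∑ ℓ, a ℓ ^ 2 ≤ ∑ ℓ, ∑ L, a ℓ * a L * P (J.br (k - 1) ℓ k L))
    {T : ℝ} (hT0 : 0 ≤ T) (hKT : 6 * K * T ≤ 1) {u : Fin r → ℝ → ℝ}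
    (hu : ∀ ℓ, Continuous (u ℓ)) {x : ℝ → E}
    (hx : IsTrajectory F₀ F T u x) {N I : ℝ} (hNdef : N = ∫ t in (0 : ℝ)..T, ∑ ℓ, |u ℓ t|)
    (hN0 : 0 ≤ N) (hN : 6 * K * N < ρ)
    (hIdef : I = ∫ t in (0 : ℝ)..T, ∑ ℓ, |iterPrim (u ℓ) k t|) (hI0 : 0 ≤ I) :
    (c / 2 - K ^ 3 * r * T) * (∫ t in (0 : ℝ)..T, ∑ ℓ, iterPrim (u ℓ) k t ^ 2)
      - 576 * K ^ 5 * I * (I + N ^ 2) - 2 * (648 + 144 * k * r) * K ^ 5 * N ^ 3 ≤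
    J.corrected k p S T u x T := by
  have hK := h.one_le
  have hT1 : T ≤ 1 := by nlinarith
  set w : ℝ → E := fun t => ∑ i ∈ Finset.range k, ∑ ℓ, iterPrim (u ℓ) (i + 1) t • J.b i ℓ with hw
  set C := (648 + 144 * (k : ℝ) * r) * K ^ 5 with hC
  have hC0 : 0 ≤ C := by positivity
  have hUk : Continuous fun t => ∑ ℓ, |iterPrim (u ℓ) k t| :=
    continuous_finsetSum _ fun ℓ _ => (continuous_iterPrim (hu ℓ) k).abs
  have hV : Continuous fun t => ∑ ℓ, iterPrim (u ℓ) k t ^ 2 :=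
    continuous_finsetSum _ fun ℓ _ => (continuous_iterPrim (hu ℓ) k).pow 2
  have hU : Continuous fun t => ∑ ℓ, |u ℓ t| := by fun_prop
  have hU0 : ∀ t, 0 ≤ ∑ ℓ, |u ℓ t| := fun t => Finset.sum_nonneg fun _ _ => abs_nonneg _
  have hUk0 : ∀ t, 0 ≤ ∑ ℓ, |iterPrim (u ℓ) k t| :=
    fun t => Finset.sum_nonneg fun _ _ => abs_nonneg _
  have hV0 : ∀ t, 0 ≤ ∑ ℓ, iterPrim (u ℓ) k t ^ 2 :=
    fun t => Finset.sum_nonneg fun _ _ => sq_nonneg _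
  -- A continuous lower bound for the derivative: the definite form, the cross term with x - w, and
  -- the cubic errors.
  let φ : ℝ → ℝ := fun t => (c / 2 - K ^ 3 * r * T) * ∑ ℓ, iterPrim (u ℓ) k t ^ 2
    - 576 * K ^ 5 * (I + N ^ 2) * ∑ ℓ, |iterPrim (u ℓ) k t|
    - (C * N ^ 3 + C * N ^ 2 * ∑ ℓ, |u ℓ t|)
  have hφc : Continuous φ := by fun_prop
  have key := intervalIntegral.integral_le_sub_of_hasDeriv_right_of_le (φ := φ) hT0
    (hA.continuousOn_corrected hu k hx.cont)
    (fun t ht => (hA.hasDerivAt_corrected hk hu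
      (e := J.velRem F₀ F (fun ℓ => u ℓ t) (x t)) (T := T)
      ((hx.deriv t ht).congr_deriv (by simp only [velRem]; abel)) (hb _) (hbr _)).hasDerivWithinAt)
    hφc.continuousOn.integrableOn_Icc (fun t ht => ?_)
  · have hzero : J.corrected k p S T u x 0 = 0 := by
      simp [corrected, hx.zero, iterPrim_succ_zero]
    rw [hzero, sub_zero] at key
    refine le_trans ?_ key
    simp only [φ]
    rw [intervalIntegral.integral_sub (Continuous.intervalIntegrable (by fun_prop) _ _)
        (Continuous.intervalIntegrable (by fun_prop) _ _),
      intervalIntegral.integral_sub ((hV.const_mul _).intervalIntegrable _ _)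
        ((hUk.const_mul _).intervalIntegrable _ _),
      intervalIntegral.integral_add (by simp) ((hU.const_mul _).intervalIntegrable _ _),
      intervalIntegral.integral_const, intervalIntegral.integral_const_mul,
      intervalIntegral.integral_const_mul, intervalIntegral.integral_const_mul, ← hNdef, ← hIdef, smul_eq_mul, sub_zero]
    have h1 : T * (C * N ^ 3) ≤ C * N ^ 3 := mul_le_of_le_one_left (by positivity) hT1
    have h2 : C * N ^ 2 * N = C * N ^ 3 := by ring
    have h3 : 2 * (648 + 144 * (k : ℝ) * r) * K ^ 5 * N ^ 3 = 2 * (C * N ^ 3) := by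
      rw [hC]; ring
    linarith
  · have ht' := Set.Ioo_subset_Icc_self ht
    have hs : T - t ∈ Set.Icc (0 : ℝ) 1 := ⟨by linarith [ht.2], by linarith [ht.1]⟩
    set s := T - t with hsdef
    set U := ∑ ℓ, |u ℓ t|
    have hUt : 0 ≤ U := hU0 t
    have hX := h.norm_trajectory_le hKT hu hx (hNdef ▸ hN) t ht'
    rw [← hNdef] at hX
    have hx0 := norm_nonneg (x t)
    set e := J.velRem F₀ F (fun ℓ => u ℓ t) (x t) with he
    have hE : ‖e‖ ≤ 72 * K ^ 3 * (N ^ 2 + N * U) :=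
      h.norm_velRem_trajectory_le hKT hu hx hNdef hN0 hN ht'
    set η := ∑ ℓ, iterPrim (u ℓ) k t • J.cov p S k ℓ s
    set R := ∑ i ∈ Finset.range k, ∑ ℓ, iterPrim (u ℓ) (i + 1) t • J.cov p S i ℓ s
    -- the term that is linear in the `k`-th primitive
    have h1 : |η (x t - w t)| ≤
        576 * K ^ 5 * (I + N ^ 2) * ∑ ℓ, |iterPrim (u ℓ) k t| := by
      have hη := norm_sum_smul_le (fun ℓ => iterPrim (u ℓ) k t) _
        fun ℓ => h.norm_cov_le (hp s hs) (hS s hs) le_rfl ℓ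
      refine (η.le_of_opNorm_le_of_le hη (h.norm_sub_primSum_le hT0 hKT hu hx hNdef hN0 hN hIdef
        hI0 t ht')).trans (le_of_eq ?_)
      ring
    -- the quadratic term
    have h2 : (c - 2 * K ^ 3 * r * T) * ∑ ℓ, iterPrim (u ℓ) k t ^ 2 ≤
        ∑ ℓ, ∑ L, iterPrim (u ℓ) k t * iterPrim (u L) k t * p s (J.br (k - 1) ℓ k L) := by
      refine le_trans ?_ (h.le_bracket_form hpos (hpP s hs) hs.1 fun ℓ => iterPrim (u ℓ) k t)
      refine mul_le_mul_of_nonneg_right ?_ (hV0 t)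
      have : 2 * K ^ 3 * r * s ≤ 2 * K ^ 3 * r * T := by
        gcongr
        linarith [ht.1]
      linarith
    -- the cubic terms
    have h3 : |p s (e - (1 / 2 : ℝ) • J.B (x t) (x t) - ∑ ℓ, u ℓ t • J.D 0 ℓ (x t))| ≤
        216 * K ^ 5 * (N ^ 3 + N ^ 2 * U) := by
      refine ((p s).le_of_opNorm_le_of_le (hp s hs)
        (h.norm_cubic_le (fun ℓ => u ℓ t) (hX.trans hN.le))).trans ?_
      calc K * (K * (‖x t‖ ^ 3 + U * ‖x t‖ ^ 2))
          ≤ K * (K * ((6 * K * N) ^ 3 + U * (6 * K * N) ^ 2)) := by gcongr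
        _ = 216 * K ^ 5 * N ^ 3 + 36 * K ^ 4 * (N ^ 2 * U) := by ring
        _ ≤ 216 * K ^ 5 * N ^ 3 + 216 * K ^ 5 * (N ^ 2 * U) := by
          gcongr
          · norm_num
          · norm_num
        _ = _ := by ring
    have h4 : |S s e (x t)| ≤ 432 * K ^ 5 * (N ^ 3 + N ^ 2 * U) := by
      refine ((S s).le_of_opNorm₂_le_of_le (hS s hs) hE hX).trans (le_of_eq ?_)
      ring
    have h5 : |R e| ≤ 144 * k * r * K ^ 5 * (N ^ 3 + N ^ 2 * U) := by
      have hR : ‖R‖ ≤ k * r * N * (2 * K ^ 2) :=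
        norm_sum_sum_smul_le (fun i ℓ => iterPrim (u ℓ) (i + 1) t) _ hN0
          (fun i _ ℓ => hNdef ▸ abs_iterPrim_le_sum hu hT1 i ℓ ht')
          (fun i hi ℓ => h.norm_cov_le (hp s hs) (hS s hs) hi.le ℓ)
      refine (R.le_of_opNorm_le_of_le hR hE).trans (le_of_eq ?_)
      ring
    have e1 := neg_le_of_abs_le h1
    have e3 := neg_le_of_abs_le h3
    have e4 := neg_le_of_abs_le h4
    have e5 := le_of_abs_le h5
    have e6 : C * N ^ 3 + C * N ^ 2 * U = 216 * K ^ 5 * (N ^ 3 + N ^ 2 * U)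
        + 432 * K ^ 5 * (N ^ 3 + N ^ 2 * U) + 144 * k * r * K ^ 5 * (N ^ 3 + N ^ 2 * U) := by
      rw [hC]; ring
    have e7 : (c / 2 - K ^ 3 * r * T) * ∑ ℓ, iterPrim (u ℓ) k t ^ 2 =
        1 / 2 * ((c - 2 * K ^ 3 * r * T) * ∑ ℓ, iterPrim (u ℓ) k t ^ 2) := by ring
    change φ t ≤ _
    simp only [φ]
    linarith

end QuadJet


/-! ### Drift estimate for the final state -/

namespace QuadJet

variable {E : Type*} [NormedAddCommGroup E] [NormedSpace ℝ E] {r : ℕ}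
variable {J : QuadJet E r} {F₀ : E → E} {F : Fin r → E → E} {k : ℕ} {ρ K : ℝ}
  {P : E →L[ℝ] ℝ} {p : ℝ → E →L[ℝ] ℝ} {S : ℝ → E →L[ℝ] E →L[ℝ] ℝ}

theorem IsBounded.mono (h : J.IsBounded F₀ F k ρ K) {K' : ℝ} (hK : K ≤ K') :
    J.IsBounded F₀ F k ρ K' where
  one_le := h.one_le.trans hK
  pos := h.pos
  le_one := h.le_one
  A_le := h.A_le.trans hK
  B_le := h.B_le.trans hK
  b_le i hi ℓ := (h.b_le i hi ℓ).trans hK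
  D_le i hi ℓ := (h.D_le i hi ℓ).trans hK
  drift x hx := (h.drift x hx).trans (by gcongr)
  field ℓ x hx := (h.field ℓ x hx).trans (by gcongr)
  coeff c i hi ℓ := (h.coeff c i hi ℓ).trans (by gcongr)

theorem IsAdjoint.exists_bound (h : J.IsAdjoint P p S) :
    ∃ K, (∀ s ∈ Set.Icc (0 : ℝ) 1, ‖p s‖ ≤ K) ∧ (∀ s ∈ Set.Icc (0 : ℝ) 1, ‖S s‖ ≤ K) ∧
      ∀ s ∈ Set.Icc (0 : ℝ) 1, ‖p s - P‖ ≤ K * s := by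
  have hpc : Continuous p := continuous_iff_continuousAt.2 fun s => (h.deriv_p s).continuousAt
  have hSc : Continuous S := continuous_iff_continuousAt.2 fun s => by
    obtain ⟨S', hS', -⟩ := h.deriv_S s
    exact HasDerivAt.continuousAt (F := E →L[ℝ] E →L[ℝ] ℝ) hS'
  obtain ⟨K₁, h1⟩ := isCompact_Icc.exists_bound_of_continuousOn (s := Set.Icc (0 : ℝ) 1)
    hpc.continuousOn
  obtain ⟨K₂, h2⟩ := isCompact_Icc.exists_bound_of_continuousOn
    (E := E →L[ℝ] E →L[ℝ] ℝ) (s := Set.Icc (0 : ℝ) 1) hSc.continuousOn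
  have hK₁ : 0 ≤ K₁ := (norm_nonneg _).trans (h1 0 (by simp))
  have h3 := norm_image_sub_le_of_norm_deriv_le_segment' (f := p) (a := 0) (b := 1)
    (f' := fun s => (p s).comp J.A) (C := K₁ * ‖J.A‖)
    (fun s _ => (h.deriv_p s).hasDerivWithinAt) (fun s hs =>
      ((p s).opNorm_comp_le J.A).trans (by
        gcongr
        exact h1 s (Set.Ico_subset_Icc_self hs)))
  refine ⟨max (max K₁ K₂) (K₁ * ‖J.A‖), fun s hs => (h1 s hs).trans ?_,
    fun s hs => (h2 s hs).trans ?_, fun s hs => ?_⟩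
  · exact (le_max_left _ _).trans (le_max_left _ _)
  · exact (le_max_right _ _).trans (le_max_left _ _)
  · have h4 := h3 s hs
    rw [h.p_zero, sub_zero] at h4
    refine h4.trans ?_
    gcongr
    · exact hs.1
    · exact le_max_right _ _

/-- At t = T the adjoint takes its initial value (P, 0), leaving P(x) - R(x) + R(w)/2. The covector
R is bounded in two ways: by N, for R(x), and by ‖w‖ through linear independence, for R(w). The
latter is then quadratic in ‖w‖ ≤ ‖x‖ + O(I + N²). -/
theorem IsBounded.sub_le_apply (h : J.IsBounded F₀ F k ρ K) (hA : J.IsAdjoint P p S)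
    (hp : ∀ s ∈ Set.Icc (0 : ℝ) 1, ‖p s‖ ≤ K) (hS : ∀ s ∈ Set.Icc (0 : ℝ) 1, ‖S s‖ ≤ K)
    {T : ℝ} (hT0 : 0 ≤ T) (hKT : 6 * K * T ≤ 1) {u : Fin r → ℝ → ℝ}
    (hu : ∀ ℓ, Continuous (u ℓ)) {x : ℝ → E}
    (hx : IsTrajectory F₀ F T u x) {N I : ℝ} (hNdef : N = ∫ t in (0 : ℝ)..T, ∑ ℓ, |u ℓ t|)
    (hN0 : 0 ≤ N) (hN : 6 * K * N < ρ)
    (hIdef : I = ∫ t in (0 : ℝ)..T, ∑ ℓ, |iterPrim (u ℓ) k t|) (hI0 : 0 ≤ I) :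
    J.corrected k p S T u x T - 2 * k * r * K ^ 2 * N * ‖x T‖
      - k * r * K ^ 3 * (‖x T‖ + 288 * K ^ 3 * (I + N ^ 2)) ^ 2 ≤ P (x T) := by
  have hK := h.one_le
  have hT1 : T ≤ 1 := by nlinarith
  have hTmem : T ∈ Set.Icc 0 T := ⟨hT0, le_rfl⟩
  have h01 : (0 : ℝ) ∈ Set.Icc (0 : ℝ) 1 := by simp
  have hxw := h.norm_sub_primSum_le hT0 hKT hu hx hNdef hN0 hN hIdef hI0 T hTmem
  set w := ∑ i ∈ Finset.range k, ∑ ℓ, iterPrim (u ℓ) (i + 1) T • J.b i ℓ with hw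
  set R := ∑ i ∈ Finset.range k, ∑ ℓ, iterPrim (u ℓ) (i + 1) T • J.cov p S i ℓ 0 with hR
  have e : J.corrected k p S T u x T = P (x T) - R (x T) + 1 / 2 * R w := by
    simp [corrected, hA.p_zero, hA.S_zero, hR, hw]
  have hcov : ∀ i < k, ∀ ℓ, ‖J.cov p S i ℓ 0‖ ≤ 2 * K ^ 2 := fun i hi ℓ =>
    h.norm_cov_le (hp 0 h01) (hS 0 h01) hi.le ℓ
  have hw0 := norm_nonneg w
  have hR1 : ‖R‖ ≤ k * r * N * (2 * K ^ 2) :=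
    norm_sum_sum_smul_le (fun i ℓ => iterPrim (u ℓ) (i + 1) T) _ hN0
      (fun i _ ℓ => hNdef ▸ abs_iterPrim_le_sum hu hT1 i ℓ hTmem) hcov
  have hR2 : ‖R‖ ≤ k * r * (K * ‖w‖) * (2 * K ^ 2) :=
    norm_sum_sum_smul_le (fun i ℓ => iterPrim (u ℓ) (i + 1) T) _ (by positivity)
      (h.coeff fun i ℓ => iterPrim (u ℓ) (i + 1) T) hcov
  have h1 : |R (x T)| ≤ 2 * k * r * K ^ 2 * N * ‖x T‖ :=
    (R.le_of_opNorm_le hR1 _).trans (le_of_eq (by ring))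
  have h2 : |R w| ≤ 2 * (k * r * K ^ 3 * ‖w‖ ^ 2) :=
    (R.le_of_opNorm_le hR2 _).trans (le_of_eq (by ring))
  have h3 : ‖w‖ ≤ ‖x T‖ + 288 * K ^ 3 * (I + N ^ 2) := by
    have := norm_sub_norm_le w (x T)
    rw [norm_sub_rev] at this
    linarith
  have h4 : k * r * K ^ 3 * ‖w‖ ^ 2 ≤
      k * r * K ^ 3 * (‖x T‖ + 288 * K ^ 3 * (I + N ^ 2)) ^ 2 := by gcongr
  have h5 := neg_le_of_abs_le h1
  have h6 := le_of_abs_le h2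
  linarith

/-- Powers of I are eliminated by I² ≤ T r Q and I ≤ r N. The constant `C₁` collects the multiples
of TQ, which a small T absorbs into half of (c/2) Q; `C` dominates the coefficients of N³, N X and
X². -/
theorem drift_arithmetic {K N I Q X T c C C₁ M V P : ℝ} {k r : ℕ} (hK : 1 ≤ K) (hN0 : 0 ≤ N)
    (hN1 : N ≤ 1) (hQ0 : 0 ≤ Q) (hX : 0 ≤ X) (hIQ : I ^ 2 ≤ T * r * Q)
    (hIN : I ≤ r * N)
    (hC : C = 576 * K ^ 5 * r + 2 * (648 + 144 * k * r) * K ^ 5 + 4 * k * r * K ^ 3 * M ^ 2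
      + 2 * k * r * K ^ 2 + 2 * k * r * K ^ 3)
    (hC₁ : C₁ = K ^ 3 * r + 576 * K ^ 5 * r + 4 * k * r * K ^ 3 * M ^ 2 * r)
    (hC₁T : C₁ * T ≤ c / 4)
    (main : (c / 2 - K ^ 3 * r * T) * Q - 576 * K ^ 5 * I * (I + N ^ 2)
      - 2 * (648 + 144 * k * r) * K ^ 5 * N ^ 3 ≤ V)
    (fin : V - 2 * k * r * K ^ 2 * N * X - k * r * K ^ 3 * (X + M * (I + N ^ 2)) ^ 2 ≤ P) :
    c / 4 * Q - C * N ^ 3 - C * X * (N + X) ≤ P := by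
  have e1 : 576 * K ^ 5 * I * (I + N ^ 2) ≤ 576 * K ^ 5 * (T * r * Q + r * N ^ 3) := by
    rw [mul_assoc]
    gcongr
    have h1 : I * N ^ 2 ≤ r * N * N ^ 2 := by gcongr
    have h2 : I * (I + N ^ 2) = I ^ 2 + I * N ^ 2 := by ring
    have h3 : r * N * N ^ 2 = r * N ^ 3 := by ring
    linarith
  have e2 : (X + M * (I + N ^ 2)) ^ 2 ≤
      2 * X ^ 2 + M ^ 2 * (4 * (T * r * Q) + 4 * N ^ 3) := by
    have h1 : (I + N ^ 2) ^ 2 ≤ 2 * (T * r * Q) + 2 * N ^ 3 := by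
      have : N ^ 4 ≤ N ^ 3 := pow_le_pow_of_le_one hN0 hN1 (by norm_num)
      have h3 : (I + N ^ 2) ^ 2 = 2 * I ^ 2 + 2 * N ^ 4 - (I - N ^ 2) ^ 2 := by ring
      linarith [sq_nonneg (I - N ^ 2)]
    have h2 : M ^ 2 * (I + N ^ 2) ^ 2 ≤ M ^ 2 * (2 * (T * r * Q) + 2 * N ^ 3) := by gcongr
    have h3 : (X + M * (I + N ^ 2)) ^ 2 =
        2 * X ^ 2 + 2 * (M ^ 2 * (I + N ^ 2) ^ 2) - (X - M * (I + N ^ 2)) ^ 2 := by ring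
    linarith [sq_nonneg (X - M * (I + N ^ 2))]
  have e3 : (k : ℝ) * r * K ^ 3 * (X + M * (I + N ^ 2)) ^ 2 ≤
      k * r * K ^ 3 * (2 * X ^ 2 + M ^ 2 * (4 * (T * r * Q) + 4 * N ^ 3)) := by gcongr
  have e4 : C₁ * T * Q ≤ c / 4 * Q := mul_le_mul_of_nonneg_right hC₁T hQ0
  have e5 : C * N ^ 3 + C * X * (N + X) =
      (576 * K ^ 5 * (r * N ^ 3) + 2 * (648 + 144 * k * r) * K ^ 5 * N ^ 3
        + k * r * K ^ 3 * (M ^ 2 * (4 * N ^ 3)) + 2 * k * r * K ^ 2 * N * X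
        + k * r * K ^ 3 * (2 * X ^ 2))
      + ((2 * k * r * K ^ 2 + 2 * k * r * K ^ 3) * N ^ 3
        + (C - 2 * k * r * K ^ 2) * (N * X)
        + (C - 2 * k * r * K ^ 3) * X ^ 2) := by
    rw [hC]; ring
  have e6 : 0 ≤ (2 * k * r * K ^ 2 + 2 * k * r * K ^ 3) * N ^ 3
        + (C - 2 * k * r * K ^ 2) * (N * X)
        + (C - 2 * k * r * K ^ 3) * X ^ 2 := by
    have h1 : 0 ≤ C - 2 * k * r * K ^ 2 := by
      have : C - 2 * k * r * K ^ 2 = 576 * K ^ 5 * r + 2 * (648 + 144 * k * r) * K ^ 5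
        + 4 * k * r * K ^ 3 * M ^ 2 + 2 * k * r * K ^ 3 := by rw [hC]; ring
      rw [this]; positivity
    have h2 : 0 ≤ C - 2 * k * r * K ^ 3 := by
      have : C - 2 * k * r * K ^ 3 = 576 * K ^ 5 * r + 2 * (648 + 144 * k * r) * K ^ 5
        + 4 * k * r * K ^ 3 * M ^ 2 + 2 * k * r * K ^ 2 := by rw [hC]; ring
      rw [this]; positivity
    positivity
  have e7 : (c / 2 - K ^ 3 * r * T) * Q - 576 * K ^ 5 * (T * r * Q)
      - k * r * K ^ 3 * (M ^ 2 * (4 * (T * r * Q))) = c / 2 * Q - C₁ * T * Q := by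
    rw [hC₁]; ring
  linarith

/-- The quadratic obstruction for abstract data: on short time intervals, for controls that are
small in `L¹`, the component `P` of the final state is bounded below by the square of the `L²` norm
of the `k`-th primitive of the control, up to terms that are cubic in the control or small
compared with the final state. -/
theorem IsBounded.exists_drift_estimate (h : J.IsBounded F₀ F k ρ K) (hk : 1 ≤ k)
    (hb : ∀ n ℓ, P (J.b n ℓ) = 0)
    (hbr : ∀ n i j, i + j ≤ 2 * k - 2 → ∀ ℓ L, P ((J.A ^ n) (J.br i ℓ j L)) = 0)
    {c : ℝ} (hc : 0 < c) (hpos : ∀ a : Fin r → ℝ,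
      c * ∑ ℓ, a ℓ ^ 2 ≤ ∑ ℓ, ∑ L, a ℓ * a L * P (J.br (k - 1) ℓ k L)) :
    ∃ T C η : ℝ, 0 < T ∧ T ≤ 1 ∧ 0 ≤ C ∧ 0 < η ∧ ∀ (u : Fin r → ℝ → ℝ) (x : ℝ → E),
      (∀ ℓ, Continuous (u ℓ)) → IsTrajectory F₀ F T u x →
      ∫ t in (0 : ℝ)..T, ∑ ℓ, |u ℓ t| < η →
      c / 4 * (∫ t in (0 : ℝ)..T, ∑ ℓ, iterPrim (u ℓ) k t ^ 2)
        - C * (∫ t in (0 : ℝ)..T, ∑ ℓ, |u ℓ t|) ^ 3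
        - C * ‖x T‖ * ((∫ t in (0 : ℝ)..T, ∑ ℓ, |u ℓ t|) + ‖x T‖) ≤ P (x T) := by
  obtain ⟨p, S, S', hp0, hS0, hpd, hSd, hS', hsymm, hvan⟩ := J.exists_adjoint P
  have hA : J.IsAdjoint P p S := ⟨hp0, hS0, hpd, fun s => ⟨S' s, hSd s, hS' s⟩, hsymm⟩
  obtain ⟨K₀, hpK, hSK, hpPK⟩ := hA.exists_bound
  wlog hKK : K₀ ≤ K generalizing K
  · exact this (h.mono (le_max_left K K₀)) (le_max_right _ _)
  have hp : ∀ s ∈ Set.Icc (0 : ℝ) 1, ‖p s‖ ≤ K := fun s hs => (hpK s hs).trans hKK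
  have hS : ∀ s ∈ Set.Icc (0 : ℝ) 1, ‖S s‖ ≤ K := fun s hs => (hSK s hs).trans hKK
  have hpP : ∀ s ∈ Set.Icc (0 : ℝ) 1, ‖p s - P‖ ≤ K * s := fun s hs =>
    (hpPK s hs).trans (mul_le_mul_of_nonneg_right hKK hs.1)
  have hpb : ∀ s ℓ, p s (J.b 0 ℓ) = 0 := fun s ℓ => hvan _ (fun n => by
    rw [← J.b_add]; exact hb _ ℓ) s
  have hpbr : ∀ s i j, i + j ≤ 2 * k - 2 → ∀ ℓ L, p s (J.br i ℓ j L) = 0 :=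
    fun s i j hij ℓ L => hvan _ (fun n => hbr n i j hij ℓ L) s
  have hK := h.one_le
  set M := 288 * K ^ 3 with hM
  set C₁ := K ^ 3 * r + 576 * K ^ 5 * r + 4 * k * r * K ^ 3 * M ^ 2 * r with hC₁
  set C := 576 * K ^ 5 * r + 2 * (648 + 144 * k * r) * K ^ 5 + 4 * k * r * K ^ 3 * M ^ 2
    + 2 * k * r * K ^ 2 + 2 * k * r * K ^ 3 with hC
  have hC₁0 : 0 ≤ C₁ := by positivity
  -- The first bound serves the Gronwall estimates, the second absorbs the multiples of TQ.
  set T := min (1 / (6 * K)) (c / (4 * (C₁ + 1))) with hT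
  have hT0 : 0 < T := lt_min (by positivity) (by positivity)
  have hKT : 6 * K * T ≤ 1 := by
    have : T ≤ 1 / (6 * K) := min_le_left _ _
    rwa [le_div_iff₀ (by positivity), mul_comm] at this
  have hT1 : T ≤ 1 := by nlinarith
  have hC₁T : C₁ * T ≤ c / 4 := by
    have : T ≤ c / (4 * (C₁ + 1)) := min_le_right _ _
    rw [le_div_iff₀ (by positivity)] at this
    nlinarith
  refine ⟨T, C, ρ / (6 * K), hT0, hT1, by positivity, div_pos h.pos (by positivity),
    fun u x hu hx hη => ?_⟩
  set N := ∫ t in (0 : ℝ)..T, ∑ ℓ, |u ℓ t| with hNdef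
  set Q := ∫ t in (0 : ℝ)..T, ∑ ℓ, iterPrim (u ℓ) k t ^ 2 with hQdef
  set I := ∫ t in (0 : ℝ)..T, ∑ ℓ, |iterPrim (u ℓ) k t| with hIdef
  have hUk : Continuous fun t => ∑ ℓ, |iterPrim (u ℓ) k t| :=
    continuous_finsetSum _ fun ℓ _ => (continuous_iterPrim (hu ℓ) k).abs
  have hV : Continuous fun t => ∑ ℓ, iterPrim (u ℓ) k t ^ 2 :=
    continuous_finsetSum _ fun ℓ _ => (continuous_iterPrim (hu ℓ) k).pow 2
  have hN0 : 0 ≤ N := intervalIntegral.integral_nonneg hT0.le fun t _ =>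
    Finset.sum_nonneg fun _ _ => abs_nonneg _
  have hI0 : 0 ≤ I := intervalIntegral.integral_nonneg hT0.le fun t _ =>
    Finset.sum_nonneg fun _ _ => abs_nonneg _
  have hQ0 : 0 ≤ Q := intervalIntegral.integral_nonneg hT0.le fun t _ =>
    Finset.sum_nonneg fun _ _ => sq_nonneg _
  have hN : 6 * K * N < ρ := by
    rwa [lt_div_iff₀ (by positivity), mul_comm] at hη
  have hN1 : N ≤ 1 := by nlinarith [h.le_one]
  have hIQ : I ^ 2 ≤ T * r * Q := by
    have h1 := sq_integral_le hT0 (hUk.intervalIntegrable _ _) ((hUk.pow 2).intervalIntegrable _ _)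
    have h2 : ∫ t in (0 : ℝ)..T, (∑ ℓ, |iterPrim (u ℓ) k t|) ^ 2 ≤ r * Q := by
      rw [hQdef, ← intervalIntegral.integral_const_mul]
      exact intervalIntegral.integral_mono_on hT0.le ((hUk.pow 2).intervalIntegrable _ _)
        ((hV.const_mul _).intervalIntegrable _ _) fun t _ => sq_sum_abs_le _
    rw [sub_zero] at h1
    nlinarith
  have hIN : I ≤ r * N := by
    have h1 : I ≤ ∫ _ in (0 : ℝ)..T, r * N := by
      refine intervalIntegral.integral_mono_on hT0.le (hUk.intervalIntegrable _ _) (by simp)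
        fun t ht => ?_
      obtain ⟨m, rfl⟩ : ∃ m, k = m + 1 := ⟨k - 1, by omega⟩
      calc ∑ ℓ, |iterPrim (u ℓ) (m + 1) t| ≤ ∑ _ℓ : Fin r, N :=
            Finset.sum_le_sum fun ℓ _ => abs_iterPrim_le_sum hu hT1 m ℓ ht
        _ = r * N := by simp
    rw [intervalIntegral.integral_const, sub_zero, smul_eq_mul] at h1
    have : 0 ≤ r * N := by positivity
    nlinarith
  have main := h.le_corrected hA hk hp hS hpP hpb hpbr hpos hT0.le hKT hu hx hNdef hN0 hN hIdef hI0
  have fin := h.sub_le_apply hA hp hS hT0.le hKT hu hx hNdef hN0 hN hIdef hI0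
  rw [← hM] at fin
  exact drift_arithmetic hK hN0 hN1 hQ0 (norm_nonneg (x T)) hIQ hIN hC hC₁ hC₁T main fin

end QuadJet


/-! ### Interpolation of derivatives in `L²` on an interval -/

theorem exists_pos_mul_sum_sq_le {ι : Type*} [Fintype ι] {q : (ι → ℝ) → ℝ} (hq : Continuous q)
    (hhom : ∀ (t : ℝ) a, q (t • a) = t ^ 2 * q a) (hpos : ∀ a, a ≠ 0 → 0 < q a) :
    ∃ c, 0 < c ∧ ∀ a, c * ∑ i, a i ^ 2 ≤ q a := by
  have hq0 : q 0 = 0 := by simpa using hhom 0 0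
  have hsum : ∀ a : ι → ℝ, ∑ i, a i ^ 2 ≤ Fintype.card ι * ‖a‖ ^ 2 := by
    intro a
    calc ∑ i, a i ^ 2 ≤ ∑ _i : ι, ‖a‖ ^ 2 := by
          refine Finset.sum_le_sum fun i _ => ?_
          rw [← sq_abs, ← Real.norm_eq_abs]
          gcongr
          exact norm_le_pi_norm a i
      _ = _ := by simp
  rcases (Metric.sphere (0 : ι → ℝ) 1).eq_empty_or_nonempty with h | h
  -- The unit sphere is empty only if the space is trivial.
  · refine ⟨1, one_pos, fun a => ?_⟩
    have ha : a = 0 := by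
      by_contra ha
      have : (‖a‖⁻¹ • a) ∈ Metric.sphere (0 : ι → ℝ) 1 := by
        rw [mem_sphere_zero_iff_norm, norm_smul, norm_inv, norm_norm,
          inv_mul_cancel₀ (norm_ne_zero_iff.2 ha)]
      rw [h] at this
      exact this
    simp [ha, hq0]
  · obtain ⟨m, hm, hmin⟩ := (isCompact_sphere (0 : ι → ℝ) 1).exists_isMinOn h hq.continuousOn
    have hm0 : m ≠ 0 := by
      rintro rfl
      simp at hm
    have hqm := hpos m hm0
    refine ⟨q m / (Fintype.card ι + 1), by positivity, fun a => ?_⟩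
    by_cases ha : a = 0
    · simp [ha, hq0]
    have hna : 0 < ‖a‖ := norm_pos_iff.2 ha
    have h1 : q m ≤ q (‖a‖⁻¹ • a) := hmin (by
      rw [mem_sphere_zero_iff_norm, norm_smul, norm_inv, norm_norm, inv_mul_cancel₀ hna.ne'])
    rw [hhom, inv_pow, ← div_eq_inv_mul, le_div_iff₀ (by positivity)] at h1
    refine le_trans ?_ h1
    rw [div_mul_eq_mul_div, div_le_iff₀ (by positivity), mul_assoc]
    refine mul_le_mul_of_nonneg_left ?_ hqm.le
    nlinarith [hsum a, sq_nonneg ‖a‖]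

/-- The L² norm squared is a positive definite form in the coefficients, since a polynomial
vanishing on an interval is zero. -/
theorem exists_coeff_le_integral_sq (n : ℕ) :
    ∃ C, 0 ≤ C ∧ ∀ a : Fin n → ℝ, ∀ i,
      a i ^ 2 ≤ C * ∫ s in (0 : ℝ)..1, (∑ j, a j * s ^ (j : ℕ)) ^ 2 := by
  have hexp : ∀ a : Fin n → ℝ, ∫ s in (0 : ℝ)..1, (∑ j, a j * s ^ (j : ℕ)) ^ 2 =
      ∑ i, ∑ j, a i * a j * ∫ s in (0 : ℝ)..1, s ^ (i : ℕ) * s ^ (j : ℕ) := by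
    intro a
    have : ∀ s : ℝ, (∑ j, a j * s ^ (j : ℕ)) ^ 2 =
        ∑ i, ∑ j, a i * a j * (s ^ (i : ℕ) * s ^ (j : ℕ)) := by
      intro s
      rw [sq, Finset.sum_mul_sum]
      exact Finset.sum_congr rfl fun i _ => Finset.sum_congr rfl fun j _ => by ring
    simp only [this]
    rw [intervalIntegral.integral_finsetSum fun i _ =>
      Continuous.intervalIntegrable (by fun_prop) _ _]
    refine Finset.sum_congr rfl fun i _ => ?_
    rw [intervalIntegral.integral_finsetSum fun i _ =>
      Continuous.intervalIntegrable (by fun_prop) _ _]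
    exact Finset.sum_congr rfl fun j _ => intervalIntegral.integral_const_mul _ _
  obtain ⟨c, hc, h⟩ := exists_pos_mul_sum_sq_le
    (q := fun a : Fin n → ℝ => ∫ s in (0 : ℝ)..1, (∑ j, a j * s ^ (j : ℕ)) ^ 2)
    (by simp only [hexp]; fun_prop)
    (fun t a => by
      rw [← intervalIntegral.integral_const_mul]
      congr 1
      ext s
      simp only [Pi.smul_apply, smul_eq_mul, mul_assoc, ← Finset.mul_sum]
      ring)
    (fun a ha => by
      have hcont : Continuous fun s : ℝ => (∑ j, a j * s ^ (j : ℕ)) ^ 2 := by fun_prop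
      refine (intervalIntegral.integral_nonneg zero_le_one fun _ _ => sq_nonneg _).lt_of_ne ?_
      intro h0
      apply ha
      have hz : ∀ s ∈ Set.Ioo (0 : ℝ) 1, ∑ j, a j * s ^ (j : ℕ) = 0 := by
        intro s hs
        by_contra hne
        refine absurd h0 (ne_of_lt ?_)
        exact intervalIntegral.integral_pos zero_lt_one hcont.continuousOn
          (fun _ _ => sq_nonneg _) ⟨s, Set.Ioo_subset_Icc_self hs, by positivity⟩
      let f : Polynomial ℝ := ∑ j : Fin n, Polynomial.C (a j) * Polynomial.X ^ (j : ℕ)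
      have hf : f = 0 := by
        refine Polynomial.eq_zero_of_infinite_isRoot f
          ((Set.Ioo_infinite (zero_lt_one' ℝ)).mono fun s hs => ?_)
        simpa [f, Polynomial.IsRoot, Polynomial.eval_finsetSum] using hz s hs
      funext j
      have hcoef := congrArg (fun g => Polynomial.coeff g (j : ℕ)) hf
      simp only [f, Polynomial.finsetSum_coeff, Polynomial.coeff_C_mul_X_pow,
        Polynomial.coeff_zero] at hcoef
      rwa [Finset.sum_eq_single j (fun i _ hij => if_neg fun h => hij (Fin.ext h.symm)) (by simp),
        if_pos rfl] at hcoef)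
  refine ⟨c⁻¹, by positivity, fun a i => ?_⟩
  rw [← div_eq_inv_mul, le_div_iff₀ hc, mul_comm]
  refine le_trans ?_ (h a)
  gcongr
  exact Finset.single_le_sum (f := fun i => a i ^ 2) (fun _ _ => sq_nonneg _) (Finset.mem_univ i)

/-- `φ (j + 1)` is the derivative of `φ j` on `[a, b]`, for `j < n`. -/
structure IsDerivChain (n : ℕ) (a b : ℝ) (φ : ℕ → ℝ → ℝ) : Prop where
  cont : ∀ j < n, Continuous (φ j)
  int : IntervalIntegrable (φ n) volume a b
  sq_int : IntervalIntegrable (fun t => φ n t ^ 2) volume a b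
  eq : ∀ j < n, ∀ s ∈ Set.Icc a b, ∀ t ∈ Set.Icc a b, φ j t - φ j s = ∫ x in s..t, φ (j + 1) x

namespace IsDerivChain

theorem mono {n : ℕ} {a b a' b' : ℝ} {φ : ℕ → ℝ → ℝ} (h : IsDerivChain n a b φ) (ha : a ≤ a')
    (hab : a' ≤ b') (hb : b' ≤ b) : IsDerivChain n a' b' φ where
  cont := h.cont
  int := h.int.mono_set (by
    rw [Set.uIcc_of_le hab, Set.uIcc_of_le (ha.trans (hab.trans hb))]
    exact Set.Icc_subset_Icc ha hb)
  sq_int := h.sq_int.mono_set (by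
    rw [Set.uIcc_of_le hab, Set.uIcc_of_le (ha.trans (hab.trans hb))]
    exact Set.Icc_subset_Icc ha hb)
  eq j hj s hs t ht := h.eq j hj s (Set.Icc_subset_Icc ha hb hs) t (Set.Icc_subset_Icc ha hb ht)

theorem shift {n : ℕ} {a b : ℝ} {φ : ℕ → ℝ → ℝ} (j : ℕ) (h : IsDerivChain (j + n) a b φ) :
    IsDerivChain n a b (fun i => φ (j + i)) where
  cont i hi := h.cont (j + i) (by omega)
  int := h.int
  sq_int := h.sq_int
  eq i hi := h.eq (j + i) (by omega)

/-- Induction through the shifted chain: the remainder of φ_0 is the integral of the remainder of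
φ_1. -/
theorem abs_sub_taylor_le {a b : ℝ} (hab : a ≤ b) (n : ℕ) :
    ∀ {φ : ℕ → ℝ → ℝ}, IsDerivChain (n + 1) a b φ → ∀ t ∈ Set.Icc a b,
      |φ 0 t - ∑ i ∈ Finset.range (n + 1), φ i a * ((t - a) ^ i / i.factorial)| ≤
        (b - a) ^ n * ∫ x in a..b, |φ (n + 1) x| := by
  have ha : a ∈ Set.Icc a b := ⟨le_rfl, hab⟩
  induction n with
  | zero =>
    intro φ h t ht
    have h1 := h.eq 0 (by omega) a ha t ht
    simp only [zero_add, Finset.range_one, Finset.sum_singleton, pow_zero, Nat.factorial_zero,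
      Nat.cast_one, div_one, mul_one, one_mul] at h1 ⊢
    rw [h1]
    refine (intervalIntegral.abs_integral_le_integral_abs ht.1).trans ?_
    exact intervalIntegral.integral_mono_interval le_rfl ht.1 ht.2
      (Filter.Eventually.of_forall fun _ => abs_nonneg _) h.int.abs
  | succ n ih =>
    intro φ h t ht
    have h' : IsDerivChain (n + 1) a b (fun i => φ (1 + i)) :=
      shift 1 (by rwa [add_comm 1 (n + 1)])
    have h2 := ih h'
    have hint : ∀ i : ℕ, ∫ s in a..t, (s - a) ^ i / i.factorial =
        (t - a) ^ (i + 1) / (i + 1).factorial := by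
      intro i
      rw [intervalIntegral.integral_div, intervalIntegral.integral_comp_sub_right (fun s => s ^ i),
        integral_pow, Nat.factorial_succ]
      push_cast
      field_simp
      simp
    have e : φ 0 t - ∑ i ∈ Finset.range (n + 1 + 1), φ i a * ((t - a) ^ i / i.factorial) =
        ∫ s in a..t, (φ 1 s - ∑ i ∈ Finset.range (n + 1),
          φ (1 + i) a * ((s - a) ^ i / i.factorial)) := by
      rw [intervalIntegral.integral_sub ((h.cont 1 (by omega)).intervalIntegrable _ _)
        (Continuous.intervalIntegrable (by fun_prop) _ _), ← h.eq 0 (by omega) a ha t ht,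
        intervalIntegral.integral_finsetSum fun i _ =>
          Continuous.intervalIntegrable (by fun_prop) _ _, Finset.sum_range_succ']
      simp only [intervalIntegral.integral_const_mul, hint, pow_zero, Nat.factorial_zero,
        Nat.cast_one, div_one, mul_one, add_comm 1]
      ring
    rw [e]
    have h3 := intervalIntegral.norm_integral_le_of_norm_le_const (a := a) (b := t)
      (f := fun s => φ 1 s - ∑ i ∈ Finset.range (n + 1),
          φ (1 + i) a * ((s - a) ^ i / i.factorial))
      (C := (b - a) ^ n * ∫ x in a..b, |φ (1 + (n + 1)) x|) (fun s hs => by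
        rw [Set.uIoc_of_le ht.1] at hs
        exact h2 s ⟨hs.1.le, hs.2.trans ht.2⟩)
    rw [Real.norm_eq_abs, abs_of_nonneg (sub_nonneg.2 ht.1)] at h3
    refine h3.trans ?_
    rw [add_comm 1 (n + 1), pow_succ, mul_right_comm]
    have h0 : 0 ≤ ∫ x in a..b, |φ (n + 1 + 1) x| :=
      intervalIntegral.integral_nonneg hab fun _ _ => abs_nonneg _
    have h4 : 0 ≤ b - a := sub_nonneg.2 hab
    gcongr
    exact ht.2

/-- The interpolation inequality on one interval, with the natural scaling. -/
theorem exists_local_interpolation (n k : ℕ) (hk : k < n) :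
    ∃ C, 0 ≤ C ∧ ∀ (a h : ℝ) (φ : ℕ → ℝ → ℝ), 0 < h → IsDerivChain n a (a + h) φ →
      h ^ (2 * k) * ∫ t in a..a + h, φ k t ^ 2 ≤
        C * ((∫ t in a..a + h, φ 0 t ^ 2) + h ^ (2 * n) * ∫ t in a..a + h, φ n t ^ 2) := by
  obtain ⟨C, hC, hcoef⟩ := exists_coeff_le_integral_sq n
  obtain ⟨m, rfl⟩ : ∃ m, n = k + (m + 1) := ⟨n - k - 1, by omega⟩
  set n := k + (m + 1) with hn
  refine ⟨4 * (n ^ 2 * (n.factorial : ℝ) ^ 2 * C) + 2, by positivity, fun a h φ hh hφ => ?_⟩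
  have hab : a ≤ a + h := by linarith
  set D := ∫ t in a..a + h, φ n t ^ 2 with hD
  set A := ∫ t in a..a + h, φ 0 t ^ 2 with hA
  set G := ∫ t in a..a + h, |φ n t| with hG
  have hGD : G ^ 2 ≤ h * D := by
    have h1 := sq_integral_le (f := fun t => |φ n t|) (a := a) (b := a + h) (by linarith)
      hφ.int.abs (by simpa only [sq_abs] using hφ.sq_int)
    simpa only [sq_abs, add_sub_cancel_left] using h1
  set p : ℝ → ℝ := fun t => ∑ i ∈ Finset.range n, φ i a * ((t - a) ^ i / i.factorial) with hp
  have hpc : Continuous p := by fun_prop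
  have hp0 : ∀ t ∈ Set.Icc a (a + h), |φ 0 t - p t| ≤ h ^ (k + m) * G := by
    intro t ht
    have := abs_sub_taylor_le hab (k + m) hφ t ht
    rwa [add_sub_cancel_left] at this
  -- The Taylor polynomial p rescaled to [0, 1]. Its L² norm is controlled by φ_0 and the remainder,
  -- and in turn controls every φ_i(a) hⁱ; φ_k is then recovered from these values and its own
  -- Taylor remainder.
  set Y := ∫ s in (0 : ℝ)..1, (∑ j : Fin n, φ j a * h ^ (j : ℕ) / (j : ℕ).factorial *
    s ^ (j : ℕ)) ^ 2 with hY
  have hpY : ∫ t in a..a + h, p t ^ 2 = h * Y := by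
    have h1 := intervalIntegral.smul_integral_comp_mul_add (a := 0) (b := 1)
      (fun t => p t ^ 2) h a
    rw [mul_zero, zero_add, mul_one, add_comm h a, smul_eq_mul] at h1
    rw [← h1, hY]
    congr 2
    ext s
    congr 1
    simp only [hp]
    rw [← Fin.sum_univ_eq_sum_range (fun i => φ i a * ((h * s + a - a) ^ i / i.factorial)) n]
    refine Finset.sum_congr rfl fun i _ => ?_
    rw [add_sub_cancel_right, mul_pow]
    ring
  have hYle : h * Y ≤ 2 * A + 2 * (h ^ (2 * n) * D) := by
    have hφ0 : Continuous (φ 0) := hφ.cont 0 (by omega)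
    have h1 : ∫ t in a..a + h, p t ^ 2 ≤
        ∫ t in a..a + h, (2 * φ 0 t ^ 2 + 2 * (h ^ (k + m) * G) ^ 2) := by
      refine intervalIntegral.integral_mono_on hab (Continuous.intervalIntegrable (by fun_prop) _ _)
        (Continuous.intervalIntegrable (by fun_prop) _ _) fun t ht => ?_
      have h2 := sq_le_sq' (neg_le_of_abs_le (hp0 t ht)) (le_of_abs_le (hp0 t ht))
      nlinarith [sq_nonneg (2 * φ 0 t - p t)]
    rw [hpY, intervalIntegral.integral_add (Continuous.intervalIntegrable (by fun_prop) _ _)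
      (by simp), intervalIntegral.integral_const_mul, intervalIntegral.integral_const,
      add_sub_cancel_left, smul_eq_mul] at h1
    have h3 : h * (2 * (h ^ (k + m) * G) ^ 2) ≤ 2 * (h ^ (2 * n) * D) := by
      calc h * (2 * (h ^ (k + m) * G) ^ 2) = 2 * h ^ (2 * (k + m) + 1) * G ^ 2 := by ring
        _ ≤ 2 * h ^ (2 * (k + m) + 1) * (h * D) := by gcongr
        _ = 2 * (h ^ (2 * n) * D) := by rw [hn]; ring
    linarith
  have hcoefk : ∀ i < m + 1, (φ (k + i) a * h ^ (k + i)) ^ 2 ≤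
      (n.factorial : ℝ) ^ 2 * (C * Y) := by
    intro i hi
    have h1 := hcoef (fun j => φ j a * h ^ (j : ℕ) / (j : ℕ).factorial) ⟨k + i, by omega⟩
    have hf : (0 : ℝ) < (k + i).factorial := by positivity
    have h2 : φ (k + i) a * h ^ (k + i) =
        (k + i).factorial * (φ (k + i) a * h ^ (k + i) / (k + i).factorial) := by
      field_simp
    rw [h2, mul_pow]
    have h3 : ((k + i).factorial : ℝ) ≤ n.factorial := by
      exact_mod_cast Nat.factorial_le (by omega)
    gcongr
  have hY0 : 0 ≤ Y := intervalIntegral.integral_nonneg zero_le_one fun _ _ => sq_nonneg _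
  have hpt : ∀ t ∈ Set.Icc a (a + h), h ^ (2 * k) * φ k t ^ 2 ≤
      2 * (n ^ 2 * (n.factorial : ℝ) ^ 2 * (C * Y)) + 2 * (h ^ (2 * (k + m)) * G ^ 2) := by
    intro t ht
    have h1 := abs_sub_taylor_le hab m (shift k hφ) t ht
    rw [add_sub_cancel_left, add_zero] at h1
    set s := ∑ i ∈ Finset.range (m + 1), φ (k + i) a * ((t - a) ^ i / i.factorial) with hs
    have ht0 : 0 ≤ t - a := by linarith [ht.1]
    have hth : t - a ≤ h := by linarith [ht.2]
    have h2 : (h ^ k * s) ^ 2 ≤ n ^ 2 * (n.factorial : ℝ) ^ 2 * (C * Y) := by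
      rw [hs, Finset.mul_sum]
      refine (sq_sum_le_card_mul_sum_sq).trans ?_
      calc ((Finset.range (m + 1)).card : ℝ) * ∑ i ∈ Finset.range (m + 1),
            (h ^ k * (φ (k + i) a * ((t - a) ^ i / i.factorial))) ^ 2
          ≤ (m + 1 : ℝ) * ∑ i ∈ Finset.range (m + 1), (n.factorial : ℝ) ^ 2 * (C * Y) := by
            rw [Finset.card_range]
            push_cast
            gcongr with i hi
            rw [Finset.mem_range] at hi
            refine le_trans ?_ (hcoefk i hi)
            rw [← sq_abs, ← sq_abs (φ (k + i) a * h ^ (k + i))]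
            refine pow_le_pow_left₀ (abs_nonneg _) ?_ 2
            rw [abs_mul, abs_mul, abs_mul, pow_add, abs_mul, mul_left_comm]
            refine mul_le_mul_of_nonneg_left ?_ (abs_nonneg _)
            refine mul_le_mul_of_nonneg_left ?_ (abs_nonneg _)
            rw [abs_of_nonneg (by positivity), abs_of_nonneg (by positivity)]
            refine (div_le_self (by positivity) ?_).trans (by gcongr)
            exact_mod_cast Nat.factorial_pos i
        _ = (m + 1 : ℝ) ^ 2 * (n.factorial : ℝ) ^ 2 * (C * Y) := by
            simp; ring
        _ ≤ _ := by
            gcongr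
            rw [hn]; push_cast; linarith [(Nat.cast_nonneg k : (0 : ℝ) ≤ k)]
    have h3 : (h ^ k * (φ k t - s)) ^ 2 ≤ h ^ (2 * (k + m)) * G ^ 2 := by
      have h4 := sq_le_sq' (neg_le_of_abs_le h1) (le_of_abs_le h1)
      calc (h ^ k * (φ k t - s)) ^ 2 = h ^ (2 * k) * (φ k t - s) ^ 2 := by ring
        _ ≤ h ^ (2 * k) * (h ^ m * G) ^ 2 := by gcongr
        _ = _ := by ring
    calc h ^ (2 * k) * φ k t ^ 2 = (h ^ k * s + h ^ k * (φ k t - s)) ^ 2 := by ring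
      _ ≤ 2 * (h ^ k * s) ^ 2 + 2 * (h ^ k * (φ k t - s)) ^ 2 := by
          nlinarith [sq_nonneg (h ^ k * s - h ^ k * (φ k t - s))]
      _ ≤ _ := by linarith
  have hφk : Continuous (φ k) := hφ.cont k (by omega)
  have hfin := intervalIntegral.integral_mono_on (μ := volume) hab
    (Continuous.intervalIntegrable (u := fun t => h ^ (2 * k) * φ k t ^ 2) (by fun_prop) _ _)
    intervalIntegrable_const hpt
  rw [intervalIntegral.integral_const_mul, intervalIntegral.integral_const, add_sub_cancel_left,
    smul_eq_mul] at hfin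
  refine hfin.trans ?_
  have h5 : h * (2 * (h ^ (2 * (k + m)) * G ^ 2)) ≤ 2 * (h ^ (2 * n) * D) := by
    calc h * (2 * (h ^ (2 * (k + m)) * G ^ 2)) = 2 * h ^ (2 * (k + m) + 1) * G ^ 2 := by ring
      _ ≤ 2 * h ^ (2 * (k + m) + 1) * (h * D) := by gcongr
      _ = 2 * (h ^ (2 * n) * D) := by rw [hn]; ring
  have h6 : 2 * (n ^ 2 * (n.factorial : ℝ) ^ 2 * C) * (h * Y) ≤
      2 * (n ^ 2 * (n.factorial : ℝ) ^ 2 * C) * (2 * A + 2 * (h ^ (2 * n) * D)) := by gcongr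
  have hA0 : 0 ≤ A := intervalIntegral.integral_nonneg hab fun _ _ => sq_nonneg _
  linarith

/-- The scaled interpolation inequality on `[0, T]`, at the scale `T / N`. -/
theorem exists_scaled_interpolation (n k : ℕ) (hk : k < n) :
    ∃ C, 0 ≤ C ∧ ∀ (T : ℝ) (N : ℕ) (φ : ℕ → ℝ → ℝ), 0 < T → 0 < N → IsDerivChain n 0 T φ →
      (T / N) ^ (2 * k) * ∫ t in (0 : ℝ)..T, φ k t ^ 2 ≤
        C * ((∫ t in (0 : ℝ)..T, φ 0 t ^ 2)
          + (T / N) ^ (2 * n) * ∫ t in (0 : ℝ)..T, φ n t ^ 2) := by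
  obtain ⟨C, hC, hloc⟩ := exists_local_interpolation n k hk
  refine ⟨C, hC, fun T N φ hT hN hφ => ?_⟩
  have hN' : (0 : ℝ) < N := by exact_mod_cast hN
  set h := T / N with hh
  have hh0 : 0 < h := by positivity
  have hNh : N * h = T := by rw [hh]; field_simp
  have hmono : ∀ i < N, IsDerivChain n (i * h) (i * h + h) φ := by
    intro i hi
    have hi' : (i : ℝ) + 1 ≤ N := by exact_mod_cast hi
    refine hφ.mono (by positivity) (by linarith) ?_
    rw [← hNh]
    nlinarith
  have hsum : ∀ f : ℝ → ℝ, IntervalIntegrable f volume 0 T →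
      ∑ i ∈ Finset.range N, ∫ t in (i * h)..(i * h + h), f t = ∫ t in (0 : ℝ)..T, f t := by
    intro f hf
    have h1 := intervalIntegral.sum_integral_adjacent_intervals (f := f) (μ := volume)
      (a := fun i : ℕ => (i : ℝ) * h) (n := N) (fun i hi => hf.mono_set (by
        have hi' : (i : ℝ) + 1 ≤ N := by exact_mod_cast hi
        rw [Set.uIcc_of_le hT.le, Set.uIcc_of_le (by push_cast; nlinarith)]
        refine Set.Icc_subset_Icc (by positivity) ?_
        push_cast
        rw [← hNh]
        nlinarith))
    simp only [Nat.cast_zero, zero_mul, hNh] at h1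
    rw [← h1]
    refine Finset.sum_congr rfl fun i _ => ?_
    congr 1
    push_cast
    ring
  have hc0 : Continuous (φ 0) := hφ.cont 0 (by omega)
  have hck : Continuous (φ k) := hφ.cont k hk
  rw [← hsum _ (Continuous.intervalIntegrable (by fun_prop) _ _),
    ← hsum _ (Continuous.intervalIntegrable (by fun_prop) _ _), ← hsum _ hφ.sq_int,
    Finset.mul_sum, Finset.mul_sum, ← Finset.sum_add_distrib, Finset.mul_sum]
  refine Finset.sum_le_sum fun i hi => ?_
  exact hloc (i * h) h φ hh0 (hmono i (Finset.mem_range.1 hi))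

/-- The interpolation inequality `‖φ⁽ᵏ⁾‖⁶ ≤ C D ‖φ‖⁴`, where `D` bounds the squares of the norms of
`φ` and `φ⁽³ᵏ⁾`. -/
theorem exists_interpolation (k : ℕ) (hk : 1 ≤ k) {T : ℝ} (hT : 0 < T) :
    ∃ C, 0 ≤ C ∧ ∀ (φ : ℕ → ℝ → ℝ) (D : ℝ), IsDerivChain (3 * k) 0 T φ →
      ∫ t in (0 : ℝ)..T, φ 0 t ^ 2 ≤ D → ∫ t in (0 : ℝ)..T, φ (3 * k) t ^ 2 ≤ D →
      (∫ t in (0 : ℝ)..T, φ k t ^ 2) ^ 3 ≤ C * D * (∫ t in (0 : ℝ)..T, φ 0 t ^ 2) ^ 2 := by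
  obtain ⟨C, hC, hs⟩ := exists_scaled_interpolation (3 * k) k (by omega)
  -- For a scale g ≤ 1, the step T / N with N = ⌈T / g⌉ lies between κ g and g.
  set κ := T / (T + 1) with hκ
  have hκ0 : 0 < κ := by positivity
  refine ⟨8 * C ^ 3 / κ ^ (6 * k), by positivity, fun φ D hφ h0 h3 => ?_⟩
  set A := ∫ t in (0 : ℝ)..T, φ k t ^ 2
  set B := ∫ t in (0 : ℝ)..T, φ 0 t ^ 2
  set R := ∫ t in (0 : ℝ)..T, φ (3 * k) t ^ 2
  have hA0 : 0 ≤ A := intervalIntegral.integral_nonneg hT.le fun _ _ => sq_nonneg _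
  have hB0 : 0 ≤ B := intervalIntegral.integral_nonneg hT.le fun _ _ => sq_nonneg _
  have hR0 : 0 ≤ R := intervalIntegral.integral_nonneg hT.le fun _ _ => sq_nonneg _
  -- The shift e > 0 keeps the quotient defining the scale positive and finite when B or D vanishes;
  -- it tends to 0 at the end.
  have key : ∀ e : ℝ, 0 < e →
      A ^ 3 ≤ 8 * C ^ 3 / κ ^ (6 * k) * (D + e) * (B + e) ^ 2 := by
    intro e he
    have hBe : 0 < B + e := by linarith
    have hDe : 0 < D + e := by linarith
    -- The scale that balances the two terms, g^{6k} (D + e) = B + e; it is at most 1 because B ≤ D.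
    set g := ((B + e) / (D + e)) ^ ((((6 * k : ℕ) : ℝ))⁻¹) with hg
    have hg0 : 0 < g := Real.rpow_pos_of_pos (by positivity) _
    have hgpow : g ^ (6 * k) = (B + e) / (D + e) :=
      Real.rpow_inv_natCast_pow (by positivity) (by omega)
    have hg1 : g ≤ 1 := by
      refine Real.rpow_le_one (by positivity) ?_ (by positivity)
      rw [div_le_one hDe]
      linarith
    set N := ⌈T / g⌉₊ with hN
    have hN0 : 0 < N := Nat.ceil_pos.2 (by positivity)
    have hN0' : (0 : ℝ) < N := by exact_mod_cast hN0
    have hNg : T / N ≤ g := by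
      rw [div_le_iff₀ hN0', mul_comm, ← div_le_iff₀ hg0]
      exact Nat.le_ceil _
    have hgN : κ * g ≤ T / N := by
      have h1 : (N : ℝ) < T / g + 1 := Nat.ceil_lt_add_one (by positivity)
      rw [le_div_iff₀ hN0', hκ, div_mul_eq_mul_div, div_mul_eq_mul_div, div_le_iff₀ (by positivity)]
      have h2 : g * N ≤ T + 1 := by
        have : g * N ≤ g * (T / g + 1) := by gcongr
        rw [mul_add, mul_div_cancel₀ _ hg0.ne'] at this
        linarith
      nlinarith
    have h1 := hs T N φ hT hN0 hφ
    have h2 : (κ * g) ^ (2 * k) * A ≤ 2 * C * (B + e) := by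
      calc (κ * g) ^ (2 * k) * A ≤ (T / N) ^ (2 * k) * A := by gcongr
        _ ≤ C * (B + (T / N) ^ (2 * (3 * k)) * R) := h1
        _ ≤ C * ((B + e) + g ^ (6 * k) * (D + e)) := by
            rw [show 2 * (3 * k) = 6 * k by ring]
            gcongr
            · linarith
            · linarith
        _ = 2 * C * (B + e) := by
            rw [hgpow]
            field_simp
            ring
    have h3 : ((κ * g) ^ (2 * k) * A) ^ 3 ≤ (2 * C * (B + e)) ^ 3 := by gcongr
    have h4 : ((κ * g) ^ (2 * k) * A) ^ 3 = κ ^ (6 * k) * ((B + e) / (D + e)) * A ^ 3 := by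
      rw [← hgpow]; ring
    rw [h4] at h3
    have h5 : A ^ 3 = (D + e) / (κ ^ (6 * k) * (B + e)) *
        (κ ^ (6 * k) * ((B + e) / (D + e)) * A ^ 3) := by
      field_simp
    have h6 : 8 * C ^ 3 / κ ^ (6 * k) * (D + e) * (B + e) ^ 2 =
        (D + e) / (κ ^ (6 * k) * (B + e)) * (2 * C * (B + e)) ^ 3 := by
      field_simp
      ring
    rw [h5, h6]
    gcongr
  have hlim : Filter.Tendsto
      (fun e : ℝ => 8 * C ^ 3 / κ ^ (6 * k) * (D + e) * (B + e) ^ 2) (nhdsWithin 0 (Set.Ioi 0))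
      (nhds (8 * C ^ 3 / κ ^ (6 * k) * (D + 0) * (B + 0) ^ 2)) := by
    refine (Continuous.tendsto ?_ 0).mono_left nhdsWithin_le_nhds
    fun_prop
  rw [add_zero, add_zero] at hlim
  exact ge_of_tendsto hlim (Filter.eventually_of_mem self_mem_nhdsWithin fun e he => key e he)

end IsDerivChain


/-! ### Continuous representatives of Sobolev functions on an interval -/

/-- Smooth functions with compact support in `(0, T)`. -/
structure IsTest (T : ℝ) (φ : ℝ → ℝ) : Prop where
  smooth : ContDiff ℝ ∞ φ
  compact : HasCompactSupport φ
  supp : tsupport φ ⊆ Set.Ioo 0 T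

namespace IsTest

variable {T : ℝ} {φ : ℝ → ℝ}

theorem deriv (h : IsTest T φ) : IsTest T (deriv φ) where
  smooth := (contDiff_infty_iff_deriv.1 h.smooth).2
  compact := h.compact.deriv
  supp := (tsupport_deriv_subset (𝕜 := ℝ)).trans h.supp

theorem eq_zero (h : IsTest T φ) {t : ℝ} (ht : t ∉ Set.Ioo 0 T) : φ t = 0 :=
  image_eq_zero_of_notMem_tsupport fun h' => ht (h.supp h')

theorem integrable_mul (h : IsTest T φ) {g : ℝ → ℝ} (hg : LocallyIntegrableOn g (Set.Ioo 0 T)) :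
    Integrable fun t => g t * φ t := by
  have h1 : IntegrableOn g (tsupport φ) := hg.integrableOn_compact_subset h.supp h.compact
  have h2 : IntegrableOn (fun t => g t * φ t) (tsupport φ) :=
    h1.mul_continuousOn h.smooth.continuous.continuousOn h.compact
  refine (integrableOn_iff_integrable_of_support_subset fun t ht => ?_).1 h2
  refine subset_tsupport φ ?_
  rw [Function.mem_support] at ht ⊢
  exact right_ne_zero_of_mul ht

theorem setIntegral_mul (h : IsTest T φ) (g : ℝ → ℝ) :
    ∫ t in Set.Ioo 0 T, g t * φ t = ∫ t, g t * φ t :=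
  setIntegral_eq_integral_of_forall_compl_eq_zero fun t ht => by rw [h.eq_zero ht, mul_zero]

theorem integrable (h : IsTest T φ) : Integrable φ :=
  h.smooth.continuous.integrable_of_hasCompactSupport h.compact

/-- A test function with vanishing integral has a primitive that is a test function. -/
theorem primitive (hT : 0 < T) (h : IsTest T φ) (h0 : ∫ t, φ t = 0) :
    IsTest T (fun t => ∫ s in (0 : ℝ)..t, φ s) ∧
      _root_.deriv (fun t => ∫ s in (0 : ℝ)..t, φ s) = φ := by
  have hd : ∀ t, HasDerivAt (fun t => ∫ s in (0 : ℝ)..t, φ s) (φ t) t := fun t =>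
    (h.smooth.continuous.integral_hasStrictDerivAt 0 t).hasDerivAt
  have hderiv : _root_.deriv (fun t => ∫ s in (0 : ℝ)..t, φ s) = φ := funext fun t => (hd t).deriv
  obtain ⟨a, b, ha, hb, hab⟩ : ∃ a b, 0 < a ∧ b < T ∧ tsupport φ ⊆ Set.Icc a b := by
    rcases (tsupport φ).eq_empty_or_nonempty with he | hne
    · exact ⟨T / 2, T / 2, by linarith, by linarith, by simp [he]⟩
    · obtain ⟨a, ha⟩ := h.compact.exists_isLeast hne
      obtain ⟨b, hb⟩ := h.compact.exists_isGreatest hne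
      exact ⟨a, b, (h.supp ha.1).1, (h.supp hb.1).2, fun t ht => ⟨ha.2 ht, hb.2 ht⟩⟩
  have hsupp : Function.support (fun t => ∫ s in (0 : ℝ)..t, φ s) ⊆ Set.Icc a b := by
    intro t ht
    by_contra hcon
    apply ht
    rw [Set.mem_Icc, not_and_or, not_le, not_le] at hcon
    rcases hcon with hlt | hlt
    · change ∫ s in (0 : ℝ)..t, φ s = 0
      rw [intervalIntegral.integral_congr (g := fun _ => 0) (fun s hs => ?_)]
      · simp
      · refine image_eq_zero_of_notMem_tsupport fun h' => ?_
        have h1 := (hab h').1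
        have h2 : s ≤ max 0 t := hs.2
        rcases le_max_iff.1 h2 with h3 | h3 <;> linarith
    · change ∫ s in (0 : ℝ)..t, φ s = 0
      rw [intervalIntegral.integral_eq_integral_of_support_subset, h0]
      intro s hs
      have h1 := hab (subset_tsupport _ hs)
      exact ⟨by linarith [h1.1], by linarith [h1.2]⟩
  have htsupp : tsupport (fun t => ∫ s in (0 : ℝ)..t, φ s) ⊆ Set.Icc a b :=
    closure_minimal hsupp isClosed_Icc
  refine ⟨⟨?_, ?_, ?_⟩, hderiv⟩
  · rw [contDiff_infty_iff_deriv, hderiv]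
    exact ⟨fun t => (hd t).differentiableAt, h.smooth⟩
  · exact HasCompactSupport.of_support_subset_isCompact isCompact_Icc hsupp
  · exact htsupp.trans fun t ht => ⟨by linarith [ht.1], by linarith [ht.2]⟩

theorem exists_integral_eq_one (hT : 0 < T) : ∃ η, IsTest T η ∧ ∫ t, η t = 1 := by
  let b : ContDiffBump (T / 2) := ⟨T / 8, T / 4, by linarith, by linarith⟩
  refine ⟨b.normed volume, ⟨b.contDiff_normed, b.hasCompactSupport_normed, ?_⟩, b.integral_normed⟩
  rw [b.tsupport_normed_eq, Real.closedBall_eq_Icc]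
  intro t ht
  have h1 : T / 2 - T / 4 ≤ t := ht.1
  have h2 : t ≤ T / 2 + T / 4 := ht.2
  exact ⟨by linarith, by linarith⟩

end IsTest

variable {T : ℝ}

theorem ae_eq_zero_of_forall_test {g : ℝ → ℝ} (hg : LocallyIntegrableOn g (Set.Ioo 0 T))
    (h : ∀ φ, IsTest T φ → ∫ t in Set.Ioo 0 T, g t * φ t = 0) :
    g =ᵐ[volume.restrict (Set.Ioo 0 T)] 0 := by
  rw [Filter.EventuallyEq, ae_restrict_iff' measurableSet_Ioo]
  refine isOpen_Ioo.ae_eq_zero_of_integral_contDiff_smul_eq_zero hg fun φ h1 h2 h3 => ?_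
  have hφ : IsTest T φ := ⟨h1, h2, h3⟩
  rw [← h φ hφ, hφ.setIntegral_mul]
  simp only [smul_eq_mul, mul_comm]

theorem locallyIntegrableOn_const_Ioo (c : ℝ) :
    LocallyIntegrableOn (fun _ : ℝ => c) (Set.Ioo 0 T) :=
  (locallyIntegrable_const c).locallyIntegrableOn _

/-- The du Bois-Reymond lemma. -/
theorem exists_ae_eq_const (hT : 0 < T) {g : ℝ → ℝ} (hg : LocallyIntegrableOn g (Set.Ioo 0 T))
    (h : ∀ φ, IsTest T φ → ∫ t in Set.Ioo 0 T, g t * deriv φ t = 0) :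
    ∃ c, g =ᵐ[volume.restrict (Set.Ioo 0 T)] fun _ => c := by
  obtain ⟨η, hη, hη1⟩ := IsTest.exists_integral_eq_one hT
  set c := ∫ t, g t * η t with hc
  refine ⟨c, ?_⟩
  have h1 : (fun t => g t - c) =ᵐ[volume.restrict (Set.Ioo 0 T)] 0 := by
    refine ae_eq_zero_of_forall_test (hg.sub (locallyIntegrableOn_const_Ioo c)) fun φ hφ => ?_
    set a := ∫ t, φ t with ha
    -- Removing the mean with η makes the function the derivative of a test function.
    have htest : IsTest T (fun t => φ t - a * η t) :=
      { smooth := hφ.smooth.sub (contDiff_const.mul hη.smooth)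
        compact := hφ.compact.sub (hη.compact.mul_left (f := fun _ => a))
        supp := by
          refine (tsupport_sub φ (fun t => a * η t)).trans (Set.union_subset hφ.supp ?_)
          exact (closure_mono (Function.support_mul_subset_right (fun _ => a) η)).trans hη.supp }
    have hint0 : ∫ t, (φ t - a * η t) = 0 := by
      rw [integral_sub hφ.integrable (hη.integrable.const_mul a), integral_const_mul, hη1]
      simp [ha]
    obtain ⟨hψ, hψd⟩ := htest.primitive hT hint0
    have h2 := h _ hψ
    rw [hψd, htest.setIntegral_mul] at h2
    rw [hφ.setIntegral_mul]
    have e1 : ∀ t, g t * (φ t - a * η t) = g t * φ t - a * (g t * η t) := fun t => by ring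
    have e2 : ∀ t, (g t - c) * φ t = g t * φ t - c * φ t := fun t => by ring
    simp only [e1] at h2
    rw [integral_sub (hφ.integrable_mul hg) ((hη.integrable_mul hg).const_mul a),
      integral_const_mul, ← hc] at h2
    simp only [e2]
    rw [integral_sub (hφ.integrable_mul hg) (hφ.integrable.const_mul c), integral_const_mul, ← ha]
    linarith
  filter_upwards [h1] with t ht
  simp only [Pi.zero_apply] at ht
  linarith

/-- As g is merely integrable, integration by parts is done for absolutely continuous functions. -/
theorem IsTest.integral_primitive_mul_deriv {φ : ℝ → ℝ} (h : IsTest T φ) (hT : 0 < T) {g : ℝ → ℝ}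
    (hg : IntervalIntegrable g volume 0 T) :
    ∫ t in Set.Ioo 0 T, (∫ s in (0 : ℝ)..t, g s) * _root_.deriv φ t =
      -∫ t in Set.Ioo 0 T, g t * φ t := by
  have hG := hg.absolutelyContinuousOnInterval_intervalIntegral (c := 0) (by simp)
  have hφ : AbsolutelyContinuousOnInterval φ 0 T :=
    (h.smooth.contDiffOn.of_le (by simp)).absolutelyContinuousOnInterval
  have key := hG.integral_mul_deriv_eq_deriv_mul hφ
  rw [h.eq_zero (t := T) (by simp), h.eq_zero (t := 0) (by simp), mul_zero, mul_zero, sub_zero,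
    zero_sub] at key
  rw [← integral_Ioc_eq_integral_Ioo, ← integral_Ioc_eq_integral_Ioo,
    ← intervalIntegral.integral_of_le hT.le, ← intervalIntegral.integral_of_le hT.le, key]
  congr 1
  refine intervalIntegral.integral_congr_ae ?_
  filter_upwards [hg.ae_hasDerivAt_integral] with t ht hmem
  rw [(ht (Set.uIoc_subset_uIcc hmem) 0 (by simp)).deriv]

theorem IsWeakDeriv.ae_eq {j : ℕ} {u v w : ℝ → ℝ} (hv : IsWeakDeriv T j u v)
    (hw : IsWeakDeriv T j u w) : v =ᵐ[volume.restrict (Set.Ioo 0 T)] w := by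
  have h := ae_eq_zero_of_forall_test (hv.2.1.sub hw.2.1) fun φ hφ => ?_
  · filter_upwards [h] with t ht
    simpa [sub_eq_zero] using ht
  · have h1 := hv.2.2 φ hφ.smooth hφ.compact hφ.supp
    rw [hw.2.2 φ hφ.smooth hφ.compact hφ.supp] at h1
    have h2 : ∫ t in Set.Ioo 0 T, w t * φ t = ∫ t in Set.Ioo 0 T, v t * φ t :=
      mul_left_cancel₀ (pow_ne_zero j (by norm_num)) h1
    have e : ∀ t, (v - w) t * φ t = v t * φ t - w t * φ t := fun t => by
      rw [Pi.sub_apply]; ring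
    simp only [e]
    rw [integral_sub (hφ.integrable_mul hv.2.1).integrableOn
      (hφ.integrable_mul hw.2.1).integrableOn, h2, sub_self]

theorem isWeakDeriv_zero_self {u : ℝ → ℝ} (hu : LocallyIntegrableOn u (Set.Ioo 0 T)) :
    IsWeakDeriv T 0 u u :=
  ⟨hu, hu, fun φ _ _ _ => by simp⟩

theorem MemH.isWeakDeriv {m : ℕ} {u : ℝ → ℝ} (h : MemH m T u) {j : ℕ} (hj : j ≤ m) :
    IsWeakDeriv T j u (weakDeriv T j u) := by
  have hex : ∃ v, IsWeakDeriv T j u v := (h j hj).imp fun _ hv => hv.1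
  rw [weakDeriv, dif_pos hex]
  exact hex.choose_spec

theorem MemH.memLp_weakDeriv {m : ℕ} {u : ℝ → ℝ} (h : MemH m T u) {j : ℕ} (hj : j ≤ m) :
    MemLp (weakDeriv T j u) 2 (volume.restrict (Set.Ioo 0 T)) := by
  obtain ⟨v, hv, hv2⟩ := h j hj
  exact hv2.ae_eq (hv.ae_eq (h.isWeakDeriv hj))

theorem MemH.intervalIntegrable_weakDeriv {m : ℕ} {u : ℝ → ℝ} (h : MemH m T u) (hT : 0 < T)
    {j : ℕ} (hj : j ≤ m) : IntervalIntegrable (weakDeriv T j u) volume 0 T := by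
  rw [intervalIntegrable_iff_integrableOn_Ioo_of_le hT.le]
  exact (h.memLp_weakDeriv hj).integrable (by norm_num)

/-- The difference of the j-th weak derivative and a primitive of the next one is orthogonal to all
derivatives of test functions, hence constant by du Bois-Reymond. -/
theorem MemH.exists_ae_eq_primitive {m : ℕ} {u : ℝ → ℝ} (h : MemH m T u) (hT : 0 < T) {j : ℕ}
    (hj : j < m) : ∃ c, weakDeriv T j u =ᵐ[volume.restrict (Set.Ioo 0 T)]
      fun t => c + ∫ s in (0 : ℝ)..t, weakDeriv T (j + 1) u s := by
  have hg := h.isWeakDeriv hj.le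
  have hg' := h.isWeakDeriv (Nat.succ_le_of_lt hj)
  have hint := h.intervalIntegrable_weakDeriv hT (Nat.succ_le_of_lt hj)
  have hGc : ContinuousOn (fun t => ∫ s in (0 : ℝ)..t, weakDeriv T (j + 1) u s)
      (Set.Ioo 0 T) := by
    have := intervalIntegral.continuousOn_primitive_interval' hint (by simp : (0 : ℝ) ∈ _)
    rw [Set.uIcc_of_le hT.le] at this
    exact this.mono Set.Ioo_subset_Icc_self
  have hGl : LocallyIntegrableOn (fun t => ∫ s in (0 : ℝ)..t, weakDeriv T (j + 1) u s)
      (Set.Ioo 0 T) := hGc.locallyIntegrableOn measurableSet_Ioo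
  have horth : ∀ φ, IsTest T φ → ∫ t in Set.Ioo 0 T, (weakDeriv T j u -
      fun t => ∫ s in (0 : ℝ)..t, weakDeriv T (j + 1) u s) t * deriv φ t = 0 := by
    intro φ hφ
    have h1 := hg.2.2 _ hφ.deriv.smooth hφ.deriv.compact hφ.deriv.supp
    have h2 := hg'.2.2 φ hφ.smooth hφ.compact hφ.supp
    rw [← iteratedDeriv_succ', h2, pow_succ, mul_assoc] at h1
    have h3 := mul_left_cancel₀ (pow_ne_zero j (by norm_num)) h1
    have h4 := hφ.integral_primitive_mul_deriv hT hint
    have e : ∀ t, (weakDeriv T j u - fun t => ∫ s in (0 : ℝ)..t, weakDeriv T (j + 1) u s) t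
        * deriv φ t = weakDeriv T j u t * deriv φ t
          - (∫ s in (0 : ℝ)..t, weakDeriv T (j + 1) u s) * deriv φ t := fun t => by
      rw [Pi.sub_apply]; ring
    simp only [e]
    rw [integral_sub (hφ.deriv.integrable_mul hg.2.1).integrableOn
      (hφ.deriv.integrable_mul hGl).integrableOn, h4, ← h3]
    ring
  obtain ⟨c, hc⟩ := exists_ae_eq_const hT (hg.2.1.sub hGl) horth
  refine ⟨c, ?_⟩
  filter_upwards [hc] with t ht
  simp only [Pi.sub_apply] at ht
  linarith

/-- A Sobolev function and its weak derivatives have representatives that form a chain of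
derivatives. -/
theorem MemH.exists_derivChain {m : ℕ} {u : ℝ → ℝ} (h : MemH m T u) (hT : 0 < T) :
    ∃ v, IsDerivChain m 0 T v ∧ u =ᵐ[volume.restrict (Set.Ioo 0 T)] v 0 ∧
      ∀ j ≤ m, v j =ᵐ[volume.restrict (Set.Ioo 0 T)] weakDeriv T j u := by
  have hex : ∀ j, ∃ c, j < m → weakDeriv T j u =ᵐ[volume.restrict (Set.Ioo 0 T)]
      fun t => c + ∫ s in (0 : ℝ)..t, weakDeriv T (j + 1) u s := by
    intro j
    by_cases hj : j < m
    · exact (h.exists_ae_eq_primitive hT hj).imp fun c hc _ => hc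
    · exact ⟨0, fun hj' => absurd hj' hj⟩
  choose c hc using hex
  -- Extension by zero makes the primitives continuous on the whole line, as a derivative chain
  -- requires.
  let g : ℕ → ℝ → ℝ := fun j => (Set.Ioo 0 T).indicator (weakDeriv T j u)
  have hgint : ∀ j ≤ m, Integrable (g j) := fun j hj => by
    rw [integrable_indicator_iff measurableSet_Ioo]
    exact (h.memLp_weakDeriv hj).integrable (by norm_num)
  have hgprim : ∀ j, ∀ t ∈ Set.Icc 0 T, ∫ s in (0 : ℝ)..t, g j s =
      ∫ s in (0 : ℝ)..t, weakDeriv T j u s := by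
    intro j t ht
    refine intervalIntegral.integral_congr_ae ?_
    filter_upwards [Measure.ae_ne volume T] with s hsT hs
    rw [Set.uIoc_of_le ht.1] at hs
    exact Set.indicator_of_mem (s := Set.Ioo 0 T)
      ⟨hs.1, lt_of_le_of_ne (hs.2.trans ht.2) hsT⟩ _
  let v : ℕ → ℝ → ℝ := fun j =>
    if j < m then fun t => c j + ∫ s in (0 : ℝ)..t, g (j + 1) s else weakDeriv T j u
  have hvlt : ∀ j < m, v j = fun t => c j + ∫ s in (0 : ℝ)..t, g (j + 1) s :=
    fun j hj => if_pos hj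
  have hvm : v m = weakDeriv T m u := if_neg (lt_irrefl m)
  have hvae : ∀ j ≤ m, v j =ᵐ[volume.restrict (Set.Ioo 0 T)] weakDeriv T j u := by
    intro j hj
    rcases hj.lt_or_eq with hj | rfl
    · refine Filter.EventuallyEq.trans ?_ (hc j hj).symm
      filter_upwards [ae_restrict_mem measurableSet_Ioo] with t ht
      rw [hvlt j hj]
      change c j + _ = _
      rw [hgprim _ t (Set.Ioo_subset_Icc_self ht)]
    · rw [hvm]
  refine ⟨v, ⟨fun j hj => ?_, ?_, ?_, fun j hj s hs t ht => ?_⟩, ?_, hvae⟩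
  · rw [hvlt j hj]
    exact continuous_const.add (intervalIntegral.continuous_primitive
      (fun _ _ => (hgint (j + 1) hj).intervalIntegrable) 0)
  · rw [hvm]
    exact h.intervalIntegrable_weakDeriv hT le_rfl
  · rw [hvm, intervalIntegrable_iff_integrableOn_Ioo_of_le hT.le]
    exact (h.memLp_weakDeriv le_rfl).integrable_sq
  · rw [hvlt j hj]
    have hi : ∀ a b, IntervalIntegrable (g (j + 1)) volume a b :=
      fun a b => (hgint (j + 1) hj).intervalIntegrable
    have e : c j + (∫ s in (0 : ℝ)..t, g (j + 1) s) - (c j + ∫ s in (0 : ℝ)..s, g (j + 1) s) =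
        ∫ x in s..t, g (j + 1) x := by
      rw [add_sub_add_left_eq_sub, intervalIntegral.integral_interval_sub_left (hi _ _) (hi _ _)]
    rw [e]
    refine intervalIntegral.integral_congr_ae ?_
    have h1 := (ae_restrict_iff' measurableSet_Ioo).1 (hvae (j + 1) hj)
    filter_upwards [h1, Measure.ae_ne volume T] with x hx hxT hmem
    have hx0 : x ∈ Set.Ioo 0 T := by
      rcases Set.mem_uIoc.1 hmem with h2 | h2
      · exact ⟨hs.1.trans_lt h2.1, lt_of_le_of_ne (h2.2.trans ht.2) hxT⟩
      · exact ⟨ht.1.trans_lt h2.1, lt_of_le_of_ne (h2.2.trans hs.2) hxT⟩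
    rw [hx hx0]
    exact Set.indicator_of_mem hx0 _
  · have h0 := h.isWeakDeriv (Nat.zero_le m)
    exact ((isWeakDeriv_zero_self h0.1).ae_eq h0).trans (hvae 0 (Nat.zero_le m)).symm


/-! ### The cubic remainder is absorbed by the drift -/

/-- With n = 2k this is the chain from the k-th primitive of the control up to its derivative of
order 2k, to which interpolation is applied. -/
theorem IsDerivChain.prepend_iterPrim {n : ℕ} {T : ℝ} {v : ℕ → ℝ → ℝ} (h : IsDerivChain n 0 T v)
    (hn : 0 < n) (k : ℕ) : IsDerivChain (k + n) 0 T
      (fun i => if i ≤ k then iterPrim (v 0) (k - i) else v (i - k)) := by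
  set φ : ℕ → ℝ → ℝ := fun i => if i ≤ k then iterPrim (v 0) (k - i) else v (i - k) with hφ
  have hle : ∀ i ≤ k, φ i = iterPrim (v 0) (k - i) := fun i hi => if_pos hi
  have hge : ∀ i, φ (k + i) = v i := by
    intro i
    rcases Nat.eq_zero_or_pos i with rfl | hi
    · rw [Nat.add_zero, hle _ le_rfl, Nat.sub_self]
      rfl
    · rw [hφ]
      dsimp only
      rw [if_neg (by omega), Nat.add_sub_cancel_left]
  have hv0 := h.cont 0 hn
  refine ⟨fun j hj => ?_, by rw [hge]; exact h.int, by rw [hge]; exact h.sq_int,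
    fun j hj s hs t ht => ?_⟩
  · rcases le_or_gt j k with hjk | hjk
    · rw [hle j hjk]
      exact continuous_iterPrim hv0 _
    · obtain ⟨i, rfl⟩ := Nat.exists_eq_add_of_le hjk.le
      rw [hge]
      exact h.cont i (by omega)
  · rcases lt_or_ge j k with hjk | hjk
    · obtain ⟨i, rfl⟩ := Nat.exists_eq_add_of_lt hjk
      rw [hle _ (by omega), hle _ (by omega), show j + i + 1 - j = i + 1 by omega,
        show j + i + 1 - (j + 1) = i by omega]
      have hi : ∀ a b, IntervalIntegrable (iterPrim (v 0) i) volume a b :=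
        fun a b => (continuous_iterPrim hv0 i).intervalIntegrable a b
      exact intervalIntegral.integral_interval_sub_left (hi _ _) (hi _ _)
    · obtain ⟨i, rfl⟩ := Nat.exists_eq_add_of_le hjk
      rw [hge, add_assoc, hge]
      exact h.eq i (by omega) s hs t ht

theorem sq_integral_abs_le {T : ℝ} (hT : 0 < T) (hT1 : T ≤ 1) {u : ℝ → ℝ} (hu : Continuous u) :
    (∫ t in (0 : ℝ)..T, |u t|) ^ 2 ≤ ∫ t in (0 : ℝ)..T, u t ^ 2 := by
  have h := sq_integral_le hT (hu.abs.intervalIntegrable 0 T) ((hu.abs.pow 2).intervalIntegrable 0 T)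
  simp only [sq_abs] at h
  have h0 : 0 ≤ ∫ t in (0 : ℝ)..T, u t ^ 2 :=
    intervalIntegral.integral_nonneg hT.le fun _ _ => sq_nonneg _
  nlinarith

theorem integral_sq_iterPrim_le {T : ℝ} (hT : 0 < T) (hT1 : T ≤ 1) {u : ℝ → ℝ} (hu : Continuous u)
    {k : ℕ} (hk : 1 ≤ k) :
    ∫ t in (0 : ℝ)..T, iterPrim u k t ^ 2 ≤ ∫ t in (0 : ℝ)..T, u t ^ 2 := by
  obtain ⟨i, rfl⟩ := Nat.exists_eq_add_of_le' hk
  have h : ∫ t in (0 : ℝ)..T, iterPrim u (i + 1) t ^ 2 ≤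
      ∫ _ in (0 : ℝ)..T, (∫ s in (0 : ℝ)..T, |u s|) ^ 2 :=
    intervalIntegral.integral_mono_on hT.le
      (((continuous_iterPrim hu _).pow 2).intervalIntegrable _ _)
      intervalIntegrable_const fun t ht => sq_le_sq' (abs_le.1 (abs_iterPrim_le hu hT1 i t ht)).1
        (abs_le.1 (abs_iterPrim_le hu hT1 i t ht)).2
  rw [intervalIntegral.integral_const, smul_eq_mul, sub_zero] at h
  have h2 := sq_integral_abs_le hT hT1 hu
  nlinarith [sq_nonneg (∫ s in (0 : ℝ)..T, |u s|)]

/-- The cube of the `L¹` norm of a control that is small in `H^{2k}` is small compared with the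
square of the `L²` norm of its `k`-th primitive. -/
theorem exists_cubic_le {k r : ℕ} (hk : 1 ≤ k) {T : ℝ} (hT : 0 < T) (hT1 : T ≤ 1) :
    ∃ C, 0 ≤ C ∧ ∀ (v : Fin r → ℕ → ℝ → ℝ) (ε : ℝ), 0 ≤ ε →
      (∀ ℓ, IsDerivChain (2 * k) 0 T (v ℓ)) →
      (∀ ℓ, ∫ t in (0 : ℝ)..T, v ℓ 0 t ^ 2 ≤ ε ^ 2) →
      (∀ ℓ, ∫ t in (0 : ℝ)..T, v ℓ (2 * k) t ^ 2 ≤ ε ^ 2) →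
      ∫ t in (0 : ℝ)..T, ∑ ℓ, |v ℓ 0 t| ≤ C * ε ∧
      (∫ t in (0 : ℝ)..T, ∑ ℓ, |v ℓ 0 t|) ^ 3 ≤
        C * ε * ∫ t in (0 : ℝ)..T, ∑ ℓ, iterPrim (v ℓ 0) k t ^ 2 := by
  obtain ⟨C, hC, hi⟩ := IsDerivChain.exists_interpolation k hk hT
  refine ⟨r + r ^ 2 * Real.sqrt C, by positivity, fun v ε hε hv h0 h2 => ?_⟩
  have hc : ∀ ℓ, Continuous (v ℓ 0) := fun ℓ => (hv ℓ).cont 0 (by omega)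
  have hki : ∀ ℓ, IntervalIntegrable (fun t => iterPrim (v ℓ 0) k t ^ 2) volume 0 T := fun ℓ =>
    ((continuous_iterPrim (hc ℓ) k).pow 2).intervalIntegrable _ _
  rw [intervalIntegral.integral_finsetSum fun ℓ _ => (hc ℓ).abs.intervalIntegrable _ _,
    intervalIntegral.integral_finsetSum fun ℓ _ => hki ℓ]
  set n : Fin r → ℝ := fun ℓ => ∫ t in (0 : ℝ)..T, |v ℓ 0 t| with hn
  set q : Fin r → ℝ := fun ℓ => ∫ t in (0 : ℝ)..T, iterPrim (v ℓ 0) k t ^ 2 with hq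
  have hn0 : ∀ ℓ, 0 ≤ n ℓ := fun ℓ =>
    intervalIntegral.integral_nonneg hT.le fun _ _ => abs_nonneg _
  have hq0 : ∀ ℓ, 0 ≤ q ℓ := fun ℓ =>
    intervalIntegral.integral_nonneg hT.le fun _ _ => sq_nonneg _
  have hny : ∀ ℓ, n ℓ ^ 2 ≤ ∫ t in (0 : ℝ)..T, v ℓ 0 t ^ 2 :=
    fun ℓ => sq_integral_abs_le hT hT1 (hc ℓ)
  have hnε : ∀ ℓ, n ℓ ≤ ε := fun ℓ =>
    (pow_le_pow_iff_left₀ (hn0 ℓ) hε two_ne_zero).1 ((hny ℓ).trans (h0 ℓ))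
  -- Interpolation with D = ε² gives n⁶ ≤ C ε² q²; the square root is then taken.
  have hn3 : ∀ ℓ, n ℓ ^ 3 ≤ Real.sqrt C * ε * q ℓ := by
    intro ℓ
    have hch := (hv ℓ).prepend_iterPrim (by omega) k
    rw [show k + 2 * k = 3 * k by ring] at hch
    have h := hi _ (ε ^ 2) hch
    have e3 : ¬ 3 * k ≤ k := by omega
    simp only [Nat.zero_le, if_true, le_refl, Nat.sub_zero, Nat.sub_self, e3, if_false,
      show 3 * k - k = 2 * k by omega] at h
    have h' := h ((integral_sq_iterPrim_le hT hT1 (hc ℓ) hk).trans (h0 ℓ)) (h2 ℓ)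
    refine (pow_le_pow_iff_left₀ (pow_nonneg (hn0 ℓ) 3) (by have := hq0 ℓ; positivity)
      two_ne_zero).1 ?_
    calc (n ℓ ^ 3) ^ 2 = (n ℓ ^ 2) ^ 3 := by ring
      _ ≤ (∫ t in (0 : ℝ)..T, v ℓ 0 t ^ 2) ^ 3 := by
        have := hny ℓ
        gcongr
      _ ≤ C * ε ^ 2 * q ℓ ^ 2 := h'
      _ = (Real.sqrt C * ε * q ℓ) ^ 2 := by
        rw [mul_pow, mul_pow, Real.sq_sqrt hC]
  have hq0' : 0 ≤ ∑ ℓ, q ℓ := Finset.sum_nonneg fun ℓ _ => hq0 ℓ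
  constructor
  · calc ∑ ℓ, n ℓ ≤ ∑ _ℓ : Fin r, ε := Finset.sum_le_sum fun ℓ _ => hnε ℓ
      _ = r * ε := by simp
      _ ≤ (r + r ^ 2 * Real.sqrt C) * ε := by
        gcongr
        have : 0 ≤ (r : ℝ) ^ 2 * Real.sqrt C := by positivity
        linarith
  · calc (∑ ℓ, n ℓ) ^ 3 ≤ (r : ℝ) ^ 2 * ∑ ℓ, n ℓ ^ 3 := by
          rcases Nat.eq_zero_or_pos r with rfl | hr
          · simp
          · have h := pow_sum_div_card_le_sum_pow (s := Finset.univ) (fun ℓ _ => hn0 ℓ) 2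
            have hr' : (0 : ℝ) < r := Nat.cast_pos.2 hr
            rw [Finset.card_univ, Fintype.card_fin, div_le_iff₀ (by positivity), mul_comm] at h
            exact h
      _ ≤ (r : ℝ) ^ 2 * ∑ ℓ, Real.sqrt C * ε * q ℓ := by
        gcongr with ℓ _
        exact hn3 ℓ
      _ = (r ^ 2 * Real.sqrt C) * ε * ∑ ℓ, q ℓ := by
        rw [← Finset.mul_sum]; ring
      _ ≤ (r + r ^ 2 * Real.sqrt C) * ε * ∑ ℓ, q ℓ := by
        gcongr
        have : (0 : ℝ) ≤ r := by positivity
        linarith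

/-- The `L²` norms of the derivatives of a continuous representative are bounded by the Sobolev
norm. -/
theorem integral_sq_le_of_normH_le {m r : ℕ} {T ε : ℝ} (hT : 0 < T) {u : Fin r → ℝ → ℝ}
    (hε : 0 ≤ ε) (h : normH m T u ≤ ε) (ℓ : Fin r) {j : ℕ} (hj : j ≤ m) {w : ℝ → ℝ}
    (hw : w =ᵐ[volume.restrict (Set.Ioo 0 T)] weakDeriv T j (u ℓ)) :
    ∫ t in (0 : ℝ)..T, w t ^ 2 ≤ ε ^ 2 := by
  rw [intervalIntegral.integral_of_le hT.le, integral_Ioc_eq_integral_Ioo]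
  have e : ∫ t in Set.Ioo 0 T, w t ^ 2 = ∫ t in Set.Ioo 0 T, weakDeriv T j (u ℓ) t ^ 2 :=
    integral_congr_ae (hw.fun_comp (· ^ 2))
  rw [e]
  rw [normH, Real.sqrt_le_left hε] at h
  have hnn : ∀ ℓ j, 0 ≤ ∫ t in Set.Ioo 0 T, weakDeriv T j (u ℓ) t ^ 2 :=
    fun ℓ j => integral_nonneg fun _ => sq_nonneg _
  refine le_trans ?_ h
  refine le_trans ?_ (Finset.single_le_sum (fun ℓ _ => Finset.sum_nonneg fun j _ => hnn ℓ j)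
    (Finset.mem_univ ℓ))
  exact Finset.single_le_sum (fun j _ => hnn ℓ j) (Finset.mem_range_succ_iff.2 hj)


/-! ### The obstruction to controllability -/

section

variable {d k r : ℕ} {Ω : TopologicalSpace.Opens (EuclideanSpace ℝ (Fin d))}

theorem SmoothVectorField.continuousOn (f : SmoothVectorField Ω) :
    ContinuousOn f.1 (Ω : Set (EuclideanSpace ℝ (Fin d))) := f.2.1.continuousOn

/-- Changing the control on a null set does not affect the integral equation; with a continuous
representative the integrand is continuous, so the solution is classical on (0, T). -/
theorem IsMildSolution.isTrajectory {f : Fin (r + 1) → SmoothVectorField Ω} {T : ℝ} (hT : 0 < T)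
    {u v : Fin r → ℝ → ℝ} {x : ℝ → EuclideanSpace ℝ (Fin d)} (h : IsMildSolution f T u x)
    (hv : ∀ ℓ, Continuous (v ℓ))
    (huv : ∀ ℓ, u ℓ =ᵐ[volume.restrict (Set.Ioo 0 T)] v ℓ) :
    IsTrajectory (f 0).1 (fun ℓ => (f ℓ.succ).1) T v x := by
  obtain ⟨hc, hΩ, hx⟩ := h
  set G : ℝ → EuclideanSpace ℝ (Fin d) :=
    fun t => (f 0).1 (x t) + ∑ ℓ : Fin r, v ℓ t • (f ℓ.succ).1 (x t) with hG
  have hGc : ContinuousOn G (Set.Icc 0 T) :=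
    ((f 0).continuousOn.comp hc hΩ).add (continuousOn_finsetSum _ fun ℓ _ =>
      (hv ℓ).continuousOn.smul ((f ℓ.succ).continuousOn.comp hc hΩ))
  have hxG : ∀ t ∈ Set.Icc 0 T, x t = ∫ s in (0 : ℝ)..t, G s := by
    intro t ht
    rw [hx t ht]
    refine intervalIntegral.integral_congr_ae ?_
    have h1 : ∀ᵐ s, ∀ ℓ, s ∈ Set.Ioo 0 T → u ℓ s = v ℓ s :=
      ae_all_iff.2 fun ℓ => (ae_restrict_iff' measurableSet_Ioo).1 (huv ℓ)
    filter_upwards [h1, Measure.ae_ne volume T] with s hs hsT hs0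
    rw [Set.uIoc_of_le ht.1] at hs0
    have hs' : s ∈ Set.Ioo 0 T := ⟨hs0.1, lt_of_le_of_ne (hs0.2.trans ht.2) hsT⟩
    simp only [hG, hs _ hs']
  refine ⟨hc, ?_, fun t ht => ?_⟩
  · rw [hx 0 ⟨le_rfl, hT.le⟩, intervalIntegral.integral_same]
  · have hmem : Set.Ioo 0 T ∈ nhds t := Ioo_mem_nhds ht.1 ht.2
    have hGo : ContinuousOn G (Set.Ioo 0 T) := hGc.mono Set.Ioo_subset_Icc_self
    have hd := intervalIntegral.integral_hasDerivAt_right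
      ((hGc.mono (Set.Icc_subset_Icc_right ht.2.le)).intervalIntegrable_of_Icc ht.1.le)
      (hGo.stronglyMeasurableAtFilter isOpen_Ioo t ht) (hGo.continuousAt hmem)
    exact hd.congr_of_eventuallyEq (Filter.eventually_of_mem hmem fun s hs =>
      hxG s (Set.Ioo_subset_Icc_self hs))

theorem exists_isBounded_jetOf (f : Fin (r + 1) → SmoothVectorField Ω) (hΩ : 0 ∈ Ω)
    (hf0 : (f 0).1 0 = 0) {P : EuclideanSpace ℝ (Fin d) →ₗ[ℝ] ℝ}
    (h0 : ∀ i j, i + j ≤ 2 * k - 2 → ∀ ℓ L, P ((jetOf f hΩ hf0).br i ℓ j L) = 0)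
    (hdef : ∀ a : Fin r → ℝ,
      ∑ ℓ, ∑ L, a ℓ * a L * P ((jetOf f hΩ hf0).br (k - 1) ℓ k L) = 0 → a = 0) :
    ∃ ρ K, (jetOf f hΩ hf0).IsBounded (f 0).1 (fun ℓ => (f ℓ.succ).1) k ρ K := by
  set J := jetOf f hΩ hf0 with hJ
  obtain ⟨K₁, hK₁, hcoeff⟩ := J.exists_coeff_bound P h0 hdef
  obtain ⟨K₂, hK₂, hdrift⟩ := ((f 0).taylor_two hΩ).exists_pos
  have hfield : ∀ ℓ : Fin r, ∃ c > 0, Asymptotics.IsBigOWith c (nhds 0)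
      (fun x => (f ℓ.succ).1 x - (f ℓ.succ).1 0 - fderiv ℝ (f ℓ.succ).1 0 x) fun x => ‖x‖ ^ 2 :=
    fun ℓ => ((f ℓ.succ).taylor_one hΩ).exists_pos
  choose K₃ hK₃ hfield using hfield
  have hev := hdrift.bound.and (Filter.eventually_all.2 fun ℓ => (hfield ℓ).bound)
  obtain ⟨ρ, hρ, hball⟩ := Metric.eventually_nhds_iff.1 hev
  set Sb := ∑ i ∈ Finset.range (k + 1), ∑ ℓ, ‖J.b i ℓ‖ with hSb
  set SD := ∑ i ∈ Finset.range (k + 1), ∑ ℓ, ‖J.D i ℓ‖ with hSD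
  have hb : ∀ i ≤ k, ∀ ℓ, ‖J.b i ℓ‖ ≤ Sb := fun i hi ℓ =>
    (Finset.single_le_sum (f := fun ℓ => ‖J.b i ℓ‖) (fun _ _ => norm_nonneg _)
      (Finset.mem_univ ℓ)).trans (Finset.single_le_sum (f := fun i => ∑ ℓ, ‖J.b i ℓ‖)
      (fun _ _ => Finset.sum_nonneg fun _ _ => norm_nonneg _) (Finset.mem_range_succ_iff.2 hi))
  have hD : ∀ i ≤ k, ∀ ℓ, ‖J.D i ℓ‖ ≤ SD := fun i hi ℓ =>
    (Finset.single_le_sum (f := fun ℓ => ‖J.D i ℓ‖) (fun _ _ => norm_nonneg _)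
      (Finset.mem_univ ℓ)).trans (Finset.single_le_sum (f := fun i => ∑ ℓ, ‖J.D i ℓ‖)
      (fun _ _ => Finset.sum_nonneg fun _ _ => norm_nonneg _) (Finset.mem_range_succ_iff.2 hi))
  have h3 : ∀ ℓ, K₃ ℓ ≤ ∑ ℓ, K₃ ℓ := fun ℓ =>
    Finset.single_le_sum (fun ℓ _ => (hK₃ ℓ).le) (Finset.mem_univ ℓ)
  have hSb0 : 0 ≤ Sb := Finset.sum_nonneg fun _ _ => Finset.sum_nonneg fun _ _ => norm_nonneg _
  have hSD0 : 0 ≤ SD := Finset.sum_nonneg fun _ _ => Finset.sum_nonneg fun _ _ => norm_nonneg _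
  have hS30 : 0 ≤ ∑ ℓ, K₃ ℓ := Finset.sum_nonneg fun ℓ _ => (hK₃ ℓ).le
  have hA0 := norm_nonneg J.A
  have hB0 := norm_nonneg J.B
  -- Halving ρ passes from the open ball of the Taylor bounds to a closed one.
  have hsmall : ∀ x : EuclideanSpace ℝ (Fin d), ‖x‖ ≤ min 1 (ρ / 2) → dist x 0 < ρ := by
    intro x hx
    rw [dist_zero_right]
    have := hx.trans (min_le_right _ _)
    linarith
  refine ⟨min 1 (ρ / 2), 1 + ‖J.A‖ + ‖J.B‖ + Sb + SD + K₁ + K₂ + ∑ ℓ, K₃ ℓ, by linarith,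
    lt_min one_pos (by linarith), min_le_left _ _, by linarith, by linarith,
    fun i hi ℓ => (hb i hi ℓ).trans (by linarith), fun i hi ℓ => (hD i hi ℓ).trans (by linarith),
    fun x hx => ?_, fun ℓ x hx => ?_, fun c i hi ℓ => (hcoeff c i hi ℓ).trans ?_⟩
  · have h := (hball (hsmall x hx)).1
    rw [hf0, sub_zero, norm_pow, norm_norm] at h
    refine h.trans (mul_le_mul_of_nonneg_right (by linarith) (by positivity))
  · have h := (hball (hsmall x hx)).2 ℓ
    rw [norm_pow, norm_norm] at h
    have eb : J.b 0 ℓ = (f ℓ.succ).1 0 := by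
      change (evalBracket f (X ℓ.succ)).1 0 = _
      rw [evalBracket_X]
    have eD : J.D 0 ℓ = fderiv ℝ (f ℓ.succ).1 0 := by
      change fderiv ℝ (evalBracket f (X ℓ.succ)).1 0 = _
      rw [evalBracket_X]
    rw [eb, eD]
    have := h3 ℓ
    refine h.trans (mul_le_mul_of_nonneg_right (by linarith) (by positivity))
  · exact mul_le_mul_of_nonneg_right (by linarith) (norm_nonneg _)

theorem quadForm_neg (f : Fin (r + 1) → SmoothVectorField Ω)
    (P : EuclideanSpace ℝ (Fin d) →ₗ[ℝ] ℝ) (a : Fin r → ℝ) :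
    quadForm f k (-P) a = -quadForm f k P a := by
  simp only [quadForm, LinearMap.neg_apply, neg_mul, Finset.sum_neg_distrib]
  ring

/-- For the target -s e with P(e) = 1, the drift estimate would give -s ≥ -s/2 with s > 0. -/
theorem not_isSTLC_of_quadForm_pos (hk : 1 ≤ k) (hr : 1 ≤ r) (hΩ : 0 ∈ Ω)
    (f : Fin (r + 1) → SmoothVectorField Ω) (hf0 : (f 0).1 0 = 0)
    {P : EuclideanSpace ℝ (Fin d) →ₗ[ℝ] ℝ} (hP : ∀ v ∈ spaceN f k, P v = 0)
    (hpos : ∀ a, a ≠ 0 → 0 < quadForm f k P a) : ¬ IsSTLC (2 * k) f := by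
  intro hstlc
  set J := jetOf f hΩ hf0 with hJ
  have hq : ∀ a : Fin r → ℝ, ∑ ℓ, ∑ L, a ℓ * a L * P (J.br (k - 1) ℓ k L) =
      2 * quadForm f k P a := sum_br_eq_quadForm f hΩ hf0 hk hP
  have hbr : ∀ n i j, i + j ≤ 2 * k - 2 → ∀ ℓ L, P ((J.A ^ n) (J.br i ℓ j L)) = 0 :=
    fun n i j hij ℓ L => apply_pow_br_eq_zero f hΩ hf0 hP n i j hij ℓ L
  obtain ⟨c, hc, hcq⟩ := exists_pos_mul_sum_sq_le
    (q := fun a : Fin r → ℝ => ∑ ℓ, ∑ L, a ℓ * a L * P (J.br (k - 1) ℓ k L)) (by fun_prop)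
    (fun t a => by
      simp only [Finset.mul_sum, Pi.smul_apply, smul_eq_mul]
      refine Finset.sum_congr rfl fun ℓ _ => Finset.sum_congr rfl fun L _ => ?_
      ring)
    (fun a ha => by
      have := hpos a ha
      rw [hq]
      linarith)
  obtain ⟨ρ, K, hJK⟩ := exists_isBounded_jetOf f hΩ hf0 (k := k) (P := P)
    (fun i j hij ℓ L => hbr 0 i j hij ℓ L) (fun a ha => by
      by_contra hne
      have := hpos a hne
      rw [hq] at ha
      linarith)
  obtain ⟨T, C, η, hT, hT1, hC, hη, hdrift⟩ := hJK.exists_drift_estimate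
    (P := LinearMap.toContinuousLinearMap P) hk (fun n ℓ => apply_b_eq_zero f hΩ hf0 hP n ℓ) hbr hc hcq
  obtain ⟨C', hC', hcubic⟩ := exists_cubic_le (r := r) hk hT hT1
  obtain ⟨e, he⟩ : ∃ e, P e = 1 := by
    obtain ⟨w, hw⟩ : ∃ w, P w ≠ 0 := by
      by_contra! hall
      have h1 := hpos (fun _ => 1) fun h => one_ne_zero (congrFun h ⟨0, hr⟩)
      simp [quadForm, hall] at h1
    exact ⟨(P w)⁻¹ • w, by rw [map_smul, smul_eq_mul, inv_mul_cancel₀ hw]⟩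
  -- The three conditions absorb the cubic error into (c/4) Q, meet the smallness threshold of the
  -- drift estimate, and make the error term with ‖x(T)‖ N at most s/4.
  obtain ⟨ε, hε, h1, h2, h3⟩ : ∃ ε > 0, C * C' * ε ≤ c / 4 ∧ C' * ε < η ∧
      C * ‖e‖ * (C' * ε) ≤ 1 / 4 := by
    have hev : ∀ᶠ ε in nhdsWithin (0 : ℝ) (Set.Ioi 0),
        C * C' * ε < c / 4 ∧ C' * ε < η ∧ C * ‖e‖ * (C' * ε) < 1 / 4 := by
      refine Filter.Eventually.filter_mono nhdsWithin_le_nhds ?_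
      refine .and ?_ (.and ?_ ?_) <;>
        refine ContinuousAt.eventually_lt (by fun_prop) continuousAt_const ?_ <;> simp <;>
        positivity
    obtain ⟨ε, h, hε⟩ := (hev.and self_mem_nhdsWithin).exists
    exact ⟨ε, hε, h.1.le, h.2.1, h.2.2.le⟩
  obtain ⟨δ, hδ, hreach⟩ := hstlc T hT ε hε
  obtain ⟨s, hs, h4, h5⟩ : ∃ s > 0, s * ‖e‖ < δ ∧ C * ‖e‖ * (s * ‖e‖) ≤ 1 / 4 := by
    have hev : ∀ᶠ s in nhdsWithin (0 : ℝ) (Set.Ioi 0),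
        s * ‖e‖ < δ ∧ C * ‖e‖ * (s * ‖e‖) < 1 / 4 := by
      refine Filter.Eventually.filter_mono nhdsWithin_le_nhds ?_
      refine .and ?_ ?_ <;>
        refine ContinuousAt.eventually_lt (by fun_prop) continuousAt_const ?_ <;> simp <;>
        positivity
    obtain ⟨s, h, hs⟩ := (hev.and self_mem_nhdsWithin).exists
    exact ⟨s, hs, h.1, h.2.le⟩
  have hnorm : ‖-(s • e)‖ = s * ‖e‖ := by rw [norm_neg, norm_smul, Real.norm_of_nonneg hs.le]
  obtain ⟨u, hu, hun, x, hx, hxT⟩ := hreach (-(s • e)) (by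
    rwa [mem_ball_zero_iff, hnorm])
  choose v hv huv hvj using fun ℓ => (hu ℓ).1.exists_derivChain hT
  have hvc : ∀ ℓ, Continuous (v ℓ 0) := fun ℓ => (hv ℓ).cont 0 (by omega)
  have htraj := hx.isTrajectory hT hvc huv
  obtain ⟨hN, hN3⟩ := hcubic v ε hε.le hv
    (fun ℓ => integral_sq_le_of_normH_le hT hε.le hun ℓ (Nat.zero_le _) (hvj ℓ 0 (Nat.zero_le _)))
    (fun ℓ => integral_sq_le_of_normH_le hT hε.le hun ℓ le_rfl (hvj ℓ _ le_rfl))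
  have hfin := hdrift (fun ℓ => v ℓ 0) x hvc htraj (hN.trans_lt h2)
  rw [hxT, hnorm, LinearMap.coe_toContinuousLinearMap', map_neg, map_smul, he, smul_eq_mul,
    mul_one] at hfin
  set N := ∫ t in (0 : ℝ)..T, ∑ ℓ, |v ℓ 0 t|
  set Q := ∫ t in (0 : ℝ)..T, ∑ ℓ, iterPrim (v ℓ 0) k t ^ 2
  have hQ : 0 ≤ Q := intervalIntegral.integral_nonneg hT.le fun _ _ =>
    Finset.sum_nonneg fun _ _ => sq_nonneg _
  have h6 : C * N ^ 3 ≤ c / 4 * Q := calc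
    C * N ^ 3 ≤ C * (C' * ε * Q) := by gcongr
    _ = C * C' * ε * Q := by ring
    _ ≤ c / 4 * Q := by gcongr
  have h7 : C * ‖e‖ * (N + s * ‖e‖) ≤ 1 / 2 := by
    have : C * ‖e‖ * N ≤ C * ‖e‖ * (C' * ε) := by gcongr
    linarith
  have h8 : C * (s * ‖e‖) * (N + s * ‖e‖) ≤ s * (1 / 2) := calc
    _ = s * (C * ‖e‖ * (N + s * ‖e‖)) := by ring
    _ ≤ s * (1 / 2) := by gcongr
  linarith

end

end QuadObstruction
end

theorem theorem3 (d k r : ℕ) (hk : 1 ≤ k) (hr : 1 ≤ r)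
    (Ω : TopologicalSpace.Opens (EuclideanSpace ℝ (Fin d))) (hΩ : 0 ∈ Ω)
    (f : Fin (r + 1) → QuadObstruction.SmoothVectorField Ω)
    (hf : ∀ i, AnalyticOnNhd ℝ (f i).1 (Ω : Set (EuclideanSpace ℝ (Fin d))))
    (hf0 : (f 0).1 0 = 0)
    (hP : ∃ P : EuclideanSpace ℝ (Fin d) →ₗ[ℝ] ℝ,
      (∀ v ∈ QuadObstruction.spaceN f k, P v = 0) ∧
      QuadObstruction.IsDefinite (QuadObstruction.quadForm f k P)) :
    ¬ QuadObstruction.IsSTLC (2 * k) f := by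
  obtain ⟨P, hP, hpos | hneg⟩ := hP
  · exact QuadObstruction.not_isSTLC_of_quadForm_pos hk hr hΩ f hf0 hP hpos
  -- The form is linear in P, so a negative definite one becomes positive definite for -P.
  · refine QuadObstruction.not_isSTLC_of_quadForm_pos hk hr hΩ f hf0 (P := -P)
      (fun v hv => by rw [LinearMap.neg_apply, hP v hv, neg_zero]) fun a ha => ?_
    rw [QuadObstruction.quadForm_neg]
    exact neg_pos.2 (hneg a ha)
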